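/- Let $n\ge 2$. Consider the $n\times n\times n$ Rubik's Cube with its $6n^2$ stickers, and let $\mathbf G\le \mathbf S_{6n^2}$ be the group of sticker permutations generated by the clockwise quarter turns $F_k,B_k,R_k,L_k,U_k,D_k$, $1\le k\le\lfloor n/2\rfloor$, of the $k$-th slice counted from the respective face (so the middle slice of an odd cube is not turned). A configuration is a permutation of the stickers obtained by disassembling the cube into its cubies and reassembling it so that every cubie is placed (after some rotation in space) in a position of its orbit under the moves. It is valid if it lies in $\mathbf G$, i.e. if it is reachable from the solved state by slice rotations. Let $\mathcal O(i,j)$ be the orbit of the cubie of the front face in row $i$ from the top and column $j$ from the left. A configuration induces permutations $\sigma$ of the 8 corners $\mathcal O(1,1)$; $\tau_s$ of the 12 single edges $\mathcal O(1,\frac{n+1}2)$ ($n$ odd); $\tau_{c_i}$ of the 24 coupled edges $\mathcal O(1,i)$, $\rho_{c_i}$ of the 24 center corners $\mathcal O(i,i)$, for $1<i\le\lfloor n/2\rfloor$; and $\rho_{e_{i,j}}$ of the 24 center edges $\mathcal O(i,j)$, for $1<i\le\lfloor n/2\rfloor$, $1<j\le\lceil n/2\rceil$, $j\ne i$. Its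 orientations are as follows. * $x\in\mathbb Z_3^{8}$: let white and yellow be the colors of the front and back faces; the entry of a corner is $0$ if its white or yellow sticker is on the front or back face, $1$ if that sticker is at the position next clockwise (as seen from outside the cube, at the corner now occupied) after the position on the front or back face, and $2$ otherwise. * $z\in\mathbb Z_2^{12}$ ($n$ odd): of the two sticker positions of each single edge, mark the one on the front or back face if the other is on the up or down face, the one on the up or down face if the other is on the right or left face, and the one on the right or left face if the other is on the front or back face; the entry of a single edge is $0$ if its sticker from the marked position is again in a marked position, and $1$ otherwise. * $y_i\in\mathbb Z_2^{24}$: on each side of each face there are two sticker positions of the coupled edges $\mathcal O(1,i)$; mark the one that comes second when going clockwise around the face (this marks one of the two sticker positions of each coupled edge); the entry of a coupled edge is $0$ if its sticker from the marked position is again in a marked position, and $1$ otherwise. Write $\operatorname{sgn}(\tau_i)=\operatorname{sgn}(\tau_{c_i})$ for $1<i\le\lfloor n/2\rfloor$ and, since the middle slice of an odd cube contains no coupled edges, $\operatorname{sgn}(\tau_{(n+1)/2})=1$ for odd $n$. **Theorem.** (a) If $n$ is odd, every configuration $(\sigma,\tau_s,\tau_{c_i},\rho_{c_i},\rho_{e_{i,j}},x,y_i,z)$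 satisfying the following conditions (for all $i$, $j$ in the ranges above) is valid: 1. $\operatorname{sgn}(\sigma)=\operatorname{sgn}(\tau_s)=\operatorname{sgn}(\rho_{c_i})$; 2. $\operatorname{sgn}(\rho_{e_{i,j}})=\operatorname{sgn}(\sigma)\operatorname{sgn}(\tau_i)\operatorname{sgn}(\tau_j)$; 3. the sum of the 8 entries of $x$ is $0$ in $\mathbb Z_3$; 4. the sum of the 12 entries of $z$ is $0$ in $\mathbb Z_2$; 5. $y_i=0$. (b) If $n$ is even, every configuration $(\sigma,\tau_{c_i},\rho_{c_i},\rho_{e_{i,j}},x,y_i)$ satisfying the following conditions (for all $i$, $j$ in the ranges above) is valid: 1. $\operatorname{sgn}(\sigma)=\operatorname{sgn}(\rho_{c_i})$; 2. $\operatorname{sgn}(\rho_{e_{i,j}})=\operatorname{sgn}(\sigma)\operatorname{sgn}(\tau_i)\operatorname{sgn}(\tau_j)$; 3. the sum of the 8 entries of $x$ is $0$ in $\mathbb Z_3$; 4. $y_i=0$. -/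

import Mathlib

namespace RubikCube

/-! ### Cubies and stickers

The axes `0, 1, 2` point to the right, up, and towards the viewer (a right-handed frame). A direction
is an axis with a sign (`true` is positive), and the six directions stand for the six faces. -/

/-- The six faces of the cube, given by their outward normals. -/
abbrev Dir := Fin 3 × Bool

/-- The right face. -/
abbrev faceR : Dir := (0, true)
/-- The left face. -/
abbrev faceL : Dir := (0, false)
/-- The up face. -/
abbrev faceU : Dir := (1, true)
/-- The down face. -/
abbrev faceD : Dir := (1, false)
/-- The front face. -/
abbrev faceF : Dir := (2, true)
/-- The back face. -/
abbrev faceB : Dir := (2, false)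

/-- The `n ^ 3` positions; coordinate `0` is at the left, bottom, back. -/
abbrev Pos (n : ℕ) := Fin 3 → Fin n

/-- The number (from `1` to `n`) of the slice containing `c`, counted from the face `d`. -/
def layer {n : ℕ} (c : Pos n) (d : Dir) : ℕ :=
  if d.2 then n - (c d.1 : ℕ) else (c d.1 : ℕ) + 1

/-- A cubie, identified with its position in the solved cube: a position on the outside. -/
abbrev Cubie (n : ℕ) := {c : Pos n // ∃ d : Dir, layer c d = 1}

/-- A sticker (position) is a face of a cubie on the outside of the cube: `(c, d)` is the sticker of
the cubie at `c` that lies on the face `d`. -/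
abbrev Sticker (n : ℕ) := {p : Pos n × Dir // layer p.1 p.2 = 1}

/-- The cubie carrying a sticker. -/
def Sticker.cubie {n : ℕ} (t : Sticker n) : Cubie n := ⟨t.1.1, t.1.2, t.2⟩

/-- The face on which a sticker lies. -/
def Sticker.dir {n : ℕ} (t : Sticker n) : Dir := t.1.2

/-! ### Quarter turns of the whole cube -/

/-- The quarter turn about axis `a` that takes axis `a + 1` to axis `a + 2`, acting on directions. -/
def quarterDir (a : Fin 3) : Equiv.Perm Dir where
  toFun d := if d.1 = a then d else if d.1 = a + 1 then (a + 2, d.2) else (a + 1, !d.2)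
  invFun d := if d.1 = a then d else if d.1 = a + 2 then (a + 1, d.2) else (a + 2, !d.2)
  left_inv := by revert a; decide
  right_inv := by revert a; decide

/-- The same quarter turn, acting on positions. -/
def quarterPos {n : ℕ} (a : Fin 3) : Equiv.Perm (Pos n) where
  toFun c b := if b = a then c a else if b = a + 1 then (c (a + 2)).rev else c (a + 1)
  invFun c b := if b = a then c a else if b = a + 1 then c (a + 2) else (c (a + 1)).rev
  left_inv c := by
    funext b
    fin_cases a <;> fin_cases b <;> simp
  right_inv c := by
    funext b
    fin_cases a <;> fin_cases b <;> simp

theorem layer_quarter {n : ℕ} (a : Fin 3) (c : Pos n) (e : Dir) :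
    layer (quarterPos a c) (quarterDir a e) = layer c e := by
  obtain ⟨b, s⟩ := e
  have h0 := (c 0).isLt
  have h1 := (c 1).isLt
  have h2 := (c 2).isLt
  fin_cases a <;> fin_cases b <;> cases s <;>
    simp [layer, quarterPos, quarterDir, Fin.val_rev] <;> omega

/-- The quarter turn of the whole cube that is clockwise as seen from the face `d`, on directions. -/
def cwDir (d : Dir) : Equiv.Perm Dir := if d.2 then (quarterDir d.1)⁻¹ else quarterDir d.1

/-- The quarter turn of the whole cube that is clockwise as seen from the face `d`, on positions. -/
def cwPos {n : ℕ} (d : Dir) : Equiv.Perm (Pos n) :=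
  if d.2 then (quarterPos d.1)⁻¹ else quarterPos d.1

theorem layer_cw {n : ℕ} (d : Dir) (c : Pos n) (e : Dir) :
    layer (cwPos d c) (cwDir d e) = layer c e := by
  obtain ⟨a, s⟩ := d
  cases s
  · simpa [cwPos, cwDir] using layer_quarter a c e
  · have h := layer_quarter a ((quarterPos a)⁻¹ c) ((quarterDir a)⁻¹ e)
    simpa [cwPos, cwDir] using h.symm

theorem cwDir_self (d : Dir) : cwDir d d = d := by
  revert d; decide

theorem layer_cw_self {n : ℕ} (d : Dir) (c : Pos n) : layer (cwPos d c) d = layer c d := by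
  have h := layer_cw d c d
  rwa [cwDir_self] at h

/-- The clockwise quarter turn of the whole cube, on cubies. -/
def cwCubie {n : ℕ} (d : Dir) : Equiv.Perm (Cubie n) :=
  (cwPos d).subtypeEquiv fun c => by
    constructor
    · rintro ⟨e, he⟩
      exact ⟨cwDir d e, (layer_cw d c e).trans he⟩
    · rintro ⟨e, he⟩
      refine ⟨(cwDir d)⁻¹ e, ?_⟩
      rw [← layer_cw d c]
      simpa using he

/-- The clockwise quarter turn of the whole cube, on stickers. -/
def cwSticker {n : ℕ} (d : Dir) : Equiv.Perm (Sticker n) :=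
  (Equiv.prodCongr (cwPos d) (cwDir d)).subtypeEquiv fun p => by
    rw [← layer_cw d p.1 p.2]
    rfl

/-! ### Slice rotations, moves, and the cube group -/

theorem layer_cwCubie {n : ℕ} (d : Dir) (c : Cubie n) : layer (cwCubie d c).1 d = layer c.1 d :=
  layer_cw_self d c.1

theorem layer_cwSticker {n : ℕ} (d : Dir) (t : Sticker n) :
    layer (cwSticker d t).1.1 d = layer t.1.1 d :=
  layer_cw_self d t.1.1

/-- The clockwise quarter turn of the `k`-th slice from the face `d`, on cubies. -/
def turnCubie {n : ℕ} (d : Dir) (k : ℕ) : Equiv.Perm (Cubie n) where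
  toFun c := if layer c.1 d = k then cwCubie d c else c
  invFun c := if layer c.1 d = k then (cwCubie d).symm c else c
  left_inv c := by
    by_cases h : layer c.1 d = k
    · simp [h, layer_cwCubie]
    · simp [h]
  right_inv c := by
    have h' := layer_cwCubie d ((cwCubie d).symm c)
    rw [Equiv.apply_symm_apply] at h'
    by_cases h : layer c.1 d = k
    · simp [h, ← h']
    · simp [h]

/-- The clockwise quarter turn of the `k`-th slice from the face `d`, on stickers. -/
def turnSticker {n : ℕ} (d : Dir) (k : ℕ) : Equiv.Perm (Sticker n) where
  toFun t := if layer t.1.1 d = k then cwSticker d t else t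
  invFun t := if layer t.1.1 d = k then (cwSticker d).symm t else t
  left_inv t := by
    by_cases h : layer t.1.1 d = k
    · simp [h, layer_cwSticker]
    · simp [h]
  right_inv t := by
    have h' := layer_cwSticker d ((cwSticker d).symm t)
    rw [Equiv.apply_symm_apply] at h'
    by_cases h : layer t.1.1 d = k
    · simp [h, ← h']
    · simp [h]

/-- The names of the slice rotations: a face and the number `1 ≤ k ≤ ⌊n / 2⌋` of a slice counted
from that face. The middle slice of an odd cube is not turned. -/
abbrev SliceRotation (n : ℕ) := Dir × {k : ℕ // 1 ≤ k ∧ k ≤ n / 2}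

/-- The group of moves: finite sequences of slice rotations and their inverses. -/
abbrev Moves (n : ℕ) := FreeGroup (SliceRotation n)

/-- The permutation of the stickers induced by a move. -/
def moveStickers (n : ℕ) : Moves n →* Equiv.Perm (Sticker n) :=
  FreeGroup.lift fun r => turnSticker r.1 r.2

/-- The permutation of the cubies induced by a move. -/
def moveCubies (n : ℕ) : Moves n →* Equiv.Perm (Cubie n) :=
  FreeGroup.lift fun r => turnCubie r.1 r.2

/-- The symmetry group of the `n × n × n` cube: all permutations of stickers caused by moves. -/
def cubeGroup (n : ℕ) : Subgroup (Equiv.Perm (Sticker n)) := (moveStickers n).range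

/-! ### The space of configurations -/

/-- The 24 rotations of space that preserve the axes, acting on directions. -/
def rotations : Subgroup (Equiv.Perm Dir) := Subgroup.closure (Set.range quarterDir)

/-- A configuration of the `n × n × n` cube: a permutation of the stickers (`perm t` is where the
sticker `t` of the solved cube is found) obtained by disassembling the cube and reassembling it so
that every cubie is put in a position of its orbit. The cubie `c` goes to `place c`, after a rotation
of the cubie in space. Every cubie has a sticker, so `place` is determined by `perm`. -/
structure Configuration (n : ℕ) where
  /-- Where the stickers go. -/
  perm : Equiv.Perm (Sticker n)
  /-- Where the cubies go. -/
  place : Equiv.Perm (Cubie n)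
  cubie_perm : ∀ t : Sticker n, Sticker.cubie (perm t) = place t.cubie
  rigid : ∀ c : Cubie n, ∃ R ∈ rotations, ∀ t : Sticker n, t.cubie = c →
    Sticker.dir (perm t) = R t.dir
  same_orbit : ∀ c : Cubie n, ∃ m : Moves n, moveCubies n m c = place c

/-- A configuration is valid if it is obtained from the solved state by slice rotations. -/
def Configuration.IsValid {n : ℕ} (s : Configuration n) : Prop := s.perm ∈ cubeGroup n

/-- The orbit, under all moves, of the cubie of the front face in row `i` from the top and column `j`
from the left (both counted from `1`). -/
def orbit (n i j : ℕ) : Set (Cubie n) :=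
  {c | ∃ c₀ : Cubie n, layer c₀.1 faceF = 1 ∧ layer c₀.1 faceU = i ∧ layer c₀.1 faceL = j ∧
    ∃ m : Moves n, moveCubies n m c₀ = c}

theorem Configuration.place_mem_orbit {n : ℕ} (s : Configuration n) (i j : ℕ) (c : Cubie n) :
    s.place c ∈ orbit n i j ↔ c ∈ orbit n i j := by
  obtain ⟨m, hm⟩ := s.same_orbit c
  rw [← hm]
  constructor
  · rintro ⟨c₀, h1, h2, h3, m', h⟩
    exact ⟨c₀, h1, h2, h3, m⁻¹ * m', by simp [h]⟩
  · rintro ⟨c₀, h1, h2, h3, m', h⟩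
    exact ⟨c₀, h1, h2, h3, m * m', by simp [h]⟩

/-- The permutation induced by a configuration on an orbit of cubies. -/
def Configuration.orbitPerm {n : ℕ} (s : Configuration n) (i j : ℕ) :
    Equiv.Perm (orbit n i j) :=
  s.place.subtypePerm (s.place_mem_orbit i j)

/-- The sign of a permutation of a finite type. -/
noncomputable def sgn {α : Type*} [Finite α] (f : Equiv.Perm α) : ℤˣ :=
  letI := Classical.decEq α
  letI := Fintype.ofFinite α
  Equiv.Perm.sign f

/-! ### The permutation coordinates of a configuration -/

namespace Configuration

variable {n : ℕ} (s : Configuration n)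

/-- The permutation `σ` of the 8 corners. -/
def sigma : Equiv.Perm (orbit n 1 1) := s.orbitPerm 1 1

/-- The permutation `τ_s` of the 12 single edges (of an odd cube). -/
def tauS : Equiv.Perm (orbit n 1 ((n + 1) / 2)) := s.orbitPerm 1 ((n + 1) / 2)

/-- The permutation `τ_{c_i}` of the 24 coupled edges in slice `i`, for `1 < i ≤ ⌊n / 2⌋`. -/
def tauC (i : ℕ) : Equiv.Perm (orbit n 1 i) := s.orbitPerm 1 i

/-- The permutation `ρ_{c_i}` of the 24 center corners in slice `i`, for `1 < i ≤ ⌊n / 2⌋`. -/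
def rhoC (i : ℕ) : Equiv.Perm (orbit n i i) := s.orbitPerm i i

/-- The permutation `ρ_{e_{i,j}}` of the 24 center edges in slices `i` and `j`, for
`1 < i ≤ ⌊n / 2⌋` and `1 < j ≤ ⌈n / 2⌉`, `j ≠ i`. -/
def rhoE (i j : ℕ) : Equiv.Perm (orbit n i j) := s.orbitPerm i j

/-- The sign of `τ_{c_i}`. The middle slice of an odd cube (`i = (n + 1) / 2`) has no coupled edges,
and the sign is then `1`. -/
noncomputable def sgnTau (i : ℕ) : ℤˣ := if i ≤ n / 2 then sgn (s.tauC i) else 1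

end Configuration

/-! ### The orientation coordinates of a configuration -/

/-- The outward unit normal of a face. -/
def normal (d : Dir) : Fin 3 → ℤ := Pi.single d.1 (if d.2 then 1 else -1)

/-- Twice the vector from the center of the cube to the center of the cubie at `c`. -/
def center {n : ℕ} (c : Pos n) : Fin 3 → ℤ := fun a => 2 * (c a : ℤ) + 1 - n

/-- The determinant of the normals of two faces and the position of a cubie. When `d` and `e` are
faces of a corner cubie, it is negative if and only if, seen from outside the cube, `e` follows `d`
in the clockwise order of the three faces of that cubie. -/
def handedness {n : ℕ} (c : Pos n) (d e : Dir) : ℤ :=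
  (Matrix.of ![normal d, normal e, center c]).det

/-- The orientation of a corner whose white or yellow sticker is at the sticker position `t` (white
and yellow being the colors of the front and back faces): `0` if `t` is on the front or back face,
`1` if it is next to such a position in the clockwise order at its corner, `2` otherwise. -/
noncomputable def cornerTwist {n : ℕ} (t : Sticker n) : ZMod 3 :=
  open Classical in
  if t.dir.1 = 2 then 0
  else if ∃ e : Dir, e.1 = 2 ∧ layer t.cubie.1 e = 1 ∧ handedness t.cubie.1 e t.dir < 0 then 1
  else 2

/-- The alternating pattern for single edges: of the two sticker positions of a single edge, one is
marked, namely that on the face with axis `a` when the other one is on a face with axis `a - 1`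
(so: on the front face above and below, on the right face in front and behind, and so on). -/
def SingleMark {n : ℕ} (t : Sticker n) : Prop :=
  ∃ e : Dir, e.1 = t.dir.1 - 1 ∧ layer t.cubie.1 e = 1

/-- The pattern for coupled edges: of the two sticker positions of a coupled edge, one is marked,
namely that which, of the two coupled edge stickers of the same orbit on the same side of its face,
comes second when one goes around that face clockwise. -/
def CoupledMark {n : ℕ} (t : Sticker n) : Prop :=
  ∃ e : Dir, e ≠ t.dir ∧ layer t.cubie.1 e = 1 ∧ handedness t.cubie.1 t.dir e < 0

/-- The white and yellow stickers of the corners, one for each of the 8 corners. -/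
abbrev CornerSticker (n : ℕ) := {t : Sticker n // t.cubie ∈ orbit n 1 1 ∧ t.dir.1 = 2}

/-- The marked stickers of the single edges, one for each of the 12 single edges. -/
abbrev SingleEdgeSticker (n : ℕ) :=
  {t : Sticker n // t.cubie ∈ orbit n 1 ((n + 1) / 2) ∧ SingleMark t}

/-- The marked stickers of the coupled edges in slice `i`, one for each of these 24 edges. -/
abbrev CoupledEdgeSticker (n i : ℕ) := {t : Sticker n // t.cubie ∈ orbit n 1 i ∧ CoupledMark t}

noncomputable instance (n : ℕ) : Fintype (CornerSticker n) := Fintype.ofFinite _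

noncomputable instance (n : ℕ) : Fintype (SingleEdgeSticker n) := Fintype.ofFinite _

namespace Configuration

variable {n : ℕ} (s : Configuration n)

/-- The corner orientations `x`, the corners being numbered by their white or yellow stickers. -/
noncomputable def x : CornerSticker n → ZMod 3 := fun t => cornerTwist (s.perm t.1)

/-- The coupled edge orientations `y_i`, for `1 < i ≤ ⌊n / 2⌋`, the coupled edges being numbered by
their marked stickers: `0` if and only if the marked sticker is in a marked position. -/
noncomputable def y (i : ℕ) : CoupledEdgeSticker n i → ZMod 2 := fun t =>
  open Classical in if CoupledMark (s.perm t.1) then 0 else 1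

/-- The single edge orientations `z`, the single edges being numbered by their marked stickers:
`0` if and only if the marked sticker is in a marked position. -/
noncomputable def z : SingleEdgeSticker n → ZMod 2 := fun t =>
  open Classical in if SingleMark (s.perm t.1) then 0 else 1

end Configuration

end RubikCube

/-!
The cube is described by *flags*: ordered pairs of perpendicular directions, which stand for the 24
rotations of the cube. A cubie lies in the orbit `orbit n i j` if and only if it has the layers
`1, i, j` along the frame of some flag (`mem_orbit_iff`), so questions about an orbit become questions
about flags that do not depend on `n` and can be decided.

**Permutations.** Let the cubie `p` be moved by a slice rotation `B`. Some motion `A` moves `p` but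
no other cubie of the slice of `B`, so the commutator of `A` and `B` permutes three cubies cyclically
and fixes the stickers of all others (`exists_three_cycle`). Here `A` may contain rotations of the
middle slice: such a rotation is a rotation of the whole cube followed by moves, hence normalizes the
group of moves (`turn_mem_normalizer`), and its commutators with moves are moves. By these three-cycles the
permutations of an orbit that are realized without disturbing the other orbits form a primitive group
containing a three-cycle, so by Jordan's theorem they include all even permutations
(`mem_supportedPerms_of_sgn`). The rotations of the front face and of the slices parallel to it
preserve the conditions on the signs (`SignCondition.frontTurn_mul`) and can be used to make the
permutations of the corners and of the coupled edges even; the conditions then force all other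
permutations to be even. Therefore every cubie can be moved to its place
(`SignCondition.exists_place_eq_one`).

**Orientations.** The sum of the orientations of the corners, or of the single edges, is additive
under composition of configurations and vanishes for slice rotations, so it is unchanged by moves
(`OrientationMeasure.sum_mul`, `OrientationMeasure.sum_ofMove_mul`). Suppose that `A` fixes all
stickers of a slice except those of one cubie, which it turns in its place. The commutator of `A` with
the rotation of the slice turns two cubies by opposite amounts
(`OrientationMeasure.exchange_of_motion`). Such an `A` exists for corners (`exchange_corner`) and for
single edges, where it uses the middle slice (`exchange_edge`). As the sum of the orientations is
zero, these exchanges correct all corners and single edges (`OrientationMeasure.exists_oriented`).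
Moves preserve the marks of the coupled edges (`coupledMark_turnSticker`), so a coupled edge in its
place with orientation zero is solved (`perm_eq_self_of_coupledMark`). Centers have only one sticker.
-/

namespace RubikCube

/-! ### Directions and flags -/

/-- The opposite of a direction. -/
def opp (d : Dir) : Dir := (d.1, !d.2)

/-- The cross product of two perpendicular directions, in the right-handed frame of the axes. -/
def cross (d e : Dir) : Dir := (-(d.1 + e.1), (d.2 == e.2) == (e.1 == d.1 + 1))

/-- A flag is an ordered pair of perpendicular directions. With their cross product they form a
right-handed frame, so flags correspond to the 24 rotations of the cube; the flag `(F, U)`, whose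
frame is `(F, U, L)`, stands for the identity. -/
abbrev Flag := {p : Dir × Dir // p.1.1 ≠ p.2.1}

/-- The third direction of the right-handed frame of a flag. -/
def Flag.third (p : Flag) : Dir := cross p.1.1 p.1.2

/-- The flag `(F, U)`. -/
def baseFlag : Flag := ⟨(faceF, faceU), by decide⟩

theorem cwDir_axis_ne (g : Dir) {d e : Dir} : d.1 ≠ e.1 → (cwDir g d).1 ≠ (cwDir g e).1 := by
  revert g d e; decide

/-- The action on flags of the clockwise quarter turn of the whole cube. -/
def cwFlag (g : Dir) (p : Flag) : Flag := ⟨(cwDir g p.1.1, cwDir g p.1.2), cwDir_axis_ne g p.2⟩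

theorem third_cwFlag (g : Dir) (p : Flag) : (cwFlag g p).third = cwDir g p.third := by
  revert g p; decide

theorem opp_opp (d : Dir) : opp (opp d) = d := by
  revert d; decide

theorem cwDir_opp_eq_inv (g : Dir) : cwDir (opp g) = (cwDir g)⁻¹ := by
  obtain ⟨a, s⟩ := g
  cases s <;> simp [cwDir, opp]

theorem cwPos_opp_eq_inv {n : ℕ} (g : Dir) : (cwPos (opp g) : Equiv.Perm (Pos n)) = (cwPos g)⁻¹ := by
  obtain ⟨a, s⟩ := g
  cases s <;> simp [cwPos, opp]

/-- Conjugating a quarter turn of the whole cube by another one, on directions. -/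
theorem cwDir_conj (g h d : Dir) : cwDir (cwDir g h) (cwDir g d) = cwDir g (cwDir h d) := by
  revert g h d; decide

/-! ### Layers -/

section
variable {n : ℕ}

theorem one_le_layer (c : Pos n) (d : Dir) : 1 ≤ layer c d := by
  have := (c d.1).isLt
  unfold layer; split_ifs <;> omega

theorem layer_le (c : Pos n) (d : Dir) : layer c d ≤ n := by
  have := (c d.1).isLt
  unfold layer; split_ifs <;> omega

theorem layer_opp (c : Pos n) (d : Dir) : layer c (opp d) = n + 1 - layer c d := by
  obtain ⟨a, s⟩ := d
  have := (c a).isLt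
  cases s
  · simp [layer, opp]
  · simp only [layer, opp]; simp; omega

theorem layer_add_layer_opp (c : Pos n) (d : Dir) : layer c d + layer c (opp d) = n + 1 := by
  have := layer_le c d
  rw [layer_opp]; omega

theorem coord_eq_of_layer_eq {c c' : Pos n} {d : Dir} (h : layer c d = layer c' d) :
    c d.1 = c' d.1 := by
  obtain ⟨a, s⟩ := d
  have h1 := (c a).isLt
  have h2 := (c' a).isLt
  apply Fin.ext
  cases s <;> simp [layer] at h ⊢ <;> omega

theorem pos_ext {c c' : Pos n} (h : ∀ d, layer c d = layer c' d) : c = c' :=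
  funext fun a => coord_eq_of_layer_eq (d := (a, true)) (h (a, true))

/-- The position `c` has the layers `i, j, k` along the three directions of the frame of `p`. -/
def HasLayers (c : Pos n) (p : Flag) (i j k : ℕ) : Prop :=
  layer c p.1.1 = i ∧ layer c p.1.2 = j ∧ layer c p.third = k

theorem third_axis_ne (p : Flag) : p.third.1 ≠ p.1.1.1 ∧ p.third.1 ≠ p.1.2.1 := by
  revert p; decide

theorem flag_axes (p : Flag) (a : Fin 3) : a = p.1.1.1 ∨ a = p.1.2.1 ∨ a = p.third.1 := by
  revert p a; decide

theorem flag_dirs (p : Flag) (d : Dir) : d = p.1.1 ∨ d = p.1.2 ∨ d = p.third ∨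
    d = opp p.1.1 ∨ d = opp p.1.2 ∨ d = opp p.third := by
  revert p d; decide

theorem HasLayers.unique {c c' : Pos n} {p : Flag} {i j k : ℕ} (h : HasLayers c p i j k)
    (h' : HasLayers c' p i j k) : c = c' := by
  funext a
  rcases flag_axes p a with rfl | rfl | rfl
  · exact coord_eq_of_layer_eq (h.1.trans h'.1.symm)
  · exact coord_eq_of_layer_eq (h.2.1.trans h'.2.1.symm)
  · exact coord_eq_of_layer_eq (h.2.2.trans h'.2.2.symm)

theorem HasLayers.cw {c : Pos n} {p : Flag} {i j k : ℕ} (h : HasLayers c p i j k) (g : Dir) :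
    HasLayers (cwPos g c) (cwFlag g p) i j k := by
  refine ⟨?_, ?_, ?_⟩
  · exact (layer_cw g c _).trans h.1
  · exact (layer_cw g c _).trans h.2.1
  · rw [third_cwFlag, layer_cw]; exact h.2.2

theorem exists_coord {i : ℕ} (hi : 1 ≤ i) (hi' : i ≤ n) (d : Dir) :
    ∃ x : Fin n, ∀ c : Pos n, c d.1 = x → layer c d = i := by
  obtain ⟨a, s⟩ := d
  cases s
  · exact ⟨⟨i - 1, by omega⟩, fun c hc => by simp [layer] at hc ⊢; rw [hc]; simp; omega⟩
  · exact ⟨⟨n - i, by omega⟩, fun c hc => by simp [layer] at hc ⊢; rw [hc]; simp; omega⟩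

theorem exists_hasLayers (p : Flag) {i j k : ℕ} (hi : 1 ≤ i) (hi' : i ≤ n) (hj : 1 ≤ j)
    (hj' : j ≤ n) (hk : 1 ≤ k) (hk' : k ≤ n) : ∃ c : Pos n, HasLayers c p i j k := by
  obtain ⟨x, hx⟩ := exists_coord hi hi' p.1.1
  obtain ⟨y, hy⟩ := exists_coord hj hj' p.1.2
  obtain ⟨z, hz⟩ := exists_coord hk hk' p.third
  have h12 : p.1.2.1 ≠ p.1.1.1 := p.2.symm
  obtain ⟨h13, h23⟩ := third_axis_ne p
  refine ⟨fun a => if a = p.1.1.1 then x else if a = p.1.2.1 then y else z, hx _ ?_, hy _ ?_,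
    hz _ ?_⟩
  · simp
  · simp [h12]
  · simp [h13, h23]

theorem layer_cwPos (g : Dir) (c : Pos n) (d : Dir) :
    layer (cwPos g c) d = layer c (cwDir (opp g) d) := by
  rw [← layer_cw g c, cwDir_opp_eq_inv]
  simp

/-- Conjugating a quarter turn of the whole cube by another one, on positions. -/
theorem cwPos_conj (g h : Dir) (c : Pos n) :
    cwPos (cwDir g h) (cwPos g c) = cwPos g (cwPos h c) := by
  have key : ∀ d, layer (cwPos (cwDir g h) (cwPos g c)) (cwDir g (cwDir h d)) =
      layer (cwPos g (cwPos h c)) (cwDir g (cwDir h d)) := fun d => by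
    rw [layer_cw, layer_cw, ← cwDir_conj, layer_cw, layer_cw]
  refine pos_ext fun d => ?_
  simpa using key ((cwDir h)⁻¹ ((cwDir g)⁻¹ d))

/-! ### Orbits -/

theorem turnCubie_apply (d : Dir) (k : ℕ) (c : Cubie n) :
    turnCubie d k c = if layer c.1 d = k then cwCubie d c else c := rfl

theorem turnSticker_apply (d : Dir) (k : ℕ) (t : Sticker n) :
    turnSticker d k t = if layer t.1.1 d = k then cwSticker d t else t := rfl

theorem turnCubie_of_ne {d : Dir} {k : ℕ} {c : Cubie n} (h : layer c.1 d ≠ k) :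
    turnCubie d k c = c := if_neg h

theorem turnSticker_of_ne {d : Dir} {k : ℕ} {t : Sticker n} (h : layer t.1.1 d ≠ k) :
    turnSticker d k t = t := if_neg h

theorem cubie_turnSticker (d : Dir) (k : ℕ) (t : Sticker n) :
    (turnSticker d k t).cubie = turnCubie d k t.cubie := by
  rw [turnCubie_apply, turnSticker_apply]
  by_cases h : layer t.1.1 d = k
  · rw [if_pos h, if_pos (show layer t.cubie.1 d = k from h)]; rfl
  · rw [if_neg h, if_neg (show ¬ layer t.cubie.1 d = k from h)]

/-- An invariant of all slice rotations is an invariant of all moves. -/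
theorem moveCubies_invariant (Q : Cubie n → Prop)
    (h : ∀ (r : SliceRotation n) c, Q (turnCubie r.1 r.2 c) ↔ Q c) (m : Moves n) :
    ∀ c, Q (moveCubies n m c) ↔ Q c := by
  induction m using FreeGroup.induction_on with
  | C1 => simp
  | of r => intro c; simpa [moveCubies] using h r c
  | inv_of r _ =>
    intro c
    have := h r ((turnCubie r.1 r.2)⁻¹ c)
    simpa [moveCubies] using this.symm
  | mul x y hx hy => intro c; rw [map_mul, Equiv.Perm.mul_apply, hx, hy]

theorem moveCubies_of (r : SliceRotation n) :
    moveCubies n (FreeGroup.of r) = turnCubie r.1 r.2 := by simp [moveCubies]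

theorem moveStickers_of (r : SliceRotation n) :
    moveStickers n (FreeGroup.of r) = turnSticker r.1 r.2 := by simp [moveStickers]

theorem turnCubie_mem_orbit {i j : ℕ} {c : Cubie n} (hc : c ∈ orbit n i j) (r : SliceRotation n) :
    turnCubie r.1 r.2 c ∈ orbit n i j := by
  obtain ⟨c₀, h1, h2, h3, m, hm⟩ := hc
  exact ⟨c₀, h1, h2, h3, FreeGroup.of r * m, by rw [map_mul, moveCubies_of, Equiv.Perm.mul_apply, hm]⟩

/-- The quarter turns about the first and about the second direction of a frame lead from any
flag to every flag. -/
theorem flag_induction {Q : Flag → Prop} (h0 : Q baseFlag)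
    (h1 : ∀ p, Q p → Q (cwFlag p.1.1 p)) (h2 : ∀ p, Q p → Q (cwFlag p.1.2 p)) (p : Flag) : Q p := by
  have it : ∀ (f : Flag → Flag), (∀ p, Q p → Q (f p)) → ∀ (a : ℕ) p, Q p → Q (f^[a] p) := by
    intro f hf a
    induction a with
    | zero => exact fun p hp => hp
    | succ a ih => exact fun p hp => ih _ (hf p hp)
  have key : ∀ p : Flag, ∃ a b c : Fin 4, p = (fun p => cwFlag p.1.1 p)^[a]
      ((fun p => cwFlag p.1.2 p)^[b] ((fun p => cwFlag p.1.1 p)^[c] baseFlag)) := by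
    decide +kernel
  obtain ⟨a, b, c, rfl⟩ := key p
  exact it _ h1 _ _ (it _ h2 _ _ (it _ h1 _ _ h0))

/-- The orbit of a cubie consists of the cubies that have the same three layers along some
right-handed frame. -/
theorem mem_orbit_iff {i j : ℕ} (hi : 1 ≤ i) (hi' : i ≤ n / 2) (c : Cubie n) :
    c ∈ orbit n i j ↔ ∃ p, HasLayers c.1 p 1 i j := by
  constructor
  · rintro ⟨c₀, h1, h2, h3, m, rfl⟩
    rw [moveCubies_invariant (fun c => ∃ p, HasLayers c.1 p 1 i j)]
    · exact ⟨baseFlag, h1, h2, h3⟩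
    · intro r c
      rw [turnCubie_apply]
      split_ifs
      · constructor
        · rintro ⟨p, hp⟩
          refine ⟨cwFlag (opp r.1) p, ?_⟩
          have := hp.cw (opp r.1)
          rw [cwPos_opp_eq_inv] at this
          have e : (cwPos r.1)⁻¹ (cwCubie r.1 c).1 = c.1 := Equiv.symm_apply_apply (cwPos r.1) c.1
          rwa [e] at this
        · rintro ⟨p, hp⟩
          exact ⟨cwFlag r.1 p, hp.cw _⟩
      · rfl
  · rintro ⟨p, hp⟩
    revert c
    refine flag_induction (Q := fun p => ∀ c : Cubie n, HasLayers c.1 p 1 i j → c ∈ orbit n i j)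
      ?_ ?_ ?_ p
    · intro c hc
      exact ⟨c, hc.1, hc.2.1, hc.2.2, 1, by simp⟩
    all_goals
      intro p ih c hc
    · let c' := (cwCubie p.1.1).symm c
      have hcc : c = cwCubie p.1.1 c' := (Equiv.apply_symm_apply _ _).symm
      have h' : HasLayers c'.1 p 1 i j := by
        obtain ⟨h1, h2, h3⟩ := hc
        rw [hcc] at h1 h2 h3
        rw [third_cwFlag] at h3
        exact ⟨(layer_cw _ c'.1 _).symm.trans h1, (layer_cw _ c'.1 _).symm.trans h2,
          (layer_cw _ c'.1 _).symm.trans h3⟩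
      have := turnCubie_mem_orbit (ih c' h') (p.1.1, ⟨1, le_rfl, by omega⟩)
      rwa [turnCubie_apply, if_pos h'.1, ← hcc] at this
    · let c' := (cwCubie p.1.2).symm c
      have hcc : c = cwCubie p.1.2 c' := (Equiv.apply_symm_apply _ _).symm
      have h' : HasLayers c'.1 p 1 i j := by
        obtain ⟨h1, h2, h3⟩ := hc
        rw [hcc] at h1 h2 h3
        rw [third_cwFlag] at h3
        exact ⟨(layer_cw _ c'.1 _).symm.trans h1, (layer_cw _ c'.1 _).symm.trans h2,
          (layer_cw _ c'.1 _).symm.trans h3⟩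
      have := turnCubie_mem_orbit (ih c' h') (p.1.2, ⟨i, hi, hi'⟩)
      rwa [turnCubie_apply, if_pos h'.2.1, ← hcc] at this

theorem mk_mem_orbit {i j : ℕ} (hi : 1 ≤ i) (hi' : i ≤ n / 2) {c : Pos n}
    {p : Flag} (h : HasLayers c p 1 i j) : (⟨c, p.1.1, h.1⟩ : Cubie n) ∈ orbit n i j :=
  (mem_orbit_iff hi hi' _).2 ⟨p, h⟩

/-- Every direction is the first one of a flag, and the flag can be rotated about it. -/
theorem exists_flag (d : Dir) : ∃ e : Dir, d.1 ≠ e.1 ∧ d.1 ≠ (cross d e).1 ∧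
    cross d (cross d e) = opp e := by
  revert d; decide

/-- Every cubie lies in one of the orbits that carry a coordinate, or is the fixed center of a
face of an odd cube. -/
theorem exists_orbit (hn : 2 ≤ n) (c : Cubie n) :
    (∃ i j, 1 ≤ i ∧ i ≤ n / 2 ∧ 1 ≤ j ∧ j ≤ (n + 1) / 2 ∧ (j = 1 → i = 1) ∧ c ∈ orbit n i j) ∨
      ∀ m, moveCubies n m c = c := by
  obtain ⟨d, hd⟩ := c.2
  obtain ⟨e, he1, he2, he3⟩ := exists_flag d
  have l1 := one_le_layer c.1 e
  have l2 := one_le_layer c.1 (cross d e)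
  have o1 := layer_add_layer_opp c.1 e
  have o2 := layer_add_layer_opp c.1 (cross d e)
  have key : ∀ p : Flag, p.1.1 = d → layer c.1 p.1.2 ≤ n / 2 → layer c.1 p.third ≤ (n + 1) / 2 →
      ∃ i j, 1 ≤ i ∧ i ≤ n / 2 ∧ 1 ≤ j ∧ j ≤ (n + 1) / 2 ∧ (j = 1 → i = 1) ∧ c ∈ orbit n i j := by
    intro p hp h1 h2
    by_cases hj : layer c.1 p.third = 1
    · refine ⟨1, layer c.1 p.1.2, le_rfl, by omega, one_le_layer _ _, by omega, fun _ => rfl, ?_⟩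
      -- the frame is rotated cyclically, so that the layers `1, i, 1` become `1, 1, i`
      have aux : ∀ p : Flag, p.third.1 ≠ p.1.1.1 ∧ cross p.third p.1.1 = p.1.2 := by decide
      exact (mem_orbit_iff le_rfl (by omega) c).2
        ⟨⟨(p.third, p.1.1), (aux p).1⟩, hj, hp ▸ hd, by
          show layer c.1 (cross p.third p.1.1) = _
          rw [(aux p).2]⟩
    · exact ⟨layer c.1 p.1.2, layer c.1 p.third, one_le_layer _ _, h1, one_le_layer _ _, h2,
        fun h => absurd h hj, (mem_orbit_iff (one_le_layer _ _) h1 c).2 ⟨p, hp ▸ hd, rfl, rfl⟩⟩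
  have aux : ∀ d e : Dir, d.1 ≠ e.1 → d.1 ≠ (cross d e).1 → cross d (cross d e) = opp e →
      cross d (opp e) = opp (cross d e) ∧ cross d (opp (cross d e)) = e := by decide
  obtain ⟨he4, he5⟩ := aux d e he1 he2 he3
  have k1 := key ⟨(d, e), he1⟩ rfl
  have k2 := key ⟨(d, cross d e), he2⟩ rfl
  have k3 := key ⟨(d, opp e), he1⟩ rfl
  have k4 := key ⟨(d, opp (cross d e)), he2⟩ rfl
  simp only [Flag.third, he3, he4, he5] at k1 k2 k3 k4
  by_cases hm : layer c.1 e = layer c.1 (opp e) ∧ layer c.1 (cross d e) = layer c.1 (opp (cross d e))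
  · right
    have fix : ∀ d : Dir, ∀ e, d.1 ≠ e.1 → ∀ g, g = d ∨ g = opp d ∨ g = e ∨ g = opp e ∨
        g = cross d e ∨ g = opp (cross d e) := by decide
    intro m
    refine (moveCubies_invariant (fun c' => c' = c) ?_ m c).2 rfl
    have hturn : ∀ r : SliceRotation n, turnCubie r.1 r.2 c = c := by
      intro r
      rw [turnCubie_apply]
      split_ifs with hr
      · have hr2 := r.2.2
        have h6 : r.1 = d ∨ r.1 = opp d := by
          rcases fix d e he1 r.1 with h | h | h | h | h | h
          · exact Or.inl h
          · exact Or.inr h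
          all_goals rw [h] at hr; omega
        have a1 : ∀ d e, d.1 ≠ e.1 → cwDir (opp d) d = d ∧ cwDir (opp d) e = cross d e ∧
            cwDir (opp d) (cross d e) = opp e ∧ cwDir d d = d ∧ cwDir d e = opp (cross d e) ∧
            cwDir d (cross d e) = e := by decide
        obtain ⟨b1, b2, b3, b4, b5, b6⟩ := a1 d e he1
        apply Subtype.ext
        refine HasLayers.unique (p := ⟨(d, e), he1⟩) (i := layer c.1 d) (j := layer c.1 e)
          (k := layer c.1 (cross d e)) ⟨?_, ?_, ?_⟩ ⟨rfl, rfl, rfl⟩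
        all_goals
          show layer (cwPos r.1 c.1) _ = _
          rw [layer_cwPos]
          simp only [Flag.third]
          rcases h6 with h | h <;> rw [h] <;> simp only [opp_opp, b1, b2, b3, b4, b5, b6] <;> omega
      · rfl
    intro r c'
    constructor
    · intro h
      rw [← hturn r] at h
      exact (turnCubie r.1 r.2).injective h
    · rintro rfl; exact hturn r
  · left
    by_cases h1 : layer c.1 e ≤ n / 2 ∧ layer c.1 (cross d e) ≤ (n + 1) / 2
    · exact k1 h1.1 h1.2
    by_cases h2 : layer c.1 (cross d e) ≤ n / 2 ∧ layer c.1 (opp e) ≤ (n + 1) / 2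
    · exact k2 h2.1 h2.2
    by_cases h3 : layer c.1 (opp e) ≤ n / 2 ∧ layer c.1 (opp (cross d e)) ≤ (n + 1) / 2
    · exact k3 h3.1 h3.2
    · exact k4 (by omega) (by omega)

end

/-! ### The group of configurations -/

section
variable {n : ℕ}

theorem cwDir_mem_rotations (d : Dir) : cwDir d ∈ rotations := by
  have h : quarterDir d.1 ∈ rotations := Subgroup.subset_closure ⟨d.1, rfl⟩
  unfold cwDir
  split_ifs
  · exact inv_mem h
  · exact h

/-- Every cubie has a sticker. -/
theorem Cubie.exists_sticker (c : Cubie n) : ∃ t : Sticker n, t.cubie = c :=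
  ⟨⟨(c.1, c.2.choose), c.2.choose_spec⟩, rfl⟩

theorem Sticker.ext_cubie_dir {t t' : Sticker n} (h : t.cubie = t'.cubie) (h' : t.dir = t'.dir) :
    t = t' :=
  Subtype.ext (Prod.ext (congrArg Subtype.val h) h')

namespace Configuration

theorem ext_perm {s s' : Configuration n} (h : s.perm = s'.perm) : s = s' := by
  have h2 : s.place = s'.place := by
    ext1 c
    obtain ⟨t, rfl⟩ := c.exists_sticker
    rw [← s.cubie_perm, ← s'.cubie_perm, h]
  cases s; cases s'; cases h; cases h2; rfl

/-- The product `s * s'` is the configuration obtained by rearranging the stickers first by `s'` and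
then by `s`. -/
instance : Mul (Configuration n) where
  mul s s' :=
    { perm := s.perm * s'.perm
      place := s.place * s'.place
      cubie_perm := fun t => by simp [s.cubie_perm, s'.cubie_perm]
      rigid := fun c => by
        obtain ⟨R', hR', h'⟩ := s'.rigid c
        obtain ⟨R, hR, h⟩ := s.rigid (s'.place c)
        refine ⟨R * R', mul_mem hR hR', fun t ht => ?_⟩
        have := h (s'.perm t) (by rw [s'.cubie_perm, ht])
        simpa [h' t ht] using this
      same_orbit := fun c => by
        obtain ⟨m', h'⟩ := s'.same_orbit c
        obtain ⟨m, h⟩ := s.same_orbit (s'.place c)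
        exact ⟨m * m', by simp [h, h']⟩ }

instance : One (Configuration n) where
  one :=
    { perm := 1
      place := 1
      cubie_perm := fun t => rfl
      rigid := fun c => ⟨1, one_mem _, fun t _ => rfl⟩
      same_orbit := fun c => ⟨1, by simp⟩ }

theorem cubie_symm (s : Configuration n) (t : Sticker n) :
    (s.perm⁻¹ t).cubie = s.place⁻¹ t.cubie := by
  rw [Equiv.Perm.eq_inv_iff_eq, ← s.cubie_perm]
  simp

instance : Inv (Configuration n) where
  inv s :=
    { perm := s.perm⁻¹
      place := s.place⁻¹
      cubie_perm := s.cubie_symm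
      rigid := fun c => by
        obtain ⟨R, hR, h⟩ := s.rigid (s.place⁻¹ c)
        refine ⟨R⁻¹, inv_mem hR, fun t ht => ?_⟩
        have := h (s.perm⁻¹ t) (by rw [cubie_symm, ht])
        rw [Equiv.Perm.eq_inv_iff_eq, ← this]
        simp
      same_orbit := fun c => by
        obtain ⟨m, h⟩ := s.same_orbit (s.place⁻¹ c)
        refine ⟨m⁻¹, ?_⟩
        rw [map_inv, Equiv.Perm.inv_eq_iff_eq, h]
        simp }

@[simp] theorem perm_mul (s s' : Configuration n) : (s * s').perm = s.perm * s'.perm := rfl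
@[simp] theorem place_mul (s s' : Configuration n) : (s * s').place = s.place * s'.place := rfl
@[simp] theorem place_inv (s : Configuration n) : (s⁻¹).place = s.place⁻¹ := rfl

instance : Group (Configuration n) where
  mul_assoc _ _ _ := ext_perm rfl
  one_mul _ := ext_perm rfl
  mul_one _ := ext_perm rfl
  inv_mul_cancel s := ext_perm (inv_mul_cancel s.perm)

/-- The configuration reached from the solved state by one slice rotation. -/
def ofRotation (r : SliceRotation n) : Configuration n where
  perm := turnSticker r.1 r.2
  place := turnCubie r.1 r.2
  cubie_perm := cubie_turnSticker r.1 r.2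
  rigid c := by
    by_cases hc : layer c.1 r.1 = r.2
    · refine ⟨cwDir r.1, cwDir_mem_rotations _, fun t ht => ?_⟩
      subst ht
      rw [turnSticker_apply, if_pos (show layer t.1.1 r.1 = r.2 from hc)]
      rfl
    · refine ⟨1, one_mem _, fun t ht => ?_⟩
      subst ht
      rw [turnSticker_of_ne hc]
      rfl
  same_orbit c := ⟨FreeGroup.of r, by rw [moveCubies_of]⟩

/-- The configuration reached from the solved state by a move. -/
def ofMove : Moves n →* Configuration n := FreeGroup.lift ofRotation

theorem ofMove_of (r : SliceRotation n) : ofMove (FreeGroup.of r) = ofRotation r := by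
  simp [ofMove]

/-- The permutation of the stickers, as a homomorphism. -/
def permHom : Configuration n →* Equiv.Perm (Sticker n) where
  toFun := perm
  map_one' := rfl
  map_mul' _ _ := rfl

/-- The permutation of the cubies, as a homomorphism. -/
def placeHom : Configuration n →* Equiv.Perm (Cubie n) where
  toFun := place
  map_one' := rfl
  map_mul' _ _ := rfl

/-- The permutation of an orbit, as a homomorphism. -/
def orbitPermHom (i j : ℕ) : Configuration n →* Equiv.Perm (orbit n i j) where
  toFun s := s.orbitPerm i j
  map_one' := rfl
  map_mul' _ _ := rfl

@[simp] theorem perm_ofMove (m : Moves n) : (ofMove m).perm = moveStickers n m := by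
  have : permHom.comp ofMove = moveStickers n := FreeGroup.ext_hom _ _ fun r => by
    simp [permHom, ofMove, moveStickers, ofRotation]
  exact DFunLike.congr_fun this m

@[simp] theorem place_ofMove (m : Moves n) : (ofMove m).place = moveCubies n m := by
  have : placeHom.comp ofMove = moveCubies n := FreeGroup.ext_hom _ _ fun r => by
    simp [placeHom, ofMove, moveCubies, ofRotation]
  exact DFunLike.congr_fun this m

theorem orbitPerm_mul (s s' : Configuration n) (i j : ℕ) :
    (s * s').orbitPerm i j = s.orbitPerm i j * s'.orbitPerm i j := rfl

@[simp] theorem orbitPerm_apply (s : Configuration n) (i j : ℕ) (c : orbit n i j) :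
    (s.orbitPerm i j c : Cubie n) = s.place c := rfl

/-- A configuration is valid if some move solves it. -/
theorem isValid_of_mul {s : Configuration n} (m : Moves n) (h : (ofMove m * s).IsValid) :
    s.IsValid := by
  obtain ⟨m', hm'⟩ := h
  refine ⟨m⁻¹ * m', ?_⟩
  rw [map_mul, hm', perm_mul, perm_ofMove, map_inv, inv_mul_cancel_left]

/-- A property of configurations that is preserved in both directions by slice rotations is
preserved by moves. -/
theorem ofMove_mul_invariant (Q : Configuration n → Prop)
    (h : ∀ r s, Q (ofRotation r * s) ↔ Q s) (m : Moves n) : ∀ s, Q (ofMove m * s) ↔ Q s := by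
  induction m using FreeGroup.induction_on with
  | C1 => simp
  | of r => intro s; simpa [ofMove] using h r s
  | inv_of r _ => intro s; simpa [ofMove] using (h r ((ofRotation r)⁻¹ * s)).symm
  | mul x y hx hy => intro c; rw [map_mul, mul_assoc, hx, hy]

end Configuration

/-! ### Signs -/

theorem sgn_eq_sign {α : Type*} [Fintype α] [DecidableEq α] (f : Equiv.Perm α) :
    sgn f = Equiv.Perm.sign f := by
  unfold sgn; congr!

theorem sgn_mul {α : Type*} [Finite α] (f g : Equiv.Perm α) : sgn (f * g) = sgn f * sgn g := by
  unfold sgn; simp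

theorem sgn_one {α : Type*} [Finite α] : sgn (1 : Equiv.Perm α) = 1 := by
  unfold sgn; simp

/-- The sign of a permutation may be computed after relabelling. -/
theorem sgn_eq_of_conj {α β : Type*} [Finite α] [Fintype β] [DecidableEq β] {f : Equiv.Perm α}
    {g : Equiv.Perm β} (P : β → α) (hP : Function.Bijective P) (h : ∀ b, f (P b) = P (g b)) :
    sgn f = Equiv.Perm.sign g := by
  classical
  have := Fintype.ofFinite α
  rw [sgn_eq_sign]
  have e : f = (Equiv.ofBijective P hP).permCongr g := by
    ext1 a
    obtain ⟨b, rfl⟩ := hP.2 a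
    rw [h, Equiv.permCongr_apply, Equiv.ofBijective_symm_apply_apply]
    rfl
  rw [e, Equiv.Perm.sign_permCongr]

end

/-! ### Commutators of permutations whose supports meet in a small set -/

section
variable {α : Type*} {A B : Equiv.Perm α} {S T : Set α}

theorem mem_of_fixes (hA : ∀ x, x ∉ S → A x = x) {x : α} : A x ∈ S ↔ x ∈ S := by
  constructor
  · intro h
    by_contra h'
    rw [hA x h'] at h
    exact h' h
  · intro h
    by_contra h'
    exact h' ((A.injective (hA _ h')).symm ▸ h)

theorem inv_fixes (hA : ∀ x, x ∉ S → A x = x) : ∀ x, x ∉ S → A⁻¹ x = x := fun x hx => by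
  rw [Equiv.Perm.inv_eq_iff_eq, hA x hx]

/-- The commutator of `A` (supported in `S`) and `B` (supported in `T`) moves only points that lie
in the intersection of `S` and `T` or come from it under `A` or `B`. -/
theorem commutator_apply_of_notMem (hA : ∀ x, x ∉ S → A x = x) (hB : ∀ x, x ∉ T → B x = x)
    {x : α} (h : x ∉ S ∩ T) (hxA : A⁻¹ x ∉ S ∩ T) (hxB : B⁻¹ x ∉ S ∩ T) :
    (A * B * A⁻¹ * B⁻¹) x = x := by
  simp only [Equiv.Perm.mul_apply]
  have hB' := inv_fixes hB
  have hA' := inv_fixes hA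
  by_cases hT : x ∈ T
  · have h1 : B⁻¹ x ∈ T := (mem_of_fixes hB').2 hT
    have h2 : A⁻¹ (B⁻¹ x) = B⁻¹ x := hA' _ fun h3 => hxB ⟨h3, h1⟩
    rw [h2, Equiv.Perm.coe_inv, Equiv.apply_symm_apply]
    exact hA _ fun h3 => h ⟨h3, hT⟩
  · rw [hB' x hT]
    by_cases hS : x ∈ S
    · have h1 : A⁻¹ x ∈ S := (mem_of_fixes hA').2 hS
      rw [hB (A⁻¹ x) fun h3 => hxA ⟨h1, h3⟩]
      simp
    · rw [hA' x hS, hB x hT, hA x hS]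

theorem commutator_apply_of_mem (hA : ∀ x, x ∉ S → A x = x) (hB : ∀ x, x ∉ T → B x = x)
    {x : α} (h : x ∈ S ∩ T) (hx : B⁻¹ x ∉ S ∩ T) : (A * B * A⁻¹ * B⁻¹) x = A x := by
  simp only [Equiv.Perm.mul_apply]
  have h1 : B⁻¹ x ∈ T := (mem_of_fixes (inv_fixes hB)).2 h.2
  rw [inv_fixes hA (B⁻¹ x) fun h3 => hx ⟨h3, h1⟩]
  simp

theorem commutator_apply_image_left (hA : ∀ x, x ∉ S → A x = x) (hB : ∀ x, x ∉ T → B x = x)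
    {y : α} (h : y ∈ S ∩ T) (h1 : A y ∉ S ∩ T) (h2 : B y ∉ S ∩ T) :
    (A * B * A⁻¹ * B⁻¹) (A y) = B y := by
  simp only [Equiv.Perm.mul_apply]
  rw [inv_fixes hB (A y) fun h3 => h1 ⟨(mem_of_fixes hA).2 h.1, h3⟩]
  simp only [Equiv.Perm.coe_inv, Equiv.symm_apply_apply]
  exact hA _ fun h3 => h2 ⟨h3, (mem_of_fixes hB).2 h.2⟩

theorem commutator_apply_image_right (hA : ∀ x, x ∉ S → A x = x) (hB : ∀ x, x ∉ T → B x = x)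
    {y : α} (h : y ∈ S ∩ T) (h1 : A⁻¹ y ∉ S ∩ T) : (A * B * A⁻¹ * B⁻¹) (B y) = y := by
  simp only [Equiv.Perm.mul_apply]
  have h2 : B⁻¹ (B y) = y := by simp
  rw [h2, hB (A⁻¹ y) fun h3 => h1 ⟨(mem_of_fixes (inv_fixes hA)).2 h.1, h3⟩]
  simp

theorem commutator_apply_image_right' (hA : ∀ x, x ∉ S → A x = x) (hB : ∀ x, x ∉ T → B x = x)
    {y : α} (h : A⁻¹ y ∈ S ∩ T) (h1 : B (A⁻¹ y) ∉ S ∩ T) :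
    (A * B * A⁻¹ * B⁻¹) (B y) = B (A⁻¹ y) := by
  simp only [Equiv.Perm.mul_apply]
  have h2 : B⁻¹ (B y) = y := by simp
  rw [h2]
  exact hA _ fun h3 => h1 ⟨h3, (mem_of_fixes hB).2 h.2⟩

end

/-! ### Slice rotations normalize the cube group -/

section
variable {n : ℕ}

/-- Permutations of the stickers paired with permutations of the cubies. -/
abbrev Motion (n : ℕ) := Equiv.Perm (Sticker n) × Equiv.Perm (Cubie n)

/-- The group of moves, acting on stickers and cubies simultaneously. -/
def motionGroup (n : ℕ) : Subgroup (Motion n) := ((moveStickers n).prod (moveCubies n)).range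

/-- The quarter turn of an arbitrary slice; the slice may be the middle one. -/
def turn (d : Dir) (k : ℕ) : Motion n := (turnSticker d k, turnCubie d k)

/-- The quarter turn of the whole cube. -/
def whole (d : Dir) : Motion n := (cwSticker d, cwCubie d)

theorem mem_motionGroup {f : Motion n} :
    f ∈ motionGroup n ↔ ∃ m, moveStickers n m = f.1 ∧ moveCubies n m = f.2 := by
  simp [motionGroup, MonoidHom.mem_range, Prod.ext_iff]

theorem turn_mem {d : Dir} {k : ℕ} (h1 : 1 ≤ k) (h2 : k ≤ n / 2) :
    (turn d k : Motion n) ∈ motionGroup n :=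
  mem_motionGroup.2 ⟨FreeGroup.of (d, ⟨k, h1, h2⟩), moveStickers_of _, moveCubies_of _⟩

theorem cwCubie_opp (d : Dir) (c : Cubie n) : cwCubie (opp d) (cwCubie d c) = c := by
  apply Subtype.ext
  show cwPos (opp d) (cwPos d c.1) = c.1
  rw [cwPos_opp_eq_inv]; simp

theorem cwSticker_opp (d : Dir) (t : Sticker n) : cwSticker (opp d) (cwSticker d t) = t := by
  refine Sticker.ext_cubie_dir (cwCubie_opp d t.cubie) ?_
  show cwDir (opp d) (cwDir d t.dir) = t.dir
  rw [cwDir_opp_eq_inv]; simp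

theorem whole_opp (d : Dir) : (whole (opp d) : Motion n) = (whole d)⁻¹ := by
  rw [eq_inv_iff_mul_eq_one]
  exact Prod.ext (Equiv.ext (cwSticker_opp d)) (Equiv.ext (cwCubie_opp d))

theorem turn_opp (d : Dir) {k : ℕ} (hk : k ≤ n) :
    (turn (opp d) (n + 1 - k) : Motion n) = (turn d k)⁻¹ := by
  rw [eq_inv_iff_mul_eq_one]
  refine Prod.ext (Equiv.ext fun t => ?_) (Equiv.ext fun c => ?_)
  · show turnSticker (opp d) (n + 1 - k) (turnSticker d k t) = t
    have h1 := layer_add_layer_opp t.1.1 d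
    have h2 := layer_le t.1.1 d
    rw [turnSticker_apply d]
    split_ifs with h
    · have h3 := layer_add_layer_opp (cwSticker d t).1.1 d
      rw [layer_cwSticker] at h3
      rw [turnSticker_apply, if_pos (by omega), cwSticker_opp]
    · rw [turnSticker_of_ne (by omega)]
  · show turnCubie (opp d) (n + 1 - k) (turnCubie d k c) = c
    have h1 := layer_add_layer_opp c.1 d
    have h2 := layer_le c.1 d
    rw [turnCubie_apply d]
    split_ifs with h
    · have h3 := layer_add_layer_opp (cwCubie d c).1 d
      rw [layer_cwCubie] at h3
      rw [turnCubie_apply, if_pos (by omega), cwCubie_opp]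
    · rw [turnCubie_of_ne (by omega)]

theorem cwCubie_conj (g d : Dir) (c : Cubie n) :
    cwCubie (cwDir g d) (cwCubie g c) = cwCubie g (cwCubie d c) :=
  Subtype.ext (cwPos_conj g d c.1)

theorem cwSticker_conj (g d : Dir) (t : Sticker n) :
    cwSticker (cwDir g d) (cwSticker g t) = cwSticker g (cwSticker d t) :=
  Sticker.ext_cubie_dir (cwCubie_conj g d t.cubie) (cwDir_conj g d t.dir)

theorem whole_conj (g d : Dir) (k : ℕ) :
    whole g * turn d k * (whole g)⁻¹ = (turn (cwDir g d) k : Motion n) := by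
  rw [mul_inv_eq_iff_eq_mul]
  refine Prod.ext (Equiv.ext fun t => ?_) (Equiv.ext fun c => ?_)
  · show cwSticker g (turnSticker d k t) = turnSticker (cwDir g d) k (cwSticker g t)
    have h : layer (cwSticker g t).1.1 (cwDir g d) = layer t.1.1 d := layer_cw g t.1.1 d
    rw [turnSticker_apply, turnSticker_apply, h, cwSticker_conj]
    split_ifs <;> rfl
  · show cwCubie g (turnCubie d k c) = turnCubie (cwDir g d) k (cwCubie g c)
    have h : layer (cwCubie g c).1 (cwDir g d) = layer c.1 d := layer_cw g c.1 d
    rw [turnCubie_apply, turnCubie_apply, h, cwCubie_conj]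
    split_ifs <;> rfl

theorem whole_conj_mem (g : Dir) {f : Motion n} (hf : f ∈ motionGroup n) :
    whole g * f * (whole g)⁻¹ ∈ motionGroup n := by
  obtain ⟨m, rfl⟩ := hf
  induction m using FreeGroup.induction_on with
  | C1 => rw [map_one, mul_one, mul_inv_cancel]; exact one_mem _
  | of r =>
    have : ((moveStickers n).prod (moveCubies n)) (FreeGroup.of r) = turn r.1 r.2 :=
      Prod.ext (moveStickers_of r) (moveCubies_of r)
    rw [this, whole_conj]
    exact turn_mem r.2.2.1 r.2.2.2
  | inv_of r ih =>
    rw [map_inv, ← conj_inv]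
    exact inv_mem ih
  | mul x y hx hy =>
    rw [map_mul, ← conj_mul]
    exact mul_mem hx hy

theorem whole_mem_normalizer (g : Dir) :
    (whole g : Motion n) ∈ Subgroup.normalizer (motionGroup n : Set (Motion n)) := by
  rw [Subgroup.mem_normalizer_iff]
  refine fun f => ⟨whole_conj_mem g, fun h => ?_⟩
  have := whole_conj_mem (opp g) h
  rw [whole_opp] at this
  simpa [mul_assoc] using this

/-- The simultaneous quarter turn of the first `K` slices is a move. -/
theorem exists_turn_slices (d : Dir) {K : ℕ} (hK : K ≤ n / 2) : ∃ f ∈ motionGroup n,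
    (∀ t, f.1 t = if layer t.1.1 d ≤ K then cwSticker d t else t) ∧
      ∀ c, f.2 c = if layer c.1 d ≤ K then cwCubie d c else c := by
  induction K with
  | zero =>
    refine ⟨1, one_mem _, fun t => ?_, fun c => ?_⟩
    · have := one_le_layer t.1.1 d
      rw [if_neg (by omega)]; rfl
    · have := one_le_layer c.1 d
      rw [if_neg (by omega)]; rfl
  | succ K ih =>
    obtain ⟨f, hf, h1, h2⟩ := ih (by omega)
    refine ⟨turn d (K + 1) * f, mul_mem (turn_mem (by omega) hK) hf, fun t => ?_, fun c => ?_⟩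
    · show turnSticker d (K + 1) (f.1 t) = _
      rw [h1, turnSticker_apply]
      by_cases h : layer t.1.1 d ≤ K
      · rw [if_pos h, layer_cwSticker, if_neg (by omega), if_pos (by omega)]
      · rw [if_neg h]
        by_cases h' : layer t.1.1 d = K + 1
        · rw [if_pos h', if_pos (by omega)]
        · rw [if_neg h', if_neg (by omega)]
    · show turnCubie d (K + 1) (f.2 c) = _
      rw [h2, turnCubie_apply]
      by_cases h : layer c.1 d ≤ K
      · rw [if_pos h, layer_cwCubie, if_neg (by omega), if_pos (by omega)]
      · rw [if_neg h]
        by_cases h' : layer c.1 d = K + 1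
        · rw [if_pos h', if_pos (by omega)]
        · rw [if_neg h', if_neg (by omega)]

/-- The middle slice rotation is a rotation of the whole cube followed by moves. -/
theorem turn_middle_mem_normalizer (d : Dir) {k : ℕ} (hk : 2 * k = n + 1) :
    (turn d k : Motion n) ∈ Subgroup.normalizer (motionGroup n : Set (Motion n)) := by
  obtain ⟨f, hf, h1, h2⟩ := exists_turn_slices (n := n) d le_rfl
  obtain ⟨f', hf', h1', h2'⟩ := exists_turn_slices (n := n) (opp d) le_rfl
  have e : (turn d k : Motion n) = f⁻¹ * f' * whole d := by
    rw [mul_assoc, eq_inv_mul_iff_mul_eq]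
    refine Prod.ext (Equiv.ext fun t => ?_) (Equiv.ext fun c => ?_)
    · show f.1 (turnSticker d k t) = f'.1 (cwSticker d t)
      have h3 := layer_add_layer_opp (cwSticker d t).1.1 d
      have h4 := layer_cwSticker d t
      rw [h1, h1', turnSticker_apply, cwSticker_opp]
      by_cases h : layer t.1.1 d = k
      · rw [if_pos h, if_neg (by omega), if_neg (by omega)]
      · rw [if_neg h]
        by_cases h' : layer t.1.1 d ≤ n / 2
        · rw [if_pos h', if_neg (by omega)]
        · rw [if_neg h', if_pos (by omega)]
    · show f.2 (turnCubie d k c) = f'.2 (cwCubie d c)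
      have h3 := layer_add_layer_opp (cwCubie d c).1 d
      have h4 := layer_cwCubie d c
      rw [h2, h2', turnCubie_apply, cwCubie_opp]
      by_cases h : layer c.1 d = k
      · rw [if_pos h, if_neg (by omega), if_neg (by omega)]
      · rw [if_neg h]
        by_cases h' : layer c.1 d ≤ n / 2
        · rw [if_pos h', if_neg (by omega)]
        · rw [if_neg h', if_pos (by omega)]
  rw [e]
  exact mul_mem (Subgroup.le_normalizer (mul_mem (inv_mem hf) hf')) (whole_mem_normalizer d)

theorem turn_mem_normalizer (d : Dir) {k : ℕ} (h1 : 1 ≤ k) (h2 : k ≤ n) :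
    (turn d k : Motion n) ∈ Subgroup.normalizer (motionGroup n : Set (Motion n)) := by
  rcases lt_trichotomy (2 * k) (n + 1) with h | h | h
  · exact Subgroup.le_normalizer (turn_mem h1 (by omega))
  · exact turn_middle_mem_normalizer d h
  · rw [← inv_inv (turn d k), ← turn_opp d h2]
    exact inv_mem (Subgroup.le_normalizer (turn_mem (by omega) (by omega)))

/-- The commutator of a motion that normalizes the cube group with a move is a move. -/
theorem exists_move_commutator {A B : Motion n}
    (hA : A ∈ Subgroup.normalizer (motionGroup n : Set (Motion n))) (hB : B ∈ motionGroup n) :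
    ∃ m, moveStickers n m = A.1 * B.1 * A.1⁻¹ * B.1⁻¹ ∧
      moveCubies n m = A.2 * B.2 * A.2⁻¹ * B.2⁻¹ :=
  (mem_motionGroup (f := A * B * A⁻¹ * B⁻¹)).1
    (mul_mem ((Subgroup.mem_normalizer_iff.1 hA B).1 hB) (inv_mem hB))

end

/-! ### Three-cycles of cubies -/

section
variable {n : ℕ}

/-- A cubie fixed by a quarter turn of the whole cube lies on the axis. -/
theorem two_mul_layer_of_cwPos_eq {c : Pos n} {f d : Dir} (h : cwPos f c = c) (hd : d.1 ≠ f.1) :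
    2 * layer c d = n + 1 := by
  have aux : ∀ f d : Dir, d.1 ≠ f.1 → cwDir f (cwDir f d) = opp d := by decide
  have h1 := layer_cw f c (cwDir f d)
  have h2 := layer_cw f c d
  rw [aux f d hd] at h1
  rw [h] at h1 h2
  have := layer_add_layer_opp c d
  omega

theorem turnCubie_conj_apply (e f : Dir) (i j : ℕ) {c : Cubie n}
    (h : layer ((turnCubie e i)⁻¹ c).1 f ≠ j) :
    (turnCubie e i * turnCubie f j * (turnCubie e i)⁻¹ : Equiv.Perm (Cubie n)) c = c := by
  simp only [Equiv.Perm.mul_apply]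
  rw [turnCubie_of_ne h]; simp

theorem cubie_turnSticker_inv (e : Dir) (i : ℕ) (t : Sticker n) :
    ((turnSticker e i)⁻¹ t).cubie = (turnCubie e i)⁻¹ t.cubie := by
  rw [Equiv.Perm.eq_inv_iff_eq, ← cubie_turnSticker]; simp

theorem turnSticker_conj_apply (e f : Dir) (i j : ℕ) {t : Sticker n}
    (h : layer ((turnCubie e i)⁻¹ t.cubie).1 f ≠ j) :
    (turnSticker e i * turnSticker f j * (turnSticker e i)⁻¹ : Equiv.Perm (Sticker n)) t = t := by
  simp only [Equiv.Perm.mul_apply]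
  rw [← cubie_turnSticker_inv] at h
  rw [turnSticker_of_ne h]; simp

theorem turnCubie_inv_of_ne {d : Dir} {k : ℕ} {c : Cubie n} (h : layer c.1 d ≠ k) :
    (turnCubie d k)⁻¹ c = c := by
  rw [Equiv.Perm.inv_eq_iff_eq, turnCubie_of_ne h]

theorem turnCubie_inv_of_eq {d : Dir} {k : ℕ} {c : Cubie n} (h : layer c.1 d = k) :
    (turnCubie d k)⁻¹ c = cwCubie (opp d) c := by
  have h2 := cwCubie_opp (opp d) c
  rw [opp_opp] at h2
  have h3 := layer_cwCubie d (cwCubie (opp d) c)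
  rw [h2] at h3
  rw [Equiv.Perm.inv_eq_iff_eq, turnCubie_apply, if_pos (by omega), h2]

/-- For a cubie `p` in a slice `d, k` that is not a middle slice there is a motion that moves `p`
and no other cubie of the slice: it is a conjugate of the rotation of a slice parallel to the given
one by the rotation of a slice through `p` perpendicular to it. -/
theorem exists_motion_moving_one (d : Dir) {k : ℕ} (hk : 2 * k ≠ n + 1) (p : Cubie n)
    (hp : layer p.1 d = k) :
    ∃ A ∈ Subgroup.normalizer (motionGroup n : Set (Motion n)), ∃ S : Set (Cubie n),
      (∀ t, (A.1 t).cubie = A.2 t.cubie) ∧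
      (∀ c, c ∉ S → A.2 c = c) ∧ (∀ t : Sticker n, t.cubie ∉ S → A.1 t = t) ∧ A.2 p ≠ p ∧
      S ∩ {c | layer c.1 d = k} = {p} := by
  -- the parallel slice is turned into the slice of `p` along `g`; of two such slices, opposite to
  -- each other, one differs from the slice `d, k`
  have geo : ∃ e f : Dir, d.1 ≠ e.1 ∧ f.1 = d.1 ∧ (∀ a, a = d.1 ∨ a = e.1 ∨ a = (cwDir e f).1) ∧
      ∀ c : Pos n, layer c f = layer p.1 (cwDir e f) → layer c d ≠ k := by
    obtain ⟨e, he, -⟩ := exists_flag d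
    have aux : ∀ d e : Dir, d.1 ≠ e.1 → cwDir (opp e) (opp d) = cwDir e d ∧
        ∀ a, a = d.1 ∨ a = e.1 ∨ a = (cwDir e d).1 := by decide
    obtain ⟨h1, h2⟩ := aux d e he
    by_cases h : layer p.1 (cwDir e d) = k
    · refine ⟨opp e, opp d, he, rfl, by rw [h1]; exact h2, fun c hc => ?_⟩
      rw [h1] at hc
      have := layer_add_layer_opp c d
      omega
    · exact ⟨e, d, he, rfl, h2, fun c hc => by omega⟩
  obtain ⟨e, f, hde, hf, hax, hsep⟩ := geo
  set i := layer p.1 e with hi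
  set j := layer p.1 (cwDir e f) with hj
  refine ⟨turn e i * turn f j * (turn e i)⁻¹, ?_,
    {c | layer ((turnCubie e i)⁻¹ c).1 f = j}, ?_, ?_, ?_, ?_, ?_⟩
  · exact mul_mem (mul_mem (turn_mem_normalizer _ (one_le_layer _ _) (layer_le _ _))
      (turn_mem_normalizer _ (one_le_layer _ _) (layer_le _ _)))
      (inv_mem (turn_mem_normalizer _ (one_le_layer _ _) (layer_le _ _)))
  · intro t
    show (turnSticker e i (turnSticker f j ((turnSticker e i)⁻¹ t))).cubie =
      turnCubie e i (turnCubie f j ((turnCubie e i)⁻¹ t.cubie))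
    rw [cubie_turnSticker, cubie_turnSticker, cubie_turnSticker_inv]
  · exact fun c hc => turnCubie_conj_apply e f i j hc
  · exact fun t ht => turnSticker_conj_apply e f i j ht
  · show turnCubie e i (turnCubie f j ((turnCubie e i)⁻¹ p)) ≠ p
    rw [Ne, ← Equiv.Perm.eq_inv_iff_eq, turnCubie_inv_of_eq hi.symm]
    have hl : ∀ δ, layer (cwCubie (opp e) p).1 δ = layer p.1 (cwDir e δ) := fun δ => by
      show layer (cwPos (opp e) p.1) δ = _
      rw [layer_cwPos, opp_opp]
    rw [turnCubie_apply, if_pos (hl f)]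
    intro h
    have h1 := congrArg Subtype.val h
    have aux : ∀ d e : Dir, d.1 ≠ e.1 → ((cwDir e)⁻¹ d).1 ≠ d.1 := by decide
    have h2 := two_mul_layer_of_cwPos_eq (d := (cwDir e)⁻¹ d) h1 (hf ▸ aux d e hde)
    rw [hl] at h2
    simp only [Equiv.Perm.coe_inv, Equiv.apply_symm_apply] at h2
    omega
  · ext c
    simp only [Set.mem_inter_iff, Set.mem_ofPred_eq, Set.mem_singleton_iff]
    constructor
    · rintro ⟨h1, h2⟩
      by_cases h3 : layer c.1 e = i
      · rw [turnCubie_inv_of_eq h3] at h1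
        have h4 : layer (cwPos (opp e) c.1) f = j := h1
        rw [layer_cwPos, opp_opp] at h4
        apply Subtype.ext
        funext a
        rcases hax a with rfl | rfl | rfl
        · exact coord_eq_of_layer_eq (by omega)
        · exact coord_eq_of_layer_eq h3
        · exact coord_eq_of_layer_eq h4
      · rw [turnCubie_inv_of_ne h3] at h1
        exact absurd h2 (hsep c.1 h1)
    · rintro rfl
      refine ⟨?_, hp⟩
      rw [turnCubie_inv_of_eq hi.symm]
      show layer (cwPos (opp e) c.1) f = j
      rw [layer_cwPos, opp_opp]

/-- For a cubie `p` moved by a slice rotation `r` to `r p`, some move permutes `p`, `r p` and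
a third cubie cyclically and leaves all other cubies alone. -/
theorem exists_three_cycle (r : SliceRotation n) (p : Cubie n) (hp : turnCubie r.1 r.2 p ≠ p) :
    ∃ (m : Moves n) (q : Cubie n), q ≠ p ∧ turnCubie r.1 r.2 p ≠ q ∧
      moveCubies n m p = q ∧ moveCubies n m q = turnCubie r.1 r.2 p ∧
      moveCubies n m (turnCubie r.1 r.2 p) = p ∧
      (∀ c, c ≠ p → c ≠ q → c ≠ turnCubie r.1 r.2 p → moveCubies n m c = c) ∧
      ∀ t : Sticker n, t.cubie ≠ p → t.cubie ≠ q → t.cubie ≠ turnCubie r.1 r.2 p →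
        moveStickers n m t = t := by
  have hpk : layer p.1 r.1 = r.2 := by
    by_contra h
    exact hp (turnCubie_of_ne h)
  obtain ⟨k1, k2⟩ := r.2.2
  obtain ⟨A, hA, S, hcomp, hS2, hS1, hAp, hST⟩ :=
    exists_motion_moving_one r.1 (k := r.2) (by omega) p hpk
  obtain ⟨m, hm1, hm2⟩ := exists_move_commutator hA (turn_mem (d := r.1) k1 k2)
  set T : Set (Cubie n) := {c | layer c.1 r.1 = r.2} with hT
  set B := turnCubie (n := n) r.1 r.2 with hB
  have hT2 : ∀ c, c ∉ T → B c = c := fun c hc => turnCubie_of_ne hc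
  have hT1 : ∀ t : Sticker n, t ∉ Sticker.cubie ⁻¹' T → turnSticker r.1 r.2 t = t :=
    fun t ht => turnSticker_of_ne ht
  have hpm : p ∈ S ∩ T := by rw [hST]; rfl
  have hne : ∀ c, c ≠ p → c ∉ S ∩ T := fun c hc => by rw [hST]; exact hc
  have hA' : A.2⁻¹ p ≠ p := fun h => hAp (by rw [Equiv.Perm.inv_eq_iff_eq] at h; exact h.symm)
  have hB' : B⁻¹ p ≠ p := fun h => hp (by rw [Equiv.Perm.inv_eq_iff_eq] at h; exact h.symm)
  have hAB : B p ≠ A.2 p := fun h => by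
    have h1 : A.2 p ∈ S := (mem_of_fixes hS2).2 hpm.1
    have h2 : B p ∈ T := (mem_of_fixes hT2).2 hpm.2
    exact hne _ hAp ⟨h1, h ▸ h2⟩
  have hfix : ∀ c, c ≠ p → c ≠ A.2 p → c ≠ B p → moveCubies n m c = c := fun c h1 h2 h3 => by
    rw [hm2]
    refine commutator_apply_of_notMem hS2 hT2 (hne _ h1) (hne _ fun h => h2 ?_)
      (hne _ fun h => h3 ?_)
    · rwa [Equiv.Perm.inv_eq_iff_eq] at h
    · rwa [Equiv.Perm.inv_eq_iff_eq] at h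
  refine ⟨m, A.2 p, hAp, hAB, ?_, ?_, ?_, hfix, ?_⟩
  · rw [hm2]; exact commutator_apply_of_mem hS2 hT2 hpm (hne _ hB')
  · rw [hm2]; exact commutator_apply_image_left hS2 hT2 hpm (hne _ hAp) (hne _ hp)
  · rw [hm2]; exact commutator_apply_image_right hS2 hT2 hpm (hne _ hA')
  · intro t h1 h2 h3
    rw [hm1]
    refine commutator_apply_of_notMem (S := Sticker.cubie ⁻¹' S) hS1 hT1 (hne _ h1)
      (hne _ fun h => h2 ?_) (hne _ fun h => h3 ?_)
    · rw [← h, ← hcomp]; simp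
    · rw [← h]
      show _ = turnCubie r.1 r.2 _
      rw [← cubie_turnSticker]
      simp

/-! ### All even permutations of an orbit are induced by moves that fix everything else -/

/-- The moves that fix all stickers outside an orbit of cubies. -/
def supportedMoves (n i j : ℕ) : Subgroup (Moves n) where
  carrier := {m | ∀ t : Sticker n, t.cubie ∉ orbit n i j → moveStickers n m t = t}
  one_mem' t _ := by simp
  mul_mem' {a b} ha hb t ht := by
    rw [map_mul, Equiv.Perm.mul_apply, hb t ht, ha t ht]
  inv_mem' {a} ha t ht := by
    rw [map_inv, Equiv.Perm.inv_eq_iff_eq, ha t ht]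

/-- The permutations of an orbit induced by the moves that fix all stickers outside the orbit. -/
def supportedPerms (n i j : ℕ) : Subgroup (Equiv.Perm (orbit n i j)) :=
  (supportedMoves n i j).map ((Configuration.orbitPermHom i j).comp Configuration.ofMove)

theorem exists_three_cycle_mem {i j : ℕ} (r : SliceRotation n) (a b : orbit n i j)
    (hb : turnCubie r.1 r.2 a.1 = b.1) (hab : a ≠ b) :
    ∃ g ∈ supportedPerms n i j, ∃ q, q ≠ a ∧ b ≠ q ∧ g a = q ∧ g q = b ∧ g b = a ∧
      ∀ x, x ≠ a → x ≠ b → x ≠ q → g x = x := by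
  obtain ⟨m, q, h1, h2, h3, h4, h5, h6, h7⟩ := exists_three_cycle r a
    (by rw [hb]; exact fun h => hab (Subtype.ext h.symm))
  rw [hb] at h2 h4 h5 h6 h7
  have hq : q ∈ orbit n i j := by
    rw [← h3, ← Configuration.place_ofMove]
    exact ((Configuration.ofMove m).place_mem_orbit i j a).2 a.2
  refine ⟨(Configuration.ofMove m).orbitPerm i j, ⟨m, fun t ht => h7 t ?_ ?_ ?_, rfl⟩, ⟨q, hq⟩,
    fun h => h1 (congrArg Subtype.val h), fun h => h2 (congrArg Subtype.val h),
    Subtype.ext (by simpa using h3), Subtype.ext (by simpa using h4),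
    Subtype.ext (by simpa using h5), fun x hxa hxb hxq => Subtype.ext ?_⟩
  · intro h; exact ht (h ▸ a.2)
  · intro h; exact ht (h ▸ hq)
  · intro h; exact ht (h ▸ b.2)
  · simpa using h6 x (fun h => hxa (Subtype.ext h)) (fun h => hxq (Subtype.ext h))
      (fun h => hxb (Subtype.ext h))

open scoped Pointwise in
/-- A block with at least two elements that contains a point of a three-cycle contains its
image. -/
theorem mem_block_of_three_cycle {α : Type*} {H : Subgroup (Equiv.Perm α)} {B : Set α}
    (hB : MulAction.IsBlock H B) (hB2 : B.Nontrivial) {g : Equiv.Perm α} (hg : g ∈ H) {p q r : α}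
    (h1 : g p = q) (h3 : g r = p) (hfix : ∀ x, x ≠ p → x ≠ q → x ≠ r → g x = x)
    (hp : p ∈ B) : q ∈ B := by
  obtain ⟨b, hb, hbp⟩ := hB2.exists_ne p
  have key : ∀ x ∈ B, g x ∈ B → q ∈ B := fun x hx hgx => by
    have h : (⟨g, hg⟩ : H) • B = B :=
      (MulAction.isBlock_iff_smul_eq_of_mem.1 hB) (g := ⟨g, hg⟩) hx hgx
    rw [← h, ← h1]
    exact Set.smul_mem_smul_set (a := (⟨g, hg⟩ : H)) hp
  by_cases hq : b = q
  · exact hq ▸ hb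
  by_cases hr : b = r
  · exact key b hb (by rw [hr, h3]; exact hp)
  · exact key b hb (by rw [hfix b hbp hq hr]; exact hb)

/-- A property of cubies of an orbit that is invariant under slice rotations and holds for one
cubie holds for all cubies of the orbit. -/
theorem orbit_connected {i j : ℕ} (Q : orbit n i j → Prop)
    (h : ∀ (r : SliceRotation n) (a b : orbit n i j), turnCubie r.1 r.2 a.1 = b.1 → (Q b ↔ Q a))
    {a : orbit n i j} (ha : Q a) (b : orbit n i j) : Q b := by
  have h0 : ∀ c : orbit n i j, ∃ c₀ : orbit n i j, layer c₀.1.1 faceF = 1 ∧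
      layer c₀.1.1 faceU = i ∧ layer c₀.1.1 faceL = j ∧ (Q c ↔ Q c₀) := by
    rintro ⟨c, c₀, h1, h2, h3, m, rfl⟩
    have hc₀ : c₀ ∈ orbit n i j := ⟨c₀, h1, h2, h3, 1, by simp⟩
    refine ⟨⟨c₀, hc₀⟩, h1, h2, h3, ?_⟩
    have := moveCubies_invariant (n := n) (fun c => ∃ hc : c ∈ orbit n i j, Q ⟨c, hc⟩) ?_ m c₀
    · constructor
      · intro hQ
        obtain ⟨_, h⟩ := this.1 ⟨_, hQ⟩
        exact h
      · intro hQ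
        obtain ⟨_, h⟩ := this.2 ⟨_, hQ⟩
        exact h
    · intro r c
      have hmem := (Configuration.ofRotation r).place_mem_orbit i j c
      constructor
      · rintro ⟨hc, hQ⟩
        exact ⟨hmem.1 hc, (h r ⟨c, hmem.1 hc⟩ ⟨_, hc⟩ rfl).1 hQ⟩
      · rintro ⟨hc, hQ⟩
        exact ⟨hmem.2 hc, (h r ⟨c, hc⟩ ⟨_, hmem.2 hc⟩ rfl).2 hQ⟩
  obtain ⟨a₀, a1, a2, a3, ha'⟩ := h0 a
  obtain ⟨b₀, b1, b2, b3, hb'⟩ := h0 b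
  have : a₀ = b₀ := Subtype.ext (Subtype.ext (HasLayers.unique (p := baseFlag) ⟨a1, a2, a3⟩
    ⟨b1, b2, b3⟩))
  rw [hb', ← this, ← ha']
  exact ha

/-- The three-cycles link every cubie to its images under slice rotations, so the permutations
in question form a primitive group, and Jordan's theorem applies. -/
theorem mem_supportedPerms_of_sgn {i j : ℕ} (f : Equiv.Perm (orbit n i j)) (hf : sgn f = 1) :
    f ∈ supportedPerms n i j := by
  classical
  have := Fintype.ofFinite (orbit n i j)
  by_cases hfix : ∀ (r : SliceRotation n) (a b : orbit n i j), turnCubie r.1 r.2 a.1 = b.1 → a = b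
  · have hsub : f = 1 := by
      ext1 a
      exact orbit_connected (fun b => b = a) (fun r a b hb => by rw [hfix r a b hb]) rfl (f a)
    rw [hsub]
    exact one_mem _
  push Not at hfix
  obtain ⟨r, a, b, hb, hab⟩ := hfix
  obtain ⟨g, hg, q, hq1, hq2, g1, g2, g3, g4⟩ := exists_three_cycle_mem r a b hb hab
  have hg3 : g.IsThreeCycle := by
    have : g = Equiv.swap a b * Equiv.swap a q := by
      ext1 x
      rw [Equiv.Perm.mul_apply]
      by_cases hxa : x = a
      · rw [hxa, g1, Equiv.swap_apply_left, Equiv.swap_apply_of_ne_of_ne hq1 hq2.symm]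
      by_cases hxq : x = q
      · rw [hxq, g2, Equiv.swap_apply_right, Equiv.swap_apply_left]
      rw [Equiv.swap_apply_of_ne_of_ne hxa hxq]
      by_cases hxb : x = b
      · rw [hxb, g3, Equiv.swap_apply_right]
      · rw [Equiv.swap_apply_of_ne_of_ne hxa hxb, g4 x hxa hxb hxq]
    rw [this]
    exact Equiv.Perm.isThreeCycle_swap_mul_swap_same hab hq1.symm hq2
  have htrans : MulAction.IsPretransitive (supportedPerms n i j) (orbit n i j) := by
    rw [MulAction.isPretransitive_iff_base a]
    refine orbit_connected (fun b => ∃ g : supportedPerms n i j, g • a = b) ?_ ⟨1, one_smul _ _⟩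
    intro r x y hy
    by_cases hxy : x = y
    · rw [hxy]
    obtain ⟨h, hh, -, -, -, -, -, h3, -⟩ := exists_three_cycle_mem r x y hy hxy
    constructor
    · rintro ⟨k, hk⟩
      exact ⟨⟨h, hh⟩ * k, by rw [mul_smul, hk]; exact h3⟩
    · rintro ⟨k, hk⟩
      exact ⟨⟨h, hh⟩⁻¹ * k, by rw [mul_smul, hk, inv_smul_eq_iff]; exact h3.symm⟩
  have hprim : MulAction.IsPreprimitive (supportedPerms n i j) (orbit n i j) := by
    refine { isTrivialBlock_of_isBlock := fun {B} hB => ?_ }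
    rcases B.subsingleton_or_nontrivial with h | h
    · exact Or.inl h
    · right
      obtain ⟨b₀, hb₀⟩ := h.nonempty
      refine Set.eq_univ_of_forall (orbit_connected (fun b => b ∈ B) ?_ hb₀)
      intro r x y hy
      by_cases hxy : x = y
      · rw [hxy]
      obtain ⟨k, hk, z, hz1, hz2, h1, h2, h3, h4⟩ := exists_three_cycle_mem r x y hy hxy
      constructor
      · exact mem_block_of_three_cycle hB h hk h3 h2 fun w a b c => h4 w b a c
      · refine mem_block_of_three_cycle hB h (inv_mem hk) (r := z) ?_ ?_ fun w a b c => ?_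
        · rw [Equiv.Perm.inv_eq_iff_eq, h3]
        · rw [Equiv.Perm.inv_eq_iff_eq, h1]
        · rw [Equiv.Perm.inv_eq_iff_eq, h4 w a b c]
  refine Equiv.Perm.alternatingGroup_le_of_isPreprimitive_of_isThreeCycle_mem hprim hg3 hg ?_
  rw [Equiv.Perm.mem_alternatingGroup, ← sgn_eq_sign, hf]

end

section
variable {n : ℕ}

namespace Configuration

/-- A configuration that permutes every orbit evenly can be brought, by moves, to one in which every
cubie is in its place. -/
theorem exists_place_eq_one (hn : 2 ≤ n) (s : Configuration n)
    (hs : ∀ i j, 1 ≤ i → i ≤ n / 2 → 1 ≤ j → j ≤ (n + 1) / 2 → (j = 1 → i = 1) →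
      sgn (s.orbitPerm i j) = 1) : ∃ m, (ofMove m * s).place = 1 := by
  classical
  induction hN : {c : Cubie n | s.place c ≠ c}.ncard using Nat.strong_induction_on
    generalizing s with
  | _ N ih =>
    by_cases h1 : s.place = 1
    · exact ⟨1, by simpa using h1⟩
    obtain ⟨c, hc⟩ : ∃ c, s.place c ≠ c := by
      by_contra! h
      exact h1 (Equiv.ext h)
    rcases exists_orbit hn c with ⟨i, j, hi, hi', hj, hj', hij, hcO⟩ | hfix
    swap
    · obtain ⟨m, hm⟩ := s.same_orbit c
      exact absurd (hm.symm.trans (hfix m)) hc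
    obtain ⟨m, hm, hms⟩ := mem_supportedPerms_of_sgn _ (hs i j hi hi' hj hj' hij)
    have hin : ∀ x ∈ orbit n i j, (ofMove m⁻¹ * s).place x = x := by
      intro x hx
      have h2 : ((ofMove m).orbitPerm i j) ⟨x, hx⟩ = (s.orbitPerm i j) ⟨x, hx⟩ :=
        DFunLike.congr_fun hms _
      have h3 := congrArg Subtype.val h2
      rw [orbitPerm_apply, orbitPerm_apply] at h3
      rw [place_mul, Equiv.Perm.mul_apply, map_inv, place_inv, Equiv.Perm.inv_eq_iff_eq]
      exact h3.symm
    have hout : ∀ x, x ∉ orbit n i j → (ofMove m⁻¹ * s).place x = s.place x := by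
      intro x hx
      rw [place_mul, Equiv.Perm.mul_apply, map_inv, place_inv, Equiv.Perm.inv_eq_iff_eq]
      have h2 : s.place x ∉ orbit n i j := fun h => hx ((s.place_mem_orbit i j x).1 h)
      obtain ⟨t, ht⟩ := (s.place x).exists_sticker
      rw [← ht] at h2 ⊢
      rw [← (ofMove m).cubie_perm, perm_ofMove, hm t h2]
    have hs' : ∀ i j, 1 ≤ i → i ≤ n / 2 → 1 ≤ j → j ≤ (n + 1) / 2 → (j = 1 → i = 1) →
        sgn ((ofMove m⁻¹ * s).orbitPerm i j) = 1 := by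
      intro i' j' a1 a2 a3 a4 a5
      -- two orbits are equal or disjoint
      by_cases hmeet : ∃ x : orbit n i' j', x.1 ∈ orbit n i j
      · obtain ⟨x, hx⟩ := hmeet
        have : ∀ y : orbit n i' j', y.1 ∈ orbit n i j :=
          orbit_connected _ (fun r a b hab => by
            rw [← hab]
            exact (ofRotation r).place_mem_orbit i j a.1) hx
        have e : (ofMove m⁻¹ * s).orbitPerm i' j' = 1 :=
          Equiv.ext fun y => Subtype.ext (hin y.1 (this y))
        rw [e, sgn_one]
      · have e : (ofMove m⁻¹ * s).orbitPerm i' j' = s.orbitPerm i' j' :=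
          Equiv.ext fun y => Subtype.ext (hout y.1 fun h => hmeet ⟨y, h⟩)
        rw [e]
        exact hs i' j' a1 a2 a3 a4 a5
    obtain ⟨m', hm'⟩ := ih {c : Cubie n | (ofMove m⁻¹ * s).place c ≠ c}.ncard
      (by
        rw [← hN]
        refine Set.ncard_lt_ncard ⟨fun x hx => ?_, fun h => ?_⟩
        · have hx1 : (ofMove m⁻¹ * s).place x ≠ x := hx
          by_cases h : x ∈ orbit n i j
          · exact absurd (hin x h) hx1
          · rwa [hout x h] at hx1
        · exact (h hc : (ofMove m⁻¹ * s).place c ≠ c) (hin c hcO))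
      (ofMove m⁻¹ * s) hs' rfl
    exact ⟨m' * m⁻¹, by rw [map_mul, mul_assoc]; exact hm'⟩

end Configuration

/-! ### Signs of the slice rotations -/

theorem HasLayers.layer_cases {c : Pos n} {p : Flag} {i j k : ℕ} (h : HasLayers c p i j k)
    (d : Dir) : (d = p.1.1 ∧ layer c d = i) ∨ (d = p.1.2 ∧ layer c d = j) ∨
      (d = p.third ∧ layer c d = k) ∨ (d = opp p.1.1 ∧ layer c d = n + 1 - i) ∨
      (d = opp p.1.2 ∧ layer c d = n + 1 - j) ∨ (d = opp p.third ∧ layer c d = n + 1 - k) := by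
  obtain ⟨h1, h2, h3⟩ := h
  rcases flag_dirs p d with h | h | h | h | h | h <;> subst h <;>
    simp only [layer_opp, h1, h2, h3, true_and, true_or, or_true]

set_option synthInstance.maxSize 2000 in
theorem flag_relations (p q : Flag) :
    (q.1.1 = p.1.1 → q.1.2 = p.1.2 → q = p) ∧
    (q.1.1 = p.1.1 → q.1.2 = p.third → q.third = opp p.1.2) ∧
    (q.1.1 = p.1.2 → q.1.2 = p.1.1 → q.third = opp p.third) ∧ q.1.1 ≠ q.1.2 := by
  revert p q; decide +kernel

/-- Apart from corners and single edges, a cubie determines the frame in which it has the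
layers of its orbit. -/
theorem HasLayers.flag_unique {c : Pos n} {p q : Flag} {i j : ℕ} (hn : 2 ≤ n) (hi : 1 ≤ i)
    (hi' : i ≤ n / 2) (hj : 1 < j) (hj' : j ≤ (n + 1) / 2) (hij : i = 1 → j ≤ n / 2)
    (hp : HasLayers c p 1 i j) (hq : HasLayers c q 1 i j) : q = p := by
  obtain ⟨e1, e2, e3, e4⟩ := flag_relations p q
  obtain ⟨q1, q2, q3⟩ := hq
  have l3 := layer_opp c p.third
  have l2 := layer_opp c p.1.2
  obtain ⟨p1, p2, p3⟩ := id hp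
  rcases hp.layer_cases q.1.1 with ⟨h, h'⟩ | ⟨h, h'⟩ | ⟨h, h'⟩ | ⟨h, h'⟩ | ⟨h, h'⟩ | ⟨h, h'⟩ <;>
    try omega
  · rcases hp.layer_cases q.1.2 with ⟨g, g'⟩ | ⟨g, g'⟩ | ⟨g, g'⟩ | ⟨g, g'⟩ | ⟨g, g'⟩ | ⟨g, g'⟩ <;>
      try omega
    · exact absurd (h.trans g.symm) e4
    · exact e1 h g
    · rw [e2 h g] at q3
      omega
  · rcases hp.layer_cases q.1.2 with ⟨g, g'⟩ | ⟨g, g'⟩ | ⟨g, g'⟩ | ⟨g, g'⟩ | ⟨g, g'⟩ | ⟨g, g'⟩ <;>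
      try omega
    · rw [e3 h g] at q3
      omega
    · exact absurd (h.trans g.symm) e4

/-- If the cubies of an orbit are labelled by a set of flags, the sign of a slice rotation on the
orbit is the sign of the permutation of the flags. -/
theorem sgn_ofRotation {i j : ℕ} (hi : 1 ≤ i) (hi' : i ≤ n / 2) (hj : 1 ≤ j)
    (hj' : j ≤ (n + 1) / 2) (r : SliceRotation n) (μ : Flag → Prop) [DecidablePred μ]
    (g : Equiv.Perm {p // μ p})
    (hinj : ∀ (c : Pos n) p q, HasLayers c p 1 i j → HasLayers c q 1 i j → μ p → μ q → p = q)
    (hsurj : ∀ (c : Pos n) p, HasLayers c p 1 i j → ∃ q, μ q ∧ HasLayers c q 1 i j)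
    (hg : ∀ (c : Cubie n) p, HasLayers c.1 p.1 1 i j →
      HasLayers (turnCubie r.1 r.2 c).1 (g p).1 1 i j) :
    sgn ((Configuration.ofRotation r).orbitPerm i j) = Equiv.Perm.sign g := by
  have hex : ∀ p : {p // μ p}, ∃ c : orbit n i j, HasLayers c.1.1 p.1 1 i j := fun p => by
    obtain ⟨c, hc⟩ := exists_hasLayers (n := n) p.1 (i := 1) (j := i) (k := j) le_rfl (by omega)
      hi (by omega) hj (by omega)
    exact ⟨⟨⟨c, _, hc.1⟩, mk_mem_orbit hi hi' hc⟩, hc⟩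
  choose P hP using hex
  have huniq : ∀ (c : orbit n i j) p, HasLayers c.1.1 p.1 1 i j → c = P p := fun c p h =>
    Subtype.ext (Subtype.ext (h.unique (hP p)))
  refine sgn_eq_of_conj P ⟨fun p q h => ?_, fun c => ?_⟩ fun p => ?_
  · have h2 := hP q
    rw [← h] at h2
    exact Subtype.ext (hinj _ _ _ (hP p) h2 p.2 q.2)
  · obtain ⟨p, hp⟩ := (mem_orbit_iff hi hi' c.1).1 c.2
    obtain ⟨q, hq, hcq⟩ := hsurj _ _ hp
    exact ⟨⟨q, hq⟩, (huniq c ⟨q, hq⟩ hcq).symm⟩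
  · exact huniq _ _ (hg (P p).1 p (hP p))

theorem orbitPerm_ofRotation_eq_one {i j : ℕ} (r : SliceRotation n)
    (h : ∀ c ∈ orbit n i j, layer c.1 r.1 ≠ r.2) :
    (Configuration.ofRotation r).orbitPerm i j = 1 :=
  Equiv.ext fun c => Subtype.ext (turnCubie_of_ne (h c.1 c.2))

/-- A rotation of the front face on flags: the flags are turned for which the front face is one of
the selected directions of the frame. -/
def flagTurn (a b c : Bool) (p : Flag) : Flag :=
  if (p.1.1 = faceF ∧ a) ∨ (p.1.2 = faceF ∧ b) ∨ (p.third = faceF ∧ c) then cwFlag faceF p else p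

theorem flagTurn_pow_four (a b c : Bool) (p : Flag) :
    flagTurn a b c (flagTurn a b c (flagTurn a b c (flagTurn a b c p))) = p := by
  revert a b c p; decide +kernel

/-- The rotation `flagTurn` as a permutation of the flags, written as a subtype to match the labels in
`sgn_ofRotation`. -/
def flagTurnPerm (a b c : Bool) : Equiv.Perm {_p : Flag // True} where
  toFun p := ⟨flagTurn a b c p.1, trivial⟩
  invFun p := ⟨flagTurn a b c (flagTurn a b c (flagTurn a b c p.1)), trivial⟩
  left_inv p := Subtype.ext (flagTurn_pow_four a b c p.1)
  right_inv p := Subtype.ext (flagTurn_pow_four a b c p.1)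

set_option maxRecDepth 10000 in
/-- Each selected direction of the frame contributes one four-cycle. -/
theorem sign_flagTurnPerm (a b c : Bool) : Equiv.Perm.sign (flagTurnPerm a b c) =
    (if a then -1 else 1) * (if b then -1 else 1) * (if c then -1 else 1) := by
  revert a b c; decide +kernel

theorem HasLayers.turnCubie {c : Cubie n} {p : Flag} {i j k : ℕ} (h : HasLayers c.1 p i j k)
    (d : Dir) {l : ℕ} (hl : layer c.1 d = l) :
    HasLayers (RubikCube.turnCubie d l c).1 (cwFlag d p) i j k := by
  rw [turnCubie_apply, if_pos hl]
  exact h.cw d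

/-- The rotation of the `k`-th slice from the front. -/
def frontTurn {k : ℕ} (hk : 1 ≤ k) (hk' : k ≤ n / 2) : SliceRotation n := (faceF, ⟨k, hk, hk'⟩)

theorem sgn_frontTurn {i j k : ℕ} (hn : 2 ≤ n) (hi : 1 ≤ i) (hi' : i ≤ n / 2) (hj : 1 < j)
    (hj' : j ≤ (n + 1) / 2) (hij : i = 1 → j ≤ n / 2) (hk : 1 ≤ k) (hk' : k ≤ n / 2) :
    sgn ((Configuration.ofRotation (frontTurn hk hk')).orbitPerm i j) =
      (if k = 1 then -1 else 1) * (if k = i then -1 else 1) * (if k = j then -1 else 1) := by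
  rw [sgn_ofRotation hi hi' hj.le hj' _ (fun _ => True) (flagTurnPerm (k = 1) (k = i) (k = j)),
    sign_flagTurnPerm]
  · simp
  · exact fun c p q hp hq _ _ => hq.flag_unique hn hi hi' hj hj' hij hp
  · exact fun c p hp => ⟨p, trivial, hp⟩
  · intro c p hp
    show HasLayers (turnCubie faceF k c).1 (flagTurn (k = 1) (k = i) (k = j) p.1) 1 i j
    unfold flagTurn
    split_ifs with h
    · refine hp.turnCubie faceF ?_
      rcases h with ⟨h, h'⟩ | ⟨h, h'⟩ | ⟨h, h'⟩
      · rw [← h, hp.1]; simpa using (of_decide_eq_true h').symm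
      · rw [← h, hp.2.1]; simpa using (of_decide_eq_true h').symm
      · rw [← h, hp.2.2]; simpa using (of_decide_eq_true h').symm
    · rw [turnCubie_of_ne]
      · exact hp
      · intro hl
        simp only [decide_eq_true_eq, not_or, not_and] at h
        obtain ⟨h1, h2, h3⟩ := h
        rcases hp.layer_cases faceF with ⟨g, g'⟩ | ⟨g, g'⟩ | ⟨g, g'⟩ | ⟨g, g'⟩ | ⟨g, g'⟩ | ⟨g, g'⟩
        · exact h1 g.symm (by omega)
        · exact h2 g.symm (by omega)
        · exact h3 g.symm (by omega)
        all_goals omega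

/-- The flags that begin with the front or the back face. They label the corners. -/
def CornerFlag (p : Flag) : Prop := p.1.1.1 = 2

instance : DecidablePred CornerFlag := fun p => inferInstanceAs (Decidable (p.1.1.1 = 2))

/-- The flags `(d, e)` for which a single edge with the faces `d` and `e` has its mark on `d`.
They label the single edges. -/
def EdgeFlag (p : Flag) : Prop := p.1.2.1 = p.1.1.1 - 1

instance : DecidablePred EdgeFlag := fun p => inferInstanceAs (Decidable (p.1.2.1 = p.1.1.1 - 1))

/-- The cyclic rotation of a frame. -/
def Flag.next (p : Flag) : Flag := ⟨(p.1.2, p.third), (third_axis_ne p).2.symm⟩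

/-- The exchange of the first two directions of a frame, which reverses the third one. -/
def Flag.swap (p : Flag) : Flag := ⟨(p.1.2, p.1.1), p.2.symm⟩

theorem third_next (p : Flag) : p.next.third = p.1.1 := by revert p; decide

theorem third_swap (p : Flag) : p.swap.third = opp p.third := by revert p; decide

theorem HasLayers.next {c : Pos n} {p : Flag} {i j k : ℕ} (h : HasLayers c p i j k) :
    HasLayers c p.next j k i :=
  ⟨h.2.1, h.2.2, by rw [third_next]; exact h.1⟩

theorem HasLayers.swap {c : Pos n} {p : Flag} {i j k : ℕ} (h : HasLayers c p i j k) :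
    HasLayers c p.swap j i (n + 1 - k) :=
  ⟨h.2.1, h.1, by rw [third_swap, layer_opp, h.2.2]⟩

theorem HasLayers.swap_middle {c : Pos n} {p : Flag} {i j k : ℕ} (hk : 2 * k = n + 1)
    (h : HasLayers c p i j k) : HasLayers c p.swap j i k := by
  have := h.swap
  rwa [show n + 1 - k = k by omega] at this

/-- The corner flag of the same corner. -/
def Flag.toCorner (p : Flag) : Flag :=
  if CornerFlag p then p else if CornerFlag p.next then p.next else p.next.next

/-- The flag of the marked sticker of the same single edge. -/
def Flag.toEdge (p : Flag) : Flag := if EdgeFlag p then p else p.swap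

theorem cornerFlag_toCorner (p : Flag) : CornerFlag p.toCorner := by revert p; decide

theorem edgeFlag_toEdge (p : Flag) : EdgeFlag p.toEdge := by revert p; decide

theorem HasLayers.toCorner {c : Pos n} {p : Flag} {i : ℕ} (h : HasLayers c p i i i) :
    HasLayers c p.toCorner i i i := by
  unfold Flag.toCorner
  split_ifs
  · exact h
  · exact h.next
  · exact h.next.next

theorem HasLayers.toEdge {c : Pos n} {p : Flag} {i k : ℕ} (hk : 2 * k = n + 1)
    (h : HasLayers c p i i k) : HasLayers c p.toEdge i i k := by
  unfold Flag.toEdge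
  split_ifs
  · exact h
  · exact h.swap_middle hk

set_option synthInstance.maxSize 2000 in
theorem HasLayers.cornerFlag_unique {c : Pos n} {p q : Flag} (hn : 2 ≤ n)
    (hp : HasLayers c p 1 1 1) (hq : HasLayers c q 1 1 1) (hp' : CornerFlag p)
    (hq' : CornerFlag q) : p = q := by
  have aux : ∀ p q : Flag, CornerFlag p → CornerFlag q →
      p = q ∨ q.1.1 = opp p.1.1 ∨ q.1.2 = opp p.1.2 ∨ q.third = opp p.third ∨
      q.third = opp p.1.2 ∨ q.1.2 = opp p.third := by decide +kernel
  have h1 := layer_opp c p.1.1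
  have h2 := layer_opp c p.1.2
  have h3 := layer_opp c p.third
  obtain ⟨p1, p2, p3⟩ := hp
  obtain ⟨q1, q2, q3⟩ := hq
  rcases aux p q hp' hq' with h | h | h | h | h | h
  · exact h
  · rw [h] at q1; omega
  · rw [h] at q2; omega
  · rw [h] at q3; omega
  · rw [h] at q3; omega
  · rw [h] at q2; omega

set_option synthInstance.maxSize 2000 in
theorem HasLayers.edgeFlag_unique {c : Pos n} {p q : Flag} {k : ℕ} (hn : 2 ≤ n)
    (hk : 2 * k = n + 1) (hp : HasLayers c p 1 1 k) (hq : HasLayers c q 1 1 k)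
    (hp' : EdgeFlag p) (hq' : EdgeFlag q) : p = q := by
  have aux : ∀ p q : Flag, EdgeFlag p → EdgeFlag q → p = q ∨ q.1.1 = opp p.1.1 ∨
      q.1.2 = opp p.1.2 ∨ q.1.1 = p.third ∨ q.1.2 = p.third ∨ q.1.1 = opp p.third ∨
      q.1.2 = opp p.third := by decide +kernel
  have h1 := layer_opp c p.1.1
  have h2 := layer_opp c p.1.2
  have h3 := layer_opp c p.third
  obtain ⟨p1, p2, p3⟩ := hp
  obtain ⟨q1, q2, q3⟩ := hq
  rcases aux p q hp' hq' with h | h | h | h | h | h | h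
  · exact h
  · rw [h] at q1; omega
  · rw [h] at q2; omega
  · rw [h] at q1; omega
  · rw [h] at q2; omega
  · rw [h] at q1; omega
  · rw [h] at q2; omega

/-- The rotation of the front face on corners. -/
def cornerTurn (p : {p // CornerFlag p}) : {p // CornerFlag p} :=
  ⟨(flagTurn true true true p.1).toCorner, cornerFlag_toCorner _⟩

theorem cornerTurn_pow_four (p) : cornerTurn (cornerTurn (cornerTurn (cornerTurn p))) = p := by
  revert p; decide +kernel

/-- The rotation of the front face on corners, as a permutation. -/
def cornerTurnPerm : Equiv.Perm {p // CornerFlag p} where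
  toFun := cornerTurn
  invFun p := cornerTurn (cornerTurn (cornerTurn p))
  left_inv := cornerTurn_pow_four
  right_inv := cornerTurn_pow_four

theorem sign_cornerTurnPerm : Equiv.Perm.sign cornerTurnPerm = -1 := by decide +kernel

/-- The rotation of the front face on single edges. -/
def edgeTurn (p : {p // EdgeFlag p}) : {p // EdgeFlag p} :=
  ⟨(flagTurn true true false p.1).toEdge, edgeFlag_toEdge _⟩

theorem edgeTurn_pow_four (p) : edgeTurn (edgeTurn (edgeTurn (edgeTurn p))) = p := by
  revert p; decide +kernel

/-- The rotation of the front face on single edges, as a permutation. -/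
def edgeTurnPerm : Equiv.Perm {p // EdgeFlag p} where
  toFun := edgeTurn
  invFun p := edgeTurn (edgeTurn (edgeTurn p))
  left_inv := edgeTurn_pow_four
  right_inv := edgeTurn_pow_four

theorem sign_edgeTurnPerm : Equiv.Perm.sign edgeTurnPerm = -1 := by decide +kernel

theorem sgn_frontTurn_corner (hn : 2 ≤ n) {k : ℕ} (hk : 1 ≤ k) (hk' : k ≤ n / 2) :
    sgn ((Configuration.ofRotation (frontTurn hk hk')).orbitPerm 1 1) =
      if k = 1 then -1 else 1 := by
  split_ifs with h
  · subst h
    rw [sgn_ofRotation le_rfl hk' le_rfl (by omega) _ CornerFlag cornerTurnPerm,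
      sign_cornerTurnPerm]
    · exact fun c p q hp hq hp' hq' => hp.cornerFlag_unique hn hq hp' hq'
    · exact fun c p hp => ⟨p.toCorner, cornerFlag_toCorner _, hp.toCorner⟩
    · intro c p hp
      show HasLayers (turnCubie faceF 1 c).1 (flagTurn true true true p.1).toCorner 1 1 1
      apply HasLayers.toCorner
      unfold flagTurn
      split_ifs with h
      · refine hp.turnCubie faceF ?_
        rcases h with ⟨h, -⟩ | ⟨h, -⟩ | ⟨h, -⟩
        · rw [← h, hp.1]
        · rw [← h, hp.2.1]
        · rw [← h, hp.2.2]
      · rw [turnCubie_of_ne]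
        · exact hp
        · simp only [and_true, not_or] at h
          intro hl
          rcases hp.layer_cases faceF with g | g | g | g | g | g
          · exact h.1 g.1.symm
          · exact h.2.1 g.1.symm
          · exact h.2.2 g.1.symm
          all_goals omega
  · rw [orbitPerm_ofRotation_eq_one, sgn_one]
    intro c hc
    obtain ⟨p, hp⟩ := (mem_orbit_iff le_rfl (by omega) c).1 hc
    show layer c.1 faceF ≠ k
    rcases hp.layer_cases faceF with g | g | g | g | g | g <;> omega

theorem sgn_frontTurn_edge (hn : 2 ≤ n) (hodd : Odd n) {k : ℕ} (hk : 1 ≤ k) (hk' : k ≤ n / 2) :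
    sgn ((Configuration.ofRotation (frontTurn hk hk')).orbitPerm 1 ((n + 1) / 2)) =
      if k = 1 then -1 else 1 := by
  have hm : 2 * ((n + 1) / 2) = n + 1 := by obtain ⟨a, rfl⟩ := hodd; omega
  split_ifs with h
  · subst h
    rw [sgn_ofRotation le_rfl hk' (by omega) (by omega) _ EdgeFlag edgeTurnPerm,
      sign_edgeTurnPerm]
    · exact fun c p q hp hq hp' hq' => hp.edgeFlag_unique hn hm hq hp' hq'
    · exact fun c p hp => ⟨p.toEdge, edgeFlag_toEdge _, hp.toEdge hm⟩
    · intro c p hp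
      show HasLayers (turnCubie faceF 1 c).1 (flagTurn true true false p.1).toEdge 1 1 _
      refine HasLayers.toEdge hm ?_
      unfold flagTurn
      simp only [and_true, Bool.false_eq_true, and_false, or_false]
      split_ifs with h
      · refine hp.turnCubie faceF ?_
        rcases h with h | h
        · rw [← h, hp.1]
        · rw [← h, hp.2.1]
      · rw [turnCubie_of_ne]
        · exact hp
        · rw [not_or] at h
          intro hl
          rcases hp.layer_cases faceF with g | g | g | g | g | g
          · exact h.1 g.1.symm
          · exact h.2 g.1.symm
          all_goals omega
  · rw [orbitPerm_ofRotation_eq_one, sgn_one]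
    intro c hc
    obtain ⟨p, hp⟩ := (mem_orbit_iff le_rfl (by omega) c).1 hc
    show layer c.1 faceF ≠ k
    rcases hp.layer_cases faceF with g | g | g | g | g | g <;> omega

end

/-! ### Correcting the signs -/

section
variable {n : ℕ}

namespace Configuration

/-- The conditions on the signs of the permutations of the orbits. -/
structure SignCondition (s : Configuration n) : Prop where
  single : Odd n → sgn s.sigma = sgn s.tauS
  centerCorner : ∀ i, 1 < i → i ≤ n / 2 → sgn s.sigma = sgn (s.rhoC i)
  centerEdge : ∀ i j, 1 < i → i ≤ n / 2 → 1 < j → j ≤ (n + 1) / 2 → j ≠ i →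
    sgn (s.rhoE i j) = sgn s.sigma * s.sgnTau i * s.sgnTau j

theorem sgn_sigma_frontTurn_mul (hn : 2 ≤ n) {k : ℕ} (hk : 1 ≤ k) (hk' : k ≤ n / 2)
    (s : Configuration n) :
    sgn (ofRotation (frontTurn hk hk') * s).sigma = (if k = 1 then -1 else 1) * sgn s.sigma := by
  rw [sigma, orbitPerm_mul, sgn_mul, sgn_frontTurn_corner hn hk hk']
  rfl

theorem sgn_orbitPerm_frontTurn_mul (hn : 2 ≤ n) {i j k : ℕ} (hi : 1 ≤ i) (hi' : i ≤ n / 2)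
    (hj : 1 < j) (hj' : j ≤ (n + 1) / 2) (hij : i = 1 → j ≤ n / 2) (hk : 1 ≤ k) (hk' : k ≤ n / 2)
    (s : Configuration n) :
    sgn ((ofRotation (frontTurn hk hk') * s).orbitPerm i j) =
      (if k = 1 then -1 else 1) * (if k = i then -1 else 1) * (if k = j then -1 else 1) *
        sgn (s.orbitPerm i j) := by
  rw [orbitPerm_mul, sgn_mul, sgn_frontTurn hn hi hi' hj hj' hij hk hk']

theorem sgnTau_frontTurn_mul (hn : 2 ≤ n) {i k : ℕ} (hi : 1 < i) (hk : 1 ≤ k) (hk' : k ≤ n / 2)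
    (s : Configuration n) :
    (ofRotation (frontTurn hk hk') * s).sgnTau i = (if k = i then -1 else 1) * s.sgnTau i := by
  unfold sgnTau
  by_cases h : i ≤ n / 2
  · rw [if_pos h, if_pos h, tauC,
      sgn_orbitPerm_frontTurn_mul hn le_rfl (by omega) hi (by omega) (fun _ => h) hk hk']
    split_ifs <;> simp [tauC]
  · rw [if_neg h, if_neg h, if_neg (by omega), one_mul]

theorem SignCondition.frontTurn_mul (hn : 2 ≤ n) {k : ℕ} (hk : 1 ≤ k) (hk' : k ≤ n / 2)
    {s : Configuration n} (hs : s.SignCondition) :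
    (ofRotation (frontTurn hk hk') * s).SignCondition where
  single hodd := by
    rw [sgn_sigma_frontTurn_mul hn, tauS, orbitPerm_mul, sgn_mul, sgn_frontTurn_edge hn hodd hk hk',
      hs.single hodd]
    rfl
  centerCorner i hi hi' := by
    rw [sgn_sigma_frontTurn_mul hn, rhoC,
      sgn_orbitPerm_frontTurn_mul hn hi.le hi' hi (by omega) (fun _ => hi'), hs.centerCorner i hi hi']
    split_ifs <;> simp [rhoC]
  centerEdge i j hi hi' hj hj' hij := by
    rw [sgn_sigma_frontTurn_mul hn, sgnTau_frontTurn_mul hn hi, sgnTau_frontTurn_mul hn hj, rhoE,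
      sgn_orbitPerm_frontTurn_mul hn hi.le hi' hj hj' (fun h => by omega)]
    have := hs.centerEdge i j hi hi' hj hj' hij
    rw [rhoE] at this
    rw [this]
    ac_rfl

theorem neg_one_mul_of_ne_one {u : ℤˣ} (h : u ≠ 1) : -1 * u = 1 := by
  rcases Int.units_eq_one_or u with rfl | rfl
  · exact absurd rfl h
  · rfl

/-- Rotations of the front face and of the slices parallel to it make the permutation of the corners
even, and then those of the coupled edges. -/
theorem SignCondition.exists_even (hn : 2 ≤ n) {s : Configuration n} (hs : s.SignCondition)
    {K : ℕ} (hK : 1 ≤ K) (hK' : K ≤ n / 2) :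
    ∃ m, (ofMove m * s).SignCondition ∧ sgn (ofMove m * s).sigma = 1 ∧
      ∀ i, 1 < i → i ≤ K → (ofMove m * s).sgnTau i = 1 := by
  induction K, hK using Nat.le_induction with
  | base =>
    by_cases h : sgn s.sigma = 1
    · exact ⟨1, by simpa using hs, by simpa using h, fun i _ _ => by omega⟩
    · refine ⟨FreeGroup.of (frontTurn le_rfl hK'), ?_, ?_, fun i _ _ => by omega⟩
      · rw [ofMove_of]
        exact hs.frontTurn_mul hn _ _
      · rw [ofMove_of, sgn_sigma_frontTurn_mul hn, if_pos rfl, neg_one_mul_of_ne_one h]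
  | succ K hK ih =>
    obtain ⟨m, h1, h2, h3⟩ := ih (by omega)
    by_cases h : (ofMove m * s).sgnTau (K + 1) = 1
    · refine ⟨m, h1, h2, fun i hi hi' => ?_⟩
      rcases Nat.lt_or_ge K i with h' | h'
      · rwa [show i = K + 1 by omega]
      · exact h3 i hi h'
    · refine ⟨FreeGroup.of (frontTurn (by omega : 1 ≤ K + 1) hK') * m, ?_, ?_, fun i hi hi' => ?_⟩ <;>
        rw [map_mul, ofMove_of, mul_assoc]
      · exact h1.frontTurn_mul hn _ _
      · rw [sgn_sigma_frontTurn_mul hn, if_neg (by omega), h2, one_mul]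
      · rw [sgnTau_frontTurn_mul hn hi]
        split_ifs with h'
        · rw [← h', neg_one_mul_of_ne_one h]
        · rw [h3 i hi (by omega), one_mul]

/-- A configuration satisfying the conditions on the signs can be brought, by moves, to one in which
every cubie is in its place. -/
theorem SignCondition.exists_place_eq_one (hn : 2 ≤ n) {s : Configuration n}
    (hs : s.SignCondition) : ∃ m, (ofMove m * s).place = 1 := by
  obtain ⟨m, h1, h2, h3⟩ := hs.exists_even hn (K := n / 2) (by omega) le_rfl
  have h3' : ∀ i, 1 < i → (ofMove m * s).sgnTau i = 1 := fun i hi => by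
    by_cases h : i ≤ n / 2
    · exact h3 i hi h
    · exact if_neg h
  obtain ⟨m', hm'⟩ := Configuration.exists_place_eq_one hn (ofMove m * s)
    (fun i j hi hi' hj hj' hij => by
      by_cases j1 : j = 1
      · obtain rfl := hij j1
        obtain rfl := j1
        exact h2
      by_cases i1 : i = 1
      · obtain rfl := i1
        by_cases hjn : j ≤ n / 2
        · have := h3' j (by omega)
          rwa [sgnTau, if_pos hjn] at this
        · have hodd : Odd n := by
            rw [Nat.odd_iff]; omega
          obtain rfl : j = (n + 1) / 2 := by omega
          exact (h1.single hodd).symm.trans h2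
      by_cases hij' : j = i
      · obtain rfl := hij'
        exact (h1.centerCorner j (by omega) hi').symm.trans h2
      · have := h1.centerEdge i j (by omega) hi' (by omega) hj' hij'
        rw [h2, h3' i (by omega), h3' j (by omega)] at this
        rw [one_mul, one_mul] at this
        exact this)
  exact ⟨m' * m, by rw [map_mul, mul_assoc]; exact hm'⟩

end Configuration

end

/-! ### Orientations and their sums -/

section
variable {n : ℕ}

open _root_.RubikCube.Configuration

/-- A way to measure the orientation of the cubies of an orbit by elements of `ZMod N`: `θ t` is the
orientation, relative to a reference orientation, of a cubie of the orbit whose reference sticker is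
found at `t`. -/
structure OrientationMeasure (n i j N : ℕ) (θ : Sticker n → ZMod N) (w : Sticker n → Prop) :
    Prop where
  /-- Every cubie of the orbit has a reference sticker. -/
  exists_ref : ∀ c ∈ orbit n i j, ∃ t : Sticker n, t.cubie = c ∧ w t
  ref_eq_zero : ∀ t : Sticker n, t.cubie ∈ orbit n i j → w t → θ t = 0
  injective : ∀ t t' : Sticker n, t.cubie = t'.cubie → t.cubie ∈ orbit n i j → θ t = θ t' → t = t'
  /-- All stickers of a cubie are turned by the same amount. -/
  rigid : ∀ (s : Configuration n) (t t' : Sticker n), t.cubie = t'.cubie → t.cubie ∈ orbit n i j →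
    θ (s.perm t) - θ t = θ (s.perm t') - θ t'

variable {i j N : ℕ} {θ : Sticker n → ZMod N} {w : Sticker n → Prop}

/-- The reference stickers of the cubies of an orbit. -/
abbrev RefSticker (n i j : ℕ) (w : Sticker n → Prop) := {t : Sticker n // t.cubie ∈ orbit n i j ∧ w t}

namespace OrientationMeasure

variable [Fintype (RefSticker n i j w)]

/-- The sum of the orientations is additive. -/
theorem sum_mul (h : OrientationMeasure n i j N θ w) (g s : Configuration n) :
    ∑ t : RefSticker n i j w, θ ((g * s).perm t.1) =
      ∑ t : RefSticker n i j w, θ (g.perm t.1) + ∑ t : RefSticker n i j w, θ (s.perm t.1) := by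
  have hmem : ∀ t : RefSticker n i j w, s.place t.1.cubie ∈ orbit n i j := fun t =>
    (s.place_mem_orbit i j _).2 t.2.1
  choose φ hφ1 hφ2 using fun t : RefSticker n i j w => h.exists_ref _ (hmem t)
  let ψ : RefSticker n i j w → RefSticker n i j w :=
    fun t => ⟨φ t, by rw [hφ1]; exact hmem t, hφ2 t⟩
  have hψ : Function.Bijective ψ := by
    refine Finite.injective_iff_bijective.1 fun t t' ht => ?_
    have h1 : φ t = φ t' := congrArg Subtype.val ht
    have h2 := congrArg Sticker.cubie h1
    rw [hφ1, hφ1] at h2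
    exact Subtype.ext (h.injective _ _ (s.place.injective h2) t.2.1
      ((h.ref_eq_zero _ t.2.1 t.2.2).trans (h.ref_eq_zero _ t'.2.1 t'.2.2).symm))
  rw [← hψ.sum_comp (fun t : RefSticker n i j w => θ (g.perm t.1)), ← Finset.sum_add_distrib]
  refine Finset.sum_congr rfl fun t _ => ?_
  have h1 := h.rigid g (s.perm t.1) (φ t) (by rw [hφ1, s.cubie_perm])
    (by rw [s.cubie_perm]; exact hmem t)
  rw [h.ref_eq_zero (φ t) (ψ t).2.1 (hφ2 t), sub_zero] at h1
  exact sub_eq_iff_eq_add.1 h1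

theorem sum_ofMove_mul (h : OrientationMeasure n i j N θ w)
    (h0 : ∀ r, ∑ t : RefSticker n i j w, θ ((ofRotation r).perm t.1) = 0) (m : Moves n)
    (s : Configuration n) : ∑ t : RefSticker n i j w, θ ((ofMove m * s).perm t.1) = 0 ↔
      ∑ t : RefSticker n i j w, θ (s.perm t.1) = 0 :=
  ofMove_mul_invariant (fun s => ∑ t : RefSticker n i j w, θ (s.perm t.1) = 0)
    (fun r s => by rw [h.sum_mul, h0, zero_add]) m s

end OrientationMeasure

/-- Some move leaves every cubie in its place and turns only the cubies `p` and `q`, by opposite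
amounts. -/
def Exchange (θ : Sticker n → ZMod N) (p q : Cubie n) : Prop :=
  ∃ m, moveCubies n m = 1 ∧
    (∀ t : Sticker n, t.cubie ≠ p → t.cubie ≠ q → moveStickers n m t = t) ∧
    (∀ t : Sticker n, t.cubie = p → θ (moveStickers n m t) = θ t + 1) ∧
    ∀ t : Sticker n, t.cubie = q → θ (moveStickers n m t) = θ t - 1

theorem cubie_moveStickers (m : Moves n) (t : Sticker n) :
    (moveStickers n m t).cubie = moveCubies n m t.cubie := by
  rw [← perm_ofMove, ← place_ofMove]
  exact (ofMove m).cubie_perm t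

theorem Exchange.symm {p q : Cubie n} (h : Exchange θ p q) : Exchange θ q p := by
  obtain ⟨m, h1, h2, h3, h4⟩ := h
  have h1' : moveCubies n m⁻¹ = 1 := by rw [map_inv, h1, inv_one]
  have h5 : ∀ t : Sticker n, moveStickers n m (moveStickers n m⁻¹ t) = t := fun t => by simp
  refine ⟨m⁻¹, h1', fun t ht ht' => ?_, fun t ht => ?_, fun t ht => ?_⟩
  · rw [map_inv, Equiv.Perm.inv_eq_iff_eq, h2 t ht' ht]
  · have := h4 (moveStickers n m⁻¹ t) (by rw [cubie_moveStickers, h1']; exact ht)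
    rw [h5] at this
    rw [this, sub_add_cancel]
  · have := h3 (moveStickers n m⁻¹ t) (by rw [cubie_moveStickers, h1']; exact ht)
    rw [h5] at this
    rw [this, add_sub_cancel_right]

theorem Exchange.trans (h : OrientationMeasure n i j N θ w) {p q r : Cubie n}
    (hq : q ∈ orbit n i j) (hpq : p ≠ q) (hqr : q ≠ r) (hpr : p ≠ r)
    (h1 : Exchange θ p q) (h2 : Exchange θ q r) : Exchange θ p r := by
  obtain ⟨m, a1, a2, a3, a4⟩ := h1
  obtain ⟨m', b1, b2, b3, b4⟩ := h2
  have hc : ∀ t : Sticker n, (moveStickers n m' t).cubie = t.cubie := fun t => by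
    rw [cubie_moveStickers, b1]; rfl
  have hc' : ∀ t : Sticker n, (moveStickers n m t).cubie = t.cubie := fun t => by
    rw [cubie_moveStickers, a1]; rfl
  refine ⟨m * m', by rw [map_mul, a1, b1, one_mul], fun t ht ht' => ?_, fun t ht => ?_,
    fun t ht => ?_⟩ <;> rw [map_mul, Equiv.Perm.mul_apply]
  · by_cases htq : t.cubie = q
    · refine h.injective _ _ (by rw [hc', hc]) (by rw [hc', hc, htq]; exact hq) ?_
      rw [a4 _ (by rw [hc, htq]), b3 t htq, add_sub_cancel_right]
    · rw [b2 t htq ht', a2 t ht htq]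
  · rw [b2 t (ht ▸ hpq) (ht ▸ hpr), a3 t ht]
  · rw [a2 _ (by rw [hc, ht]; exact hpr.symm) (by rw [hc, ht]; exact hqr.symm), b4 t ht]

/-- If cubies can be turned together with their images under slice rotations, then any two cubies of
the orbit can be turned together. -/
theorem OrientationMeasure.exchange (h : OrientationMeasure n i j N θ w)
    (hT : ∀ (r : SliceRotation n), ∀ c ∈ orbit n i j, turnCubie r.1 r.2 c ≠ c →
      Exchange θ c (turnCubie r.1 r.2 c)) {p q : Cubie n} (hp : p ∈ orbit n i j)
    (hq : q ∈ orbit n i j) (hpq : p ≠ q) : Exchange θ p q := by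
  have step : ∀ a b : orbit n i j, a.1 ≠ b.1 → Exchange θ a.1 b.1 →
      (p = b.1 ∨ Exchange θ p b.1) → (p = a.1 ∨ Exchange θ p a.1) := by
    rintro a b hab hE (hb | hb)
    · exact Or.inr (hb ▸ hE.symm)
    · by_cases hpa : p = a.1
      · exact Or.inl hpa
      · by_cases hpb : p = b.1
        · exact Or.inr (hpb ▸ hE.symm)
        · exact Or.inr (hb.trans h b.2 hpb hab.symm hpa hE.symm)
  have := orbit_connected (i := i) (j := j) (fun b => p = b.1 ∨ Exchange θ p b.1) ?_
    (a := ⟨p, hp⟩) (Or.inl rfl) ⟨q, hq⟩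
  · exact this.resolve_left hpq
  · intro r a b hab
    by_cases hne : a.1 = b.1
    · rw [hne]
    · have hE := hT r a.1 a.2 (by rw [hab]; exact fun e => hne e.symm)
      rw [hab] at hE
      exact ⟨step a b hne hE, step b a (fun e => hne e.symm) hE.symm⟩

/-- The moves exchanging orientation bring all cubies of an orbit into their correct orientation,
provided that the orientations sum up to zero. -/
theorem OrientationMeasure.exists_oriented [NeZero N] [Fintype (RefSticker n i j w)]
    (h : OrientationMeasure n i j N θ w)
    (h0 : ∀ r, ∑ t : RefSticker n i j w, θ ((ofRotation r).perm t.1) = 0)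
    (hT : ∀ (r : SliceRotation n), ∀ c ∈ orbit n i j, turnCubie r.1 r.2 c ≠ c →
      Exchange θ c (turnCubie r.1 r.2 c))
    (s : Configuration n) (hs : s.place = 1)
    (hsum : ∑ t : RefSticker n i j w, θ (s.perm t.1) = 0) :
    ∃ m, moveCubies n m = 1 ∧
      (∀ t : Sticker n, t.cubie ∉ orbit n i j → moveStickers n m t = t) ∧
      ∀ t : Sticker n, t.cubie ∈ orbit n i j → (ofMove m * s).perm t = t := by
  classical
  induction hK : (Finset.univ.filter fun t : RefSticker n i j w => θ (s.perm t.1) ≠ 0).card using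
    Nat.strong_induction_on generalizing s with
  | _ K ih =>
    have hcub : ∀ t, (s.perm t).cubie = t.cubie := fun t => by rw [s.cubie_perm, hs]; rfl
    by_cases hall : ∀ t : RefSticker n i j w, θ (s.perm t.1) = 0
    · refine ⟨1, by simp, fun t _ => by simp, fun t ht => ?_⟩
      obtain ⟨t', ht', hw⟩ := h.exists_ref _ ht
      have hr := h.rigid s t t' ht'.symm ht
      rw [hall ⟨t', ht' ▸ ht, hw⟩, h.ref_eq_zero t' (ht' ▸ ht) hw, sub_zero, sub_eq_zero] at hr
      rw [map_one, one_mul]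
      exact h.injective _ _ (hcub t) (by rw [hcub]; exact ht) hr
    · push Not at hall
      obtain ⟨t₁, ht₁⟩ := hall
      -- as the sum is zero, a second cubie is not oriented correctly
      obtain ⟨t₂, hne, ht₂⟩ : ∃ t₂, t₂ ≠ t₁ ∧ θ (s.perm t₂.1) ≠ 0 := by
        by_contra! hcon
        rw [Finset.sum_eq_single t₁ (fun t _ ht => hcon t ht) (fun h => absurd (Finset.mem_univ _) h)]
          at hsum
        exact ht₁ hsum
      have hcne : t₁.1.cubie ≠ t₂.1.cubie := fun e => hne (Subtype.ext (h.injective _ _ e t₁.2.1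
        ((h.ref_eq_zero _ t₁.2.1 t₁.2.2).trans (h.ref_eq_zero _ t₂.2.1 t₂.2.2).symm))).symm
      obtain ⟨m, m1, m2, m3, m4⟩ := h.exchange hT t₁.2.1 t₂.2.1 hcne
      have mc : ∀ t : Sticker n, (moveStickers n m t).cubie = t.cubie := fun t => by
        rw [cubie_moveStickers, m1]; rfl
      have hiter : ∀ (k : ℕ) (t : Sticker n), (moveStickers n (m ^ k) t).cubie = t.cubie ∧
          (t.cubie = t₁.1.cubie → θ (moveStickers n (m ^ k) t) = θ t + k) ∧
          (t.cubie ≠ t₁.1.cubie → t.cubie ≠ t₂.1.cubie → moveStickers n (m ^ k) t = t) := by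
        intro k
        induction k with
        | zero => simp
        | succ k ihk =>
          intro t
          obtain ⟨i1, i2, i3⟩ := ihk t
          rw [pow_succ', map_mul, Equiv.Perm.mul_apply]
          refine ⟨by rw [mc, i1], fun ht => ?_, fun ht ht' => ?_⟩
          · rw [m3 _ (by rw [i1, ht]), i2 ht]; push_cast; ring
          · rw [i3 ht ht', m2 t ht ht']
      -- the power of the exchange that corrects the first cubie
      set k : ℕ := (-θ (s.perm t₁.1)).val with hk
      have hkc : (k : ZMod N) = -θ (s.perm t₁.1) := ZMod.natCast_zmod_val _
      have hplace : moveCubies n (m ^ k) = 1 := by rw [map_pow, m1, one_pow]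
      have hfix : θ ((ofMove (m ^ k) * s).perm t₁.1) = 0 := by
        rw [perm_mul, Equiv.Perm.mul_apply, perm_ofMove, (hiter k _).2.1 (hcub _), hkc,
          add_neg_cancel]
      have hkeep : ∀ t : RefSticker n i j w, θ (s.perm t.1) = 0 →
          θ ((ofMove (m ^ k) * s).perm t.1) = 0 := by
        intro t ht
        have ht1 : t ≠ t₁ := by rintro rfl; exact ht₁ ht
        have ht2 : t ≠ t₂ := by rintro rfl; exact ht₂ ht
        have cne : ∀ t' : RefSticker n i j w, t ≠ t' → t.1.cubie ≠ t'.1.cubie := fun t' htt e =>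
          htt (Subtype.ext (h.injective _ _ e t.2.1
            ((h.ref_eq_zero _ t.2.1 t.2.2).trans (h.ref_eq_zero _ t'.2.1 t'.2.2).symm)))
        rw [perm_mul, Equiv.Perm.mul_apply, perm_ofMove, (hiter k _).2.2
          (by rw [hcub]; exact cne _ ht1) (by rw [hcub]; exact cne _ ht2), ht]
      obtain ⟨m', n1, n2, n3⟩ := ih _ (by
          rw [← hK]
          refine Finset.card_lt_card ⟨fun t ht => ?_, fun hsub => ?_⟩
          · rw [Finset.mem_filter] at ht ⊢
            exact ⟨ht.1, fun e => ht.2 (hkeep t e)⟩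
          · have := hsub (Finset.mem_filter.2 ⟨Finset.mem_univ t₁, ht₁⟩)
            exact (Finset.mem_filter.1 this).2 hfix)
        (ofMove (m ^ k) * s) (by rw [place_mul, place_ofMove, hplace, hs, one_mul])
        ((h.sum_ofMove_mul h0 _ _).2 hsum) rfl
      refine ⟨m' * m ^ k, by rw [map_mul, n1, hplace, one_mul], fun t ht => ?_, fun t ht => ?_⟩
      · rw [map_mul, Equiv.Perm.mul_apply, (hiter k t).2.2 (fun e => ht (e ▸ t₁.2.1))
          (fun e => ht (e ▸ t₂.2.1)), n2 t ht]
      · rw [map_mul, mul_assoc]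
        exact n3 t ht

/-- Suppose that a motion `A` normalizing the group fixes all stickers of a slice except those of
one cubie `p`, which it turns in its place. Then the commutator of `A` with the rotation of the slice
turns `p` and the image of `p`, by opposite amounts. -/
theorem OrientationMeasure.exchange_of_motion (h : OrientationMeasure n i j N θ w)
    (r : SliceRotation n) {p : Cubie n} (hp : p ∈ orbit n i j) (hpr : turnCubie r.1 r.2 p ≠ p)
    {A : Motion n} (hA : A ∈ Subgroup.normalizer (motionGroup n : Set (Motion n)))
    (hcomp : ∀ t, (A.1 t).cubie = A.2 t.cubie)
    (hfix : ∀ t : Sticker n, layer t.cubie.1 r.1 = r.2 → t.cubie ≠ p → A.1 t = t)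
    (hp2 : A.2 p = p) (hturn : ∀ t : Sticker n, t.cubie = p → θ (A.1 t) = θ t + 1) :
    Exchange θ p (turnCubie r.1 r.2 p) := by
  obtain ⟨k1, k2⟩ := r.2.2
  have hpk : layer p.1 r.1 = r.2 := by
    by_contra h
    exact hpr (turnCubie_of_ne h)
  obtain ⟨m, hm1, hm2⟩ := exists_move_commutator hA (turn_mem (d := r.1) k1 k2)
  let T : Set (Sticker n) := {t | layer t.cubie.1 r.1 = r.2}
  let S : Set (Sticker n) := {t | t ∈ T → t.cubie = p}
  have hST : ∀ t, t ∈ S ∩ T ↔ t.cubie = p := fun t =>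
    ⟨fun ht => ht.1 ht.2, fun ht => ⟨fun _ => ht, by show layer t.cubie.1 r.1 = r.2; rw [ht, hpk]⟩⟩
  have hS : ∀ t, t ∉ S → A.1 t = t := fun t ht => by
    have ht' : t ∈ T ∧ t.cubie ≠ p := by
      by_contra hcon
      exact ht fun h1 => by_contra fun h2 => hcon ⟨h1, h2⟩
    exact hfix t ht'.1 ht'.2
  have hT : ∀ t, t ∉ T → turnSticker r.1 r.2 t = t := fun t ht => turnSticker_of_ne ht
  have hA2 : ∀ c : Cubie n, layer c.1 r.1 = r.2 → A.2 c = c := fun c hc => by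
    by_cases hcp : c = p
    · rw [hcp, hp2]
    · obtain ⟨t, rfl⟩ := c.exists_sticker
      rw [← hcomp, hfix t hc hcp]
  have hAinv : ∀ t : Sticker n, (A.1⁻¹ t).cubie = A.2⁻¹ t.cubie := fun t => by
    rw [Equiv.Perm.eq_inv_iff_eq, ← hcomp]; simp
  have hp2' : A.2⁻¹ p = p := by rw [Equiv.Perm.inv_eq_iff_eq, hp2]
  have hBinv : ∀ t : Sticker n, ((turnSticker r.1 r.2)⁻¹ t).cubie = p ↔
      t.cubie = turnCubie r.1 r.2 p := fun t => by
    rw [cubie_turnSticker_inv, Equiv.Perm.inv_eq_iff_eq]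
  have hApre : ∀ t : Sticker n, (A.1⁻¹ t).cubie = p ↔ t.cubie = p := fun t => by
    rw [hAinv, Equiv.Perm.inv_eq_iff_eq, hp2]
  refine ⟨m, ?_, fun t ht ht' => ?_, fun t ht => ?_, fun t ht => ?_⟩
  · rw [hm2]
    ext1 c
    exact commutator_apply_of_notMem (S := {c : Cubie n | layer c.1 r.1 ≠ r.2})
      (T := {c : Cubie n | layer c.1 r.1 = r.2}) (A := A.2) (B := turnCubie r.1 r.2)
      (fun c hc => hA2 c (not_not.1 hc)) (fun c hc => turnCubie_of_ne hc)
      (fun h => h.1 h.2) (fun h => h.1 h.2) (fun h => h.1 h.2)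
  · rw [hm1]
    refine commutator_apply_of_notMem hS hT ?_ ?_ ?_
    · rwa [hST]
    · rwa [hST, hApre]
    · show (turnSticker r.1 r.2)⁻¹ t ∉ _
      rwa [hST, hBinv]
  · rw [hm1, ← hturn t ht]
    congr 1
    refine commutator_apply_of_mem hS hT ((hST t).2 ht) ?_
    show (turnSticker r.1 r.2)⁻¹ t ∉ _
    rw [hST, hBinv, ht]
    exact hpr.symm
  · obtain ⟨y, rfl⟩ := (turnSticker r.1 r.2).surjective t
    rw [cubie_turnSticker] at ht
    have hy : y.cubie = p := (turnCubie r.1 r.2).injective ht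
    have h1 : moveStickers n m (turnSticker r.1 r.2 y) = turnSticker r.1 r.2 (A.1⁻¹ y) := by
      rw [hm1]
      refine commutator_apply_image_right' hS hT ((hST _).2 ((hApre y).2 hy)) ?_
      show turnSticker r.1 r.2 (A.1⁻¹ y) ∉ _
      rw [hST, cubie_turnSticker, (hApre y).2 hy]
      exact hpr
    have h2 := hturn (A.1⁻¹ y) ((hApre y).2 hy)
    have h3 : A.1 (A.1⁻¹ y) = y := by simp
    have h4 := h.rigid (ofRotation r) (A.1⁻¹ y) y (by rw [(hApre y).2 hy, hy])
      (by rw [(hApre y).2 hy]; exact hp)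
    rw [h3] at h2
    rw [h2] at h4
    change θ (turnSticker r.1 r.2 (A.1⁻¹ y)) - _ = θ (turnSticker r.1 r.2 y) - _ at h4
    rw [h1]
    linear_combination h4

end

section
variable {n : ℕ}

open _root_.RubikCube.Configuration

/-! ### Frames of stickers -/

/-- The sticker `t` lies on the first face of the frame of `p`, and its cubie has the layers `1`,
`j`, `k` along that frame. -/
def StickerAt (t : Sticker n) (p : Flag) (j k : ℕ) : Prop :=
  t.dir = p.1.1 ∧ HasLayers t.cubie.1 p 1 j k

theorem StickerAt.unique {t t' : Sticker n} {p : Flag} {j k : ℕ} (h : StickerAt t p j k)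
    (h' : StickerAt t' p j k) : t = t' :=
  Sticker.ext_cubie_dir (Subtype.ext (h.2.unique h'.2)) (h.1.trans h'.1.symm)

theorem exists_stickerAt (p : Flag) {j k : ℕ} (hj : 1 ≤ j) (hj' : j ≤ n) (hk : 1 ≤ k)
    (hk' : k ≤ n) : ∃ t : Sticker n, StickerAt t p j k := by
  obtain ⟨c, hc⟩ := exists_hasLayers (n := n) p le_rfl (hj.trans hj') hj hj' hk hk'
  exact ⟨⟨(c, p.1.1), hc.1⟩, rfl, hc⟩

theorem StickerAt.turnSticker {t : Sticker n} {p : Flag} {j k : ℕ} (h : StickerAt t p j k)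
    (d : Dir) {l : ℕ} (hl : layer t.cubie.1 d = l) :
    StickerAt (RubikCube.turnSticker d l t) (cwFlag d p) j k := by
  rw [turnSticker_apply, if_pos (show layer t.1.1 d = l from hl)]
  exact ⟨congrArg (cwDir d) h.1, h.2.cw d⟩

theorem turnSticker_inv_of_ne {d : Dir} {l : ℕ} {t : Sticker n} (h : layer t.cubie.1 d ≠ l) :
    (RubikCube.turnSticker d l)⁻¹ t = t := by
  rw [Equiv.Perm.inv_eq_iff_eq, turnSticker_of_ne h]

theorem StickerAt.turnSticker_inv {t : Sticker n} {p : Flag} {j k : ℕ} (h : StickerAt t p j k)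
    (d : Dir) {l : ℕ} (hl : layer t.cubie.1 d = l) :
    StickerAt ((RubikCube.turnSticker d l)⁻¹ t) (cwFlag (opp d) p) j k := by
  have h2 := cwSticker_opp (opp d) t
  rw [opp_opp] at h2
  have h3 := layer_cwSticker d (cwSticker (opp d) t)
  rw [h2] at h3
  have h4 : (RubikCube.turnSticker d l)⁻¹ t = cwSticker (opp d) t := by
    rw [Equiv.Perm.inv_eq_iff_eq, turnSticker_apply, if_pos (h3.symm.trans hl), h2]
  rw [h4]
  exact ⟨congrArg (cwDir (opp d)) h.1, h.2.cw (opp d)⟩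

/-- Rotations of space preserve opposite directions, perpendicularity, and cross products. -/
theorem rotations_cross {R : Equiv.Perm Dir} (hR : R ∈ rotations) :
    (∀ d, R (opp d) = opp (R d)) ∧ ∀ d e : Dir, d.1 ≠ e.1 → (R d).1 ≠ (R e).1 ∧
      R (cross d e) = cross (R d) (R e) := by
  have axis : ∀ d e : Dir, d.1 = e.1 ↔ d = e ∨ d = opp e := by decide
  induction hR using Subgroup.closure_induction with
  | mem R hR =>
    obtain ⟨a, rfl⟩ := hR
    revert a
    decide +kernel
  | one => exact ⟨fun d => rfl, fun d e h => ⟨h, rfl⟩⟩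
  | mul R S _ _ ihR ihS =>
    refine ⟨fun d => ?_, fun d e h => ?_⟩
    · rw [Equiv.Perm.mul_apply, ihS.1, ihR.1, Equiv.Perm.mul_apply]
    · obtain ⟨h1, h2⟩ := ihS.2 d e h
      obtain ⟨h3, h4⟩ := ihR.2 _ _ h1
      exact ⟨h3, by rw [Equiv.Perm.mul_apply, h2, h4]; rfl⟩
  | inv R _ ih =>
    have ho : ∀ d, R⁻¹ (opp d) = opp (R⁻¹ d) := fun d => by
      rw [Equiv.Perm.inv_eq_iff_eq, ih.1]; simp
    have ha : ∀ d e : Dir, d.1 ≠ e.1 → (R⁻¹ d).1 ≠ (R⁻¹ e).1 := fun d e h h' => by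
      rw [axis] at h'
      refine h ((axis d e).2 (h'.imp (fun h => R⁻¹.injective h) fun h => ?_))
      rw [← ho] at h
      exact R⁻¹.injective h
    refine ⟨ho, fun d e h => ⟨ha d e h, ?_⟩⟩
    rw [Equiv.Perm.inv_eq_iff_eq, (ih.2 _ _ (ha d e h)).2]
    simp

/-- A configuration maps the frames of the stickers of a cubie by a rotation of space. -/
theorem Configuration.exists_rotation (s : Configuration n) (c : Cubie n) :
    ∃ R : Flag → Flag, (∀ p, (R p).next = R p.next) ∧ (∀ p, (R p).swap = R p.swap) ∧
      ∀ (t : Sticker n) (p : Flag), t.cubie = c → t.dir = p.1.1 →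
        (s.perm t).dir = (R p).1.1 := by
  obtain ⟨R, hR, h⟩ := s.rigid c
  obtain ⟨-, h2⟩ := rotations_cross hR
  refine ⟨fun p => ⟨(R p.1.1, R p.1.2), (h2 _ _ p.2).1⟩, fun p => ?_, fun p => rfl,
    fun t p ht hp => by rw [h t ht, hp]⟩
  refine Subtype.ext (Prod.ext rfl ?_)
  exact (h2 _ _ p.2).2.symm

/-- The determinant of two normals and a position measures the layer along their cross product. -/
theorem handedness_eq (c : Pos n) {d e : Dir} (h : d.1 ≠ e.1) :
    handedness c d e = n + 1 - 2 * layer c (cross d e) := by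
  obtain ⟨a, s⟩ := d
  obtain ⟨b, u⟩ := e
  have h0 := (c 0).isLt
  have h1 := (c 1).isLt
  have h2 := (c 2).isLt
  have e1 : (-1 : Fin 3) = 2 := rfl
  have e2 : (-2 : Fin 3) = 1 := rfl
  fin_cases a <;> fin_cases b <;> first | (exact absurd rfl h) | skip
  all_goals
    cases s <;> cases u <;>
    simp [handedness, Matrix.det_fin_three, normal, center, layer, cross, e1, e2] <;>
    omega

theorem dir_eq_or_of_layer_eq_one {c : Pos n} {p : Flag} {k : ℕ} (hn : 2 ≤ n)
    (h : HasLayers c p 1 1 k) (hk : 1 < k) (hk' : k < n) {d : Dir} (hd : layer c d = 1) :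
    d = p.1.1 ∨ d = p.1.2 := by
  rcases h.layer_cases d with g | g | g | g | g | g
  · exact Or.inl g.1
  · exact Or.inr g.1
  all_goals omega

theorem dir_eq_or_of_layer_eq_one' {c : Pos n} {p : Flag} (hn : 2 ≤ n)
    (h : HasLayers c p 1 1 1) {d : Dir} (hd : layer c d = 1) :
    d = p.1.1 ∨ d = p.1.2 ∨ d = p.third := by
  rcases h.layer_cases d with g | g | g | g | g | g
  · exact Or.inl g.1
  · exact Or.inr (Or.inl g.1)
  · exact Or.inr (Or.inr g.1)
  all_goals omega

/-! ### Corners -/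

/-- The orientation of a corner in terms of the frame of a sticker. -/
def cornerValue (p : Flag) : ZMod 3 := if p.1.1.1 = 2 then 0 else if p.1.2.1 = 2 then 1 else 2

theorem cornerValue_next (p : Flag) : cornerValue p.next = cornerValue p - 1 := by
  revert p; decide

theorem third_cross (p : Flag) : cross p.third p.1.1 = p.1.2 := by revert p; decide

theorem cornerTwist_eq (hn : 2 ≤ n) {t : Sticker n} {p : Flag} (h : StickerAt t p 1 1) :
    cornerTwist t = cornerValue p := by
  obtain ⟨hd, hl⟩ := h
  obtain ⟨h1, h2, h3⟩ := id hl
  have c21 : cross p.1.2 p.1.1 = opp p.third := third_swap p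
  have c31 : cross p.third p.1.1 = p.1.2 := third_cross p
  obtain ⟨n1, n2⟩ := third_axis_ne p
  have o3 := layer_opp t.cubie.1 p.third
  unfold cornerTwist cornerValue
  rw [hd]
  split_ifs with g1 g2 g3 g3
  · rfl
  · rfl
  · -- the third face is the front or back face, and it precedes the face of the sticker
    exfalso
    obtain ⟨e, he, hel, hneg⟩ := g2
    rcases dir_eq_or_of_layer_eq_one' hn hl hel with rfl | rfl | rfl
    · exact g1 he
    · exact g3 he
    · rw [handedness_eq _ n1, c31] at hneg
      omega
  · exfalso
    refine g2 ⟨p.1.2, g3, h2, ?_⟩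
    rw [handedness_eq _ p.2.symm, c21, o3, h3]
    push_cast
    omega
  · rfl

theorem exists_stickerAt_corner (hn : 2 ≤ n) {t : Sticker n} (h : t.cubie ∈ orbit n 1 1) :
    ∃ p, StickerAt t p 1 1 := by
  obtain ⟨p, hp⟩ := (mem_orbit_iff le_rfl (by omega) _).1 h
  rcases dir_eq_or_of_layer_eq_one' hn hp t.2 with g | g | g
  · exact ⟨p, g, hp⟩
  · exact ⟨p.next, g, hp.next⟩
  · exact ⟨p.next.next, g, hp.next.next⟩

theorem mem_orbit_of_stickerAt (hn : 2 ≤ n) {t : Sticker n} {p : Flag} {k : ℕ}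
    (h : StickerAt t p 1 k) : t.cubie ∈ orbit n 1 k :=
  (mem_orbit_iff le_rfl (by omega) _).2 ⟨p, h.2⟩

/-- The stickers of the corner of a given sticker. -/
theorem StickerAt.corner_cases (hn : 2 ≤ n) {t t' : Sticker n} {p : Flag} (h : StickerAt t p 1 1)
    (hc : t.cubie = t'.cubie) :
    StickerAt t' p 1 1 ∨ StickerAt t' p.next 1 1 ∨ StickerAt t' p.next.next 1 1 := by
  obtain ⟨hd, hl⟩ := h
  rw [hc] at hl
  rcases dir_eq_or_of_layer_eq_one' hn hl t'.2 with g | g | g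
  · exact Or.inl ⟨g, hl⟩
  · exact Or.inr (Or.inl ⟨g, hl.next⟩)
  · exact Or.inr (Or.inr ⟨g, hl.next.next⟩)

/-- The orientations of the corners; the white and yellow stickers serve as reference. -/
theorem cornerMeasure (hn : 2 ≤ n) :
    OrientationMeasure n 1 1 3 cornerTwist fun t => t.dir.1 = 2 where
  exists_ref c hc := by
    obtain ⟨p, hp⟩ := (mem_orbit_iff le_rfl (by omega) _).1 hc
    have h1 := cornerFlag_toCorner p
    have h2 := hp.toCorner
    exact ⟨⟨(c.1, p.toCorner.1.1), h2.1⟩, rfl, h1⟩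
  ref_eq_zero t _ hw := if_pos hw
  injective t t' hc ht h := by
    obtain ⟨p, hp⟩ := exists_stickerAt_corner hn ht
    have e0 : ∀ a : ZMod 3, a ≠ a - 1 ∧ a ≠ a - 1 - 1 := by decide
    rcases hp.corner_cases hn hc with h' | h' | h'
    · exact hp.unique h'
    · rw [cornerTwist_eq hn hp, cornerTwist_eq hn h', cornerValue_next] at h
      exact absurd h (e0 _).1
    · rw [cornerTwist_eq hn hp, cornerTwist_eq hn h', cornerValue_next, cornerValue_next] at h
      exact absurd h (e0 _).2
  rigid s t t' hc ht := by
    obtain ⟨R, hR1, -, hR⟩ := s.exists_rotation t.cubie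
    obtain ⟨p, hp⟩ := exists_stickerAt_corner hn ht
    have key : ∀ (u : Sticker n) (q : Flag), u.cubie = t.cubie → StickerAt u q 1 1 →
        StickerAt (s.perm u) (R q) 1 1 := by
      intro u q hu hq
      -- the other two stickers of the cubie show that the two other faces are outer faces
      have d1 : layer (s.place t.cubie).1 (R q).1.1 = 1 := by
        have := (s.perm u).2
        rw [← hu, ← s.cubie_perm, ← hR u q hu hq.1]
        exact this
      have d2 : ∀ q' : Flag, layer u.cubie.1 q'.1.1 = 1 →
          layer (s.place t.cubie).1 (R q').1.1 = 1 := by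
        intro q' hq'
        let v : Sticker n := ⟨(u.cubie.1, q'.1.1), hq'⟩
        have hv : v.cubie = t.cubie := hu
        rw [← hv, ← s.cubie_perm, ← hR v q' hv rfl]
        exact (s.perm v).2
      have l2 := d2 q.next hq.2.2.1
      have l3 := d2 q.next.next hq.2.2.2
      rw [← hR1] at l2
      rw [← hR1, ← hR1] at l3
      rw [← hu, ← s.cubie_perm] at d1 l2 l3
      exact ⟨hR u q hu hq.1, d1, l2, l3⟩
    have hs := key t p rfl hp
    rcases hp.corner_cases hn hc with h' | h' | h'
    · rw [hp.unique h']
    · have h'' := key t' _ hc.symm h'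
      rw [cornerTwist_eq hn hp, cornerTwist_eq hn h', cornerTwist_eq hn hs, cornerTwist_eq hn h'',
        ← hR1, cornerValue_next, cornerValue_next]
      ring
    · have h'' := key t' _ hc.symm h'
      rw [cornerTwist_eq hn hp, cornerTwist_eq hn h', cornerTwist_eq hn hs, cornerTwist_eq hn h'',
        ← hR1, ← hR1, cornerValue_next, cornerValue_next, cornerValue_next, cornerValue_next]
      ring

/-- A rotation of an outer slice on the frames of the stickers of corners. -/
def cornerStep (d : Dir) (p : Flag) : Flag :=
  if d = p.1.1 ∨ d = p.1.2 ∨ d = p.third then cwFlag d p else p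

/-- The inverse of `cornerStep`. -/
def cornerStepInv (d : Dir) (p : Flag) : Flag :=
  if d = p.1.1 ∨ d = p.1.2 ∨ d = p.third then cwFlag (opp d) p else p

theorem HasLayers.layer_eq_one_iff {c : Pos n} {p : Flag} (hn : 2 ≤ n) (h : HasLayers c p 1 1 1)
    (d : Dir) : layer c d = 1 ↔ d = p.1.1 ∨ d = p.1.2 ∨ d = p.third := by
  constructor
  · exact dir_eq_or_of_layer_eq_one' hn h
  · obtain ⟨h1, h2, h3⟩ := h
    rintro (rfl | rfl | rfl)
    exacts [h1, h2, h3]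

theorem StickerAt.cornerStep (hn : 2 ≤ n) {t : Sticker n} {p : Flag} (h : StickerAt t p 1 1)
    (d : Dir) : StickerAt (RubikCube.turnSticker d 1 t) (cornerStep d p) 1 1 := by
  unfold RubikCube.cornerStep
  split_ifs with hd
  · exact h.turnSticker d ((h.2.layer_eq_one_iff hn d).2 hd)
  · rw [← h.2.layer_eq_one_iff hn] at hd
    rwa [turnSticker_of_ne hd]

theorem StickerAt.cornerStepInv (hn : 2 ≤ n) {t : Sticker n} {p : Flag} (h : StickerAt t p 1 1)
    (d : Dir) : StickerAt ((RubikCube.turnSticker d 1)⁻¹ t) (cornerStepInv d p) 1 1 := by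
  unfold RubikCube.cornerStepInv
  split_ifs with hd
  · exact h.turnSticker_inv d ((h.2.layer_eq_one_iff hn d).2 hd)
  · rw [← h.2.layer_eq_one_iff hn] at hd
    rwa [turnSticker_inv_of_ne hd]

/-- Slice rotations do not change the sum of the orientations of the corners. -/
theorem sum_cornerTwist_ofRotation (hn : 2 ≤ n) (r : SliceRotation n) :
    ∑ t : CornerSticker n, cornerTwist ((ofRotation r).perm t.1) = 0 := by
  by_cases hr : (r.2 : ℕ) = 1
  · have hex : ∀ p : {p // CornerFlag p}, ∃ t : Sticker n, StickerAt t p.1 1 1 := fun p =>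
      exists_stickerAt p.1 le_rfl (by omega) le_rfl (by omega)
    choose P hP using hex
    let φ : {p // CornerFlag p} → CornerSticker n := fun p =>
      ⟨P p, mem_orbit_of_stickerAt hn (hP p), by rw [(hP p).1]; exact p.2⟩
    have hφ : Function.Bijective φ := by
      constructor
      · intro p q hpq
        have h1 : P p = P q := congrArg Subtype.val hpq
        have h2 := hP q
        rw [← h1] at h2
        exact Subtype.ext ((hP p).2.cornerFlag_unique hn h2.2 p.2 q.2)
      · intro t
        obtain ⟨p, hp⟩ := exists_stickerAt_corner hn t.2.1
        have hc : CornerFlag p := by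
          have := t.2.2
          rwa [hp.1] at this
        exact ⟨⟨p, hc⟩, Subtype.ext ((hP ⟨p, hc⟩).unique hp)⟩
    rw [← hφ.sum_comp]
    have hstep : ∀ p : {p // CornerFlag p}, cornerTwist ((ofRotation r).perm (φ p).1) =
        cornerValue (cornerStep r.1 p.1) := fun p => by
      show cornerTwist (turnSticker r.1 r.2 (P p)) = _
      rw [hr]
      exact cornerTwist_eq hn ((hP p).cornerStep hn r.1)
    rw [Finset.sum_congr rfl fun p _ => hstep p]
    have : ∀ d : Dir, ∑ p : {p // CornerFlag p}, cornerValue (cornerStep d p.1) = 0 := by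
      decide +kernel
    exact this r.1
  · refine Finset.sum_eq_zero fun t _ => ?_
    obtain ⟨p, hp⟩ := exists_stickerAt_corner hn t.2.1
    have hk := r.2.2
    have : layer t.1.1.1 r.1 ≠ r.2 := by
      show layer t.1.cubie.1 r.1 ≠ r.2
      rcases hp.2.layer_cases r.1 with g | g | g | g | g | g <;> omega
    show cornerTwist (turnSticker r.1 r.2 t.1) = 0
    rw [turnSticker_of_ne this]
    exact if_pos t.2.2

set_option synthInstance.maxSize 2000 in
/-- With `p = (d, e, f)` the motion is `Y X⁻¹ Y` with `Y = E⁻¹ X E`, where `E` and `X` are the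
rotations of the outer slices at `e` and opposite to `d`. Of the stickers of the outer slice at `d`,
`Y` moves only those of the corner `p`, and `X` none. -/
theorem exchange_corner (hn : 2 ≤ n) (r : SliceRotation n) (c : Cubie n) (hc : c ∈ orbit n 1 1)
    (hcr : turnCubie r.1 r.2 c ≠ c) : Exchange cornerTwist c (turnCubie r.1 r.2 c) := by
  obtain ⟨d, k, hk1, hk2⟩ := r
  have hck : layer c.1 d = k := by
    by_contra h
    exact hcr (turnCubie_of_ne h)
  obtain ⟨q, hq⟩ := (mem_orbit_iff le_rfl (by omega) _).1 hc
  obtain rfl : k = 1 := by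
    rcases hq.layer_cases d with g | g | g | g | g | g <;> omega
  obtain ⟨p, hpd, hp⟩ : ∃ p : Flag, d = p.1.1 ∧ HasLayers c.1 p 1 1 1 := by
    rcases dir_eq_or_of_layer_eq_one' hn hq hck with g | g | g
    · exact ⟨q, g, hq⟩
    · exact ⟨q.next, g, hq.next⟩
    · exact ⟨q.next.next, g, hq.next.next⟩
  subst hpd
  let E : Motion n := turn p.1.2 1
  let X : Motion n := turn (opp p.1.1) 1
  have hE : E ∈ motionGroup n := turn_mem le_rfl hk2
  have hX : X ∈ motionGroup n := turn_mem le_rfl hk2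
  let Y : Motion n := E⁻¹ * X * E
  have hY : Y ∈ motionGroup n := mul_mem (mul_mem (inv_mem hE) hX) hE
  have hA : Y * X⁻¹ * Y ∈ motionGroup n := mul_mem (mul_mem hY (inv_mem hX)) hY
  have hcomp : ∀ f ∈ motionGroup n, ∀ t, (f.1 t).cubie = f.2 t.cubie := by
    intro f hf t
    obtain ⟨m, h1, h2⟩ := mem_motionGroup.1 hf
    rw [← h1, ← h2, cubie_moveStickers]
  have hturn : ∀ t : Sticker n, t.cubie = c → ((Y * X⁻¹ * Y).1 t).cubie = c ∧
      cornerTwist ((Y * X⁻¹ * Y).1 t) = cornerTwist t + 1 := by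
    intro t ht
    have hp' : HasLayers t.cubie.1 p 1 1 1 := by rwa [ht]
    have key : ∀ (u : Flag), StickerAt t u 1 1 → StickerAt ((Y * X⁻¹ * Y).1 t)
        (cornerStepInv p.1.2 (cornerStep (opp p.1.1) (cornerStep p.1.2 (cornerStepInv (opp p.1.1)
          (cornerStepInv p.1.2 (cornerStep (opp p.1.1) (cornerStep p.1.2 u))))))) 1 1 := by
      intro u hu
      exact ((((((hu.cornerStep hn _).cornerStep hn _).cornerStepInv hn _).cornerStepInv hn
        _).cornerStep hn _).cornerStep hn _).cornerStepInv hn _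
    have model : ∀ p u : Flag, u = p ∨ u = p.next ∨ u = p.next.next →
        cornerStepInv p.1.2 (cornerStep (opp p.1.1) (cornerStep p.1.2 (cornerStepInv (opp p.1.1)
          (cornerStepInv p.1.2 (cornerStep (opp p.1.1) (cornerStep p.1.2 u)))))) =
          u.next.next := by decide +kernel
    have fin : ∀ u, (u = p ∨ u = p.next ∨ u = p.next.next) → StickerAt t u 1 1 →
        ((Y * X⁻¹ * Y).1 t).cubie = c ∧ cornerTwist ((Y * X⁻¹ * Y).1 t) = cornerTwist t + 1 := by
      intro u hu htu
      have h1 := key u htu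
      rw [model p u hu] at h1
      constructor
      · rw [← ht]
        exact Subtype.ext (h1.2.unique htu.2.next.next)
      · rw [cornerTwist_eq hn h1, cornerTwist_eq hn htu, cornerValue_next, cornerValue_next]
        have e0 : ∀ a : ZMod 3, a - 1 - 1 = a + 1 := by decide
        exact e0 _
    rcases dir_eq_or_of_layer_eq_one' hn hp' t.2 with g | g | g
    · exact fin p (Or.inl rfl) ⟨g, hp'⟩
    · exact fin p.next (Or.inr (Or.inl rfl)) ⟨g, hp'.next⟩
    · exact fin p.next.next (Or.inr (Or.inr rfl)) ⟨g, hp'.next.next⟩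
  refine (cornerMeasure hn).exchange_of_motion (p.1.1, ⟨1, hk1, hk2⟩) hc hcr
    (Subgroup.le_normalizer hA) (hcomp _ hA) ?_ ?_ fun t ht => (hturn t ht).2
  · intro t ht htc
    have ht1 : layer t.cubie.1 p.1.1 = 1 := ht
    have ho := layer_add_layer_opp t.cubie.1 p.1.1
    have hXt : turnSticker (opp p.1.1) 1 t = t := turnSticker_of_ne
      (show layer t.cubie.1 (opp p.1.1) ≠ 1 by omega)
    have hYt : Y.1 t = t := by
      show (turnSticker p.1.2 1)⁻¹ (turnSticker (opp p.1.1) 1 (turnSticker p.1.2 1 t)) = t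
      rw [Equiv.Perm.inv_eq_iff_eq]
      by_cases h2 : layer t.cubie.1 p.1.2 = 1
      · have h3 : layer t.cubie.1 p.third ≠ 1 := fun h3 =>
          htc (Subtype.ext (HasLayers.unique (p := p) ⟨ht1, h2, h3⟩ hp))
        have h4 : (turnSticker p.1.2 1 t).cubie.1 = cwPos p.1.2 t.cubie.1 := by
          rw [turnSticker_apply, if_pos (show layer t.1.1 p.1.2 = 1 from h2)]; rfl
        have aux : ∀ p : Flag, cwDir (opp p.1.2) (opp p.1.1) = p.third := by decide
        refine turnSticker_of_ne ?_
        show layer (turnSticker p.1.2 1 t).cubie.1 (opp p.1.1) ≠ 1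
        rwa [h4, layer_cwPos, aux]
      · rw [turnSticker_of_ne h2, hXt]
    show Y.1 ((turnSticker (opp p.1.1) 1)⁻¹ (Y.1 t)) = t
    rw [hYt, Equiv.Perm.inv_eq_iff_eq.2 hXt.symm, hYt]
  · obtain ⟨t, ht⟩ := c.exists_sticker
    rw [← ht, ← hcomp _ hA, (hturn t ht).1, ht]

end

section
variable {n : ℕ}

open _root_.RubikCube.Configuration

/-! ### Single edges -/

open Classical in
/-- The orientation of a single edge whose marked sticker is found at `t`. -/
noncomputable def singleValue (t : Sticker n) : ZMod 2 := if SingleMark t then 0 else 1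

/-- The orientation of a single edge in terms of the frame of a sticker. -/
def edgeValue (p : Flag) : ZMod 2 := if EdgeFlag p then 0 else 1

theorem edgeValue_swap (p : Flag) : edgeValue p.swap = edgeValue p + 1 := by
  revert p; decide

variable {m : ℕ}

theorem singleMark_iff (hn : 2 ≤ n) (hm : 2 * m = n + 1) {t : Sticker n} {p : Flag}
    (h : StickerAt t p 1 m) : SingleMark t ↔ EdgeFlag p := by
  unfold SingleMark EdgeFlag
  rw [h.1]
  constructor
  · rintro ⟨e, he, hl⟩
    rcases dir_eq_or_of_layer_eq_one hn h.2 (by omega) (by omega) hl with rfl | rfl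
    · have aux : ∀ a : Fin 3, a ≠ a - 1 := by decide
      exact absurd he (aux _)
    · exact he
  · exact fun he => ⟨p.1.2, he, h.2.2.1⟩

theorem singleValue_eq (hn : 2 ≤ n) (hm : 2 * m = n + 1) {t : Sticker n} {p : Flag}
    (h : StickerAt t p 1 m) : singleValue t = edgeValue p := by
  unfold singleValue edgeValue
  simp only [singleMark_iff hn hm h]

theorem exists_stickerAt_edge (hn : 2 ≤ n) (hm : 2 * m = n + 1) {t : Sticker n}
    (h : t.cubie ∈ orbit n 1 m) : ∃ p, StickerAt t p 1 m := by
  obtain ⟨p, hp⟩ := (mem_orbit_iff le_rfl (by omega) _).1 h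
  rcases dir_eq_or_of_layer_eq_one hn hp (by omega) (by omega) t.2 with g | g
  · exact ⟨p, g, hp⟩
  · exact ⟨p.swap, g, hp.swap_middle hm⟩

/-- The stickers of the single edge of a given sticker. -/
theorem StickerAt.edge_cases (hn : 2 ≤ n) (hm : 2 * m = n + 1) {t t' : Sticker n} {p : Flag}
    (h : StickerAt t p 1 m) (hc : t.cubie = t'.cubie) :
    StickerAt t' p 1 m ∨ StickerAt t' p.swap 1 m := by
  obtain ⟨hd, hl⟩ := h
  rw [hc] at hl
  rcases dir_eq_or_of_layer_eq_one hn hl (by omega) (by omega) t'.2 with g | g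
  · exact Or.inl ⟨g, hl⟩
  · exact Or.inr ⟨g, hl.swap_middle hm⟩

/-- The orientations of the single edges; the marked stickers serve as reference. -/
theorem edgeMeasure (hn : 2 ≤ n) (hm : 2 * m = n + 1) :
    OrientationMeasure n 1 m 2 singleValue SingleMark where
  exists_ref c hc := by
    obtain ⟨p, hp⟩ := (mem_orbit_iff le_rfl (by omega) _).1 hc
    have h2 := hp.toEdge hm
    refine ⟨⟨(c.1, p.toEdge.1.1), h2.1⟩, rfl, ?_⟩
    exact (singleMark_iff hn hm (t := ⟨(c.1, p.toEdge.1.1), h2.1⟩) (p := p.toEdge)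
      ⟨rfl, h2⟩).2 (edgeFlag_toEdge p)
  ref_eq_zero t _ hw := if_pos hw
  injective t t' hc ht h := by
    obtain ⟨p, hp⟩ := exists_stickerAt_edge hn hm ht
    have e0 : ∀ a : ZMod 2, a ≠ a + 1 := by decide
    rcases hp.edge_cases hn hm hc with h' | h'
    · exact hp.unique h'
    · rw [singleValue_eq hn hm hp, singleValue_eq hn hm h', edgeValue_swap] at h
      exact absurd h (e0 _)
  rigid s t t' hc ht := by
    obtain ⟨R, -, hR2, hR⟩ := s.exists_rotation t.cubie
    obtain ⟨p, hp⟩ := exists_stickerAt_edge hn hm ht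
    have key : ∀ (u : Sticker n) (q : Flag), u.cubie = t.cubie → StickerAt u q 1 m →
        StickerAt (s.perm u) (R q) 1 m := by
      intro u q hu hq
      -- the other sticker of the cubie shows that the other face is an outer face
      have hu' : (s.perm u).cubie ∈ orbit n 1 m := by
        rw [s.cubie_perm, s.place_mem_orbit, hu]
        exact ht
      obtain ⟨q', hq'⟩ := exists_stickerAt_edge hn hm hu'
      have h1 : q'.1.1 = (R q).1.1 := by rw [← hq'.1, hR u q hu hq.1]
      let v : Sticker n := ⟨(u.cubie.1, q.swap.1.1), hq.2.2.1⟩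
      have h2 : layer (s.perm u).cubie.1 (R q).1.2 = 1 := by
        have hv : v.cubie = t.cubie := hu
        have h3 := (s.perm v).2
        have h4 : (s.perm v).dir = (R q).1.2 := by
          rw [hR v q.swap hv rfl, ← hR2]; rfl
        have h5 : (s.perm u).cubie = (s.perm v).cubie := by
          rw [s.cubie_perm, s.cubie_perm, hu, hv]
        rw [h5, ← h4]
        exact h3
      rcases dir_eq_or_of_layer_eq_one hn hq'.2 (by omega) (by omega) h2 with g | g
      · exact absurd (congrArg Prod.fst (g.trans h1)).symm (R q).2
      · have : R q = q' := Subtype.ext (Prod.ext h1.symm g)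
        rwa [this]
    have hs := key t p rfl hp
    rcases hp.edge_cases hn hm hc with h' | h'
    · rw [hp.unique h']
    · have h'' := key t' _ hc.symm h'
      rw [singleValue_eq hn hm hp, singleValue_eq hn hm h', singleValue_eq hn hm hs,
        singleValue_eq hn hm h'', ← hR2, edgeValue_swap, edgeValue_swap]
      ring

/-- A rotation of an outer slice on the frames of the stickers of single edges. -/
def edgeStep (d : Dir) (p : Flag) : Flag :=
  if d = p.1.1 ∨ d = p.1.2 then cwFlag d p else p

/-- The inverse of `edgeStep`. -/
def edgeStepInv (d : Dir) (p : Flag) : Flag :=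
  if d = p.1.1 ∨ d = p.1.2 then cwFlag (opp d) p else p

/-- A rotation of a middle slice on the frames of the stickers of single edges. -/
def middleStep (d : Dir) (p : Flag) : Flag :=
  if d.1 = p.third.1 then cwFlag d p else p

/-- The inverse of `middleStep`. -/
def middleStepInv (d : Dir) (p : Flag) : Flag :=
  if d.1 = p.third.1 then cwFlag (opp d) p else p

theorem HasLayers.layer_eq_one_iff_edge {c : Pos n} {p : Flag} (hn : 2 ≤ n)
    (hm : 2 * m = n + 1) (h : HasLayers c p 1 1 m) (d : Dir) :
    layer c d = 1 ↔ d = p.1.1 ∨ d = p.1.2 := by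
  constructor
  · exact dir_eq_or_of_layer_eq_one hn h (by omega) (by omega)
  · obtain ⟨h1, h2, h3⟩ := h
    rintro (rfl | rfl)
    exacts [h1, h2]

theorem HasLayers.layer_eq_middle_iff {c : Pos n} {p : Flag} (hn : 2 ≤ n)
    (hm : 2 * m = n + 1) (h : HasLayers c p 1 1 m) (d : Dir) :
    layer c d = m ↔ d.1 = p.third.1 := by
  have aux : ∀ d e : Dir, d.1 = e.1 ↔ d = e ∨ d = opp e := by decide
  constructor
  · intro hd
    rcases h.layer_cases d with g | g | g | g | g | g
    · omega
    · omega
    · rw [g.1]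
    · omega
    · omega
    · rw [g.1]; rfl
  · rw [aux]
    rintro (rfl | rfl)
    · exact h.2.2
    · rw [layer_opp, h.2.2]; omega

theorem StickerAt.edgeStep (hn : 2 ≤ n) (hm : 2 * m = n + 1) {t : Sticker n} {p : Flag}
    (h : StickerAt t p 1 m) (d : Dir) :
    StickerAt (RubikCube.turnSticker d 1 t) (edgeStep d p) 1 m := by
  unfold RubikCube.edgeStep
  split_ifs with hd
  · exact h.turnSticker d ((h.2.layer_eq_one_iff_edge hn hm d).2 hd)
  · rw [← h.2.layer_eq_one_iff_edge hn hm] at hd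
    rwa [turnSticker_of_ne hd]

theorem StickerAt.edgeStepInv (hn : 2 ≤ n) (hm : 2 * m = n + 1) {t : Sticker n} {p : Flag}
    (h : StickerAt t p 1 m) (d : Dir) :
    StickerAt ((RubikCube.turnSticker d 1)⁻¹ t) (edgeStepInv d p) 1 m := by
  unfold RubikCube.edgeStepInv
  split_ifs with hd
  · exact h.turnSticker_inv d ((h.2.layer_eq_one_iff_edge hn hm d).2 hd)
  · rw [← h.2.layer_eq_one_iff_edge hn hm] at hd
    rwa [turnSticker_inv_of_ne hd]

theorem StickerAt.middleStep (hn : 2 ≤ n) (hm : 2 * m = n + 1) {t : Sticker n} {p : Flag}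
    (h : StickerAt t p 1 m) (d : Dir) :
    StickerAt (RubikCube.turnSticker d m t) (middleStep d p) 1 m := by
  unfold RubikCube.middleStep
  split_ifs with hd
  · exact h.turnSticker d ((h.2.layer_eq_middle_iff hn hm d).2 hd)
  · rw [← h.2.layer_eq_middle_iff hn hm] at hd
    rwa [turnSticker_of_ne hd]

theorem StickerAt.middleStepInv (hn : 2 ≤ n) (hm : 2 * m = n + 1) {t : Sticker n} {p : Flag}
    (h : StickerAt t p 1 m) (d : Dir) :
    StickerAt ((RubikCube.turnSticker d m)⁻¹ t) (middleStepInv d p) 1 m := by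
  unfold RubikCube.middleStepInv
  split_ifs with hd
  · exact h.turnSticker_inv d ((h.2.layer_eq_middle_iff hn hm d).2 hd)
  · rw [← h.2.layer_eq_middle_iff hn hm] at hd
    rwa [turnSticker_inv_of_ne hd]

/-- Slice rotations do not change the sum of the orientations of the single edges. -/
theorem sum_singleValue_ofRotation (hn : 2 ≤ n) (hm : 2 * m = n + 1)
    [Fintype (RefSticker n 1 m SingleMark)] (r : SliceRotation n) :
    ∑ t : RefSticker n 1 m SingleMark, singleValue ((ofRotation r).perm t.1) = 0 := by
  by_cases hr : (r.2 : ℕ) = 1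
  · have hex : ∀ p : {p // EdgeFlag p}, ∃ t : Sticker n, StickerAt t p.1 1 m := fun p =>
      exists_stickerAt p.1 le_rfl (by omega) (by omega) (by omega)
    choose P hP using hex
    let φ : {p // EdgeFlag p} → RefSticker n 1 m SingleMark := fun p =>
      ⟨P p, mem_orbit_of_stickerAt hn (hP p), (singleMark_iff hn hm (hP p)).2 p.2⟩
    have hφ : Function.Bijective φ := by
      constructor
      · intro p q hpq
        have h1 : P p = P q := congrArg Subtype.val hpq
        have h2 := hP q
        rw [← h1] at h2
        exact Subtype.ext ((hP p).2.edgeFlag_unique hn hm h2.2 p.2 q.2)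
      · intro t
        obtain ⟨p, hp⟩ := exists_stickerAt_edge hn hm t.2.1
        have hc : EdgeFlag p := (singleMark_iff hn hm hp).1 t.2.2
        exact ⟨⟨p, hc⟩, Subtype.ext ((hP ⟨p, hc⟩).unique hp)⟩
    rw [← hφ.sum_comp]
    have hstep : ∀ p : {p // EdgeFlag p}, singleValue ((ofRotation r).perm (φ p).1) =
        edgeValue (edgeStep r.1 p.1) := fun p => by
      show singleValue (turnSticker r.1 r.2 (P p)) = _
      rw [hr]
      exact singleValue_eq hn hm ((hP p).edgeStep hn hm r.1)
    rw [Finset.sum_congr rfl fun p _ => hstep p]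
    have : ∀ d : Dir, ∑ p : {p // EdgeFlag p}, edgeValue (edgeStep d p.1) = 0 := by
      decide +kernel
    exact this r.1
  · refine Finset.sum_eq_zero fun t _ => ?_
    obtain ⟨p, hp⟩ := exists_stickerAt_edge hn hm t.2.1
    have hk := r.2.2
    have : layer t.1.1.1 r.1 ≠ r.2 := by
      show layer t.1.cubie.1 r.1 ≠ r.2
      rcases hp.2.layer_cases r.1 with g | g | g | g | g | g <;> omega
    show singleValue (turnSticker r.1 r.2 t.1) = 0
    rw [turnSticker_of_ne this]
    exact if_pos t.2.2

set_option synthInstance.maxSize 2000 in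
/-- With `p = (d, e)` the motion is `E M² E⁻² M⁻¹ E`, where `E` is the rotation of the outer slice at
`e` and `M` the rotation of the middle slice between `d` and its opposite. Of the outer slice at `d`
only the cubie `p` is moved into the middle slice by `E` or `E⁻¹`, so the others stay. -/
theorem exchange_edge (hn : 2 ≤ n) (hm : 2 * m = n + 1) (r : SliceRotation n) (c : Cubie n)
    (hc : c ∈ orbit n 1 m) (hcr : turnCubie r.1 r.2 c ≠ c) :
    Exchange singleValue c (turnCubie r.1 r.2 c) := by
  obtain ⟨d, k, hk1, hk2⟩ := r
  have hck : layer c.1 d = k := by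
    by_contra h
    exact hcr (turnCubie_of_ne h)
  obtain ⟨q, hq⟩ := (mem_orbit_iff le_rfl (by omega) _).1 hc
  obtain rfl : k = 1 := by
    rcases hq.layer_cases d with g | g | g | g | g | g <;> omega
  obtain ⟨p, hpd, hp⟩ : ∃ p : Flag, d = p.1.1 ∧ HasLayers c.1 p 1 1 m := by
    rcases dir_eq_or_of_layer_eq_one hn hq (by omega) (by omega) hck with g | g
    · exact ⟨q, g, hq⟩
    · exact ⟨q.swap, g, hq.swap_middle hm⟩
  subst hpd
  let E : Motion n := turn p.1.2 1
  let M : Motion n := turn p.1.1 m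
  have hE : E ∈ Subgroup.normalizer (motionGroup n : Set (Motion n)) :=
    turn_mem_normalizer _ le_rfl (by omega)
  have hM : M ∈ Subgroup.normalizer (motionGroup n : Set (Motion n)) :=
    turn_mem_normalizer _ (by omega) (by omega)
  let A : Motion n := E * M * M * E⁻¹ * E⁻¹ * M⁻¹ * E
  have hA : A ∈ Subgroup.normalizer (motionGroup n : Set (Motion n)) :=
    mul_mem (mul_mem (mul_mem (mul_mem (mul_mem (mul_mem hE hM) hM) (inv_mem hE)) (inv_mem hE))
      (inv_mem hM)) hE
  have hA1 : ∀ t, A.1 t = turnSticker p.1.2 1 (turnSticker p.1.1 m (turnSticker p.1.1 m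
      ((turnSticker p.1.2 1)⁻¹ ((turnSticker p.1.2 1)⁻¹ ((turnSticker p.1.1 m)⁻¹
        (turnSticker p.1.2 1 t)))))) := fun t => rfl
  have hcomp : ∀ t, (A.1 t).cubie = A.2 t.cubie := by
    intro t
    rw [hA1, cubie_turnSticker, cubie_turnSticker, cubie_turnSticker, cubie_turnSticker_inv,
      cubie_turnSticker_inv, cubie_turnSticker_inv, cubie_turnSticker]
    rfl
  have hturn : ∀ t : Sticker n, t.cubie = c → (A.1 t).cubie = c ∧
      singleValue (A.1 t) = singleValue t + 1 := by
    intro t ht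
    have hp' : HasLayers t.cubie.1 p 1 1 m := by rwa [ht]
    have key : ∀ (u : Flag), StickerAt t u 1 m → StickerAt (A.1 t)
        (edgeStep p.1.2 (middleStep p.1.1 (middleStep p.1.1 (edgeStepInv p.1.2 (edgeStepInv p.1.2
          (middleStepInv p.1.1 (edgeStep p.1.2 u))))))) 1 m := by
      intro u hu
      exact ((((((hu.edgeStep hn hm _).middleStepInv hn hm _).edgeStepInv hn hm _).edgeStepInv
        hn hm _).middleStep hn hm _).middleStep hn hm _).edgeStep hn hm _
    have model : ∀ p u : Flag, u = p ∨ u = p.swap →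
        edgeStep p.1.2 (middleStep p.1.1 (middleStep p.1.1 (edgeStepInv p.1.2 (edgeStepInv p.1.2
          (middleStepInv p.1.1 (edgeStep p.1.2 u)))))) = u.swap := by decide +kernel
    have fin : ∀ u, (u = p ∨ u = p.swap) → StickerAt t u 1 m →
        (A.1 t).cubie = c ∧ singleValue (A.1 t) = singleValue t + 1 := by
      intro u hu htu
      have h1 := key u htu
      rw [model p u hu] at h1
      constructor
      · rw [← ht]
        exact Subtype.ext (h1.2.unique (htu.2.swap_middle hm))
      · rw [singleValue_eq hn hm h1, singleValue_eq hn hm htu, edgeValue_swap]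
    rcases dir_eq_or_of_layer_eq_one hn hp' (by omega) (by omega) t.2 with g | g
    · exact fin p (Or.inl rfl) ⟨g, hp'⟩
    · exact fin p.swap (Or.inr rfl) ⟨g, hp'.swap_middle hm⟩
  refine (edgeMeasure hn hm).exchange_of_motion (p.1.1, ⟨1, hk1, hk2⟩) hc hcr hA hcomp ?_ ?_
    fun t ht => (hturn t ht).2
  · intro t ht htc
    have ht1 : layer t.cubie.1 p.1.1 = 1 := ht
    rw [hA1]
    by_cases h2 : layer t.cubie.1 p.1.2 = 1
    · have h3 : layer t.cubie.1 p.third ≠ m := fun h3 =>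
        htc (Subtype.ext (HasLayers.unique (p := p) ⟨ht1, h2, h3⟩ hp))
      have ho := layer_add_layer_opp t.cubie.1 p.third
      have aux : ∀ p : Flag, cwDir p.1.2 p.1.1 = p.third ∧
        cwDir (opp p.1.2) p.1.1 = opp p.third := by decide
      have h4 : layer (turnSticker p.1.2 1 t).cubie.1 p.1.1 ≠ m := by
        rw [turnSticker_apply, if_pos (show layer t.1.1 p.1.2 = 1 from h2)]
        show layer (cwPos p.1.2 t.cubie.1) p.1.1 ≠ m
        rw [layer_cwPos, (aux p).2]
        omega
      have h5 : layer ((turnSticker p.1.2 1)⁻¹ t).cubie.1 p.1.1 ≠ m := by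
        rw [cubie_turnSticker_inv, turnCubie_inv_of_eq h2]
        show layer (cwPos (opp p.1.2) t.cubie.1) p.1.1 ≠ m
        rw [layer_cwPos, opp_opp, (aux p).1]
        exact h3
      have h6 : ∀ u : Sticker n, (turnSticker p.1.2 1)⁻¹ (turnSticker p.1.2 1 u) = u := by simp
      have h7 : ∀ u : Sticker n, turnSticker p.1.2 1 ((turnSticker p.1.2 1)⁻¹ u) = u := by simp
      rw [turnSticker_inv_of_ne h4, h6, turnSticker_of_ne h5, turnSticker_of_ne h5, h7]
    · have h4 : layer t.cubie.1 p.1.1 ≠ m := by omega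
      rw [turnSticker_of_ne h2, turnSticker_inv_of_ne h4, turnSticker_inv_of_ne h2,
        turnSticker_inv_of_ne h2, turnSticker_of_ne h4, turnSticker_of_ne h4, turnSticker_of_ne h2]
  · obtain ⟨t, ht⟩ := c.exists_sticker
    rw [← ht, ← hcomp, (hturn t ht).1, ht]

/-! ### Coupled edges and centers -/

theorem axis_ne_of_layer_eq_one (hn : 2 ≤ n) {c : Pos n} {d e : Dir} (hd : layer c d = 1)
    (he : layer c e = 1) (hde : e ≠ d) : d.1 ≠ e.1 := by
  have aux : ∀ d e : Dir, d.1 = e.1 → e = d ∨ e = opp d := by decide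
  intro h
  rcases aux d e h with h | h
  · exact hde h
  · have := layer_add_layer_opp c d
    rw [h] at he
    omega

theorem coupledMark_iff (hn : 2 ≤ n) (t : Sticker n) : CoupledMark t ↔
    ∃ e : Dir, t.dir.1 ≠ e.1 ∧ layer t.cubie.1 e = 1 ∧
      n + 1 < 2 * layer t.cubie.1 (cross t.dir e) := by
  unfold CoupledMark
  refine exists_congr fun e => ⟨fun ⟨h1, h2, h3⟩ => ?_, fun ⟨h1, h2, h3⟩ => ?_⟩
  · have h4 : t.dir.1 ≠ e.1 := axis_ne_of_layer_eq_one hn t.2 h2 h1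
    rw [handedness_eq _ h4] at h3
    exact ⟨h4, h2, by omega⟩
  · refine ⟨fun h => h1 (by rw [h]), h2, ?_⟩
    rw [handedness_eq _ h1]
    omega

/-- Slice rotations preserve the marks of the coupled edges. -/
theorem coupledMark_turnSticker (hn : 2 ≤ n) (d : Dir) (k : ℕ) (t : Sticker n) :
    CoupledMark (turnSticker d k t) ↔ CoupledMark t := by
  rw [turnSticker_apply]
  split_ifs
  · rw [coupledMark_iff hn, coupledMark_iff hn, ← (cwDir d).exists_congr_right]
    refine exists_congr fun e => ?_
    have aux : ∀ d a b : Dir, (a.1 ≠ b.1 ↔ (cwDir d a).1 ≠ (cwDir d b).1) ∧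
        (a.1 ≠ b.1 → cross (cwDir d a) (cwDir d b) = cwDir d (cross a b)) := by decide +kernel
    obtain ⟨h1, h2⟩ := aux d t.dir e
    show ((cwDir d t.dir).1 ≠ (cwDir d e).1 ∧ layer (cwPos d t.cubie.1) (cwDir d e) = 1 ∧
      n + 1 < 2 * layer (cwPos d t.cubie.1) (cross (cwDir d t.dir) (cwDir d e))) ↔ _
    rw [← h1, layer_cw]
    refine and_congr_right fun h => ?_
    rw [h2 h, layer_cw]
  · rfl

theorem coupledMark_ofMove_mul (hn : 2 ≤ n) (m : Moves n) (s : Configuration n) (t : Sticker n) :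
    CoupledMark ((ofMove m * s).perm t) ↔ CoupledMark (s.perm t) := by
  have := ofMove_mul_invariant (n := n)
    (fun s' => CoupledMark (s'.perm t) ↔ CoupledMark (s.perm t)) (fun r s' => by
      rw [show CoupledMark ((ofRotation r * s').perm t) ↔ CoupledMark (s'.perm t) from
        coupledMark_turnSticker hn r.1 r.2 (s'.perm t)]) m s
  exact this.2 Iff.rfl

/-- Each coupled edge has exactly one marked sticker. -/
theorem coupledMark_iff_of_stickerAt (hn : 2 ≤ n) {t : Sticker n} {p : Flag} {k : ℕ}
    (hk : 1 < k) (hk' : k < n) (h : StickerAt t p 1 k) : CoupledMark t ↔ n + 1 < 2 * k := by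
  rw [coupledMark_iff hn, h.1]
  constructor
  · rintro ⟨e, h1, h2, h3⟩
    rcases dir_eq_or_of_layer_eq_one hn h.2 hk hk' h2 with rfl | rfl
    · exact absurd rfl h1
    · have h4 : layer t.cubie.1 (cross p.1.1 p.1.2) = k := h.2.2.2
      rwa [h4] at h3
  · intro h1
    refine ⟨p.1.2, p.2, h.2.2.1, ?_⟩
    have h4 : layer t.cubie.1 (cross p.1.1 p.1.2) = k := h.2.2.2
    rwa [h4]

/-- A configuration that leaves a coupled edge in its place and respects its mark fixes its
stickers. -/
theorem perm_eq_self_of_coupledMark (hn : 2 ≤ n) {s : Configuration n} (hs : s.place = 1) {k : ℕ}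
    (hk : 1 < k) (hk' : k ≤ n / 2)
    (hy : ∀ t : Sticker n, t.cubie ∈ orbit n 1 k → CoupledMark t → CoupledMark (s.perm t))
    (t : Sticker n) (ht : t.cubie ∈ orbit n 1 k) : s.perm t = t := by
  have hcub : ∀ t, (s.perm t).cubie = t.cubie := fun t => by rw [s.cubie_perm, hs]; rfl
  obtain ⟨p, hp⟩ := (mem_orbit_iff le_rfl (by omega) _).1 ht
  have hsw : HasLayers t.cubie.1 p.swap 1 1 (n + 1 - k) := hp.swap
  -- the marked sticker
  let v : Sticker n := ⟨(t.cubie.1, p.swap.1.1), hsw.1⟩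
  have hvc : v.cubie = t.cubie := rfl
  have hmark : ∀ u : Sticker n, u.cubie = t.cubie → (CoupledMark u ↔ u = v) := by
    intro u hu
    rcases dir_eq_or_of_layer_eq_one hn hp hk (by omega) (hu ▸ u.2 : layer t.cubie.1 u.dir = 1)
      with g | g
    · have hu1 : StickerAt u p 1 k := ⟨g, hu ▸ hp⟩
      rw [coupledMark_iff_of_stickerAt hn hk (by omega) hu1]
      refine ⟨fun h => by omega, fun h => ?_⟩
      have h2 : p.1.1 = p.1.2 := by rw [← g, h]; rfl
      exact absurd (congrArg Prod.fst h2) p.2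
    · have hu1 : StickerAt u p.swap 1 (n + 1 - k) := ⟨g, hu ▸ hsw⟩
      rw [coupledMark_iff_of_stickerAt hn (by omega) (by omega) hu1]
      exact ⟨fun _ => Sticker.ext_cubie_dir (hu.trans hvc.symm) g, fun _ => by omega⟩
  have hv : s.perm v = v := by
    rw [← hmark _ (by rw [hcub]; rfl)]
    exact hy v ht ((hmark v rfl).2 rfl)
  by_cases htv : t = v
  · rw [htv, hv]
  · have h1 : s.perm t ≠ v := fun h => htv (s.perm.injective (h.trans hv.symm))
    have only : ∀ u : Sticker n, u.cubie = t.cubie → u ≠ v → u.dir = p.1.1 := by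
      intro u hu huv
      rcases dir_eq_or_of_layer_eq_one hn hp hk (by omega) (hu ▸ u.2 : layer t.cubie.1 u.dir = 1)
        with g | g
      · exact g
      · exact absurd (Sticker.ext_cubie_dir (hu.trans hvc.symm) g) huv
    exact Sticker.ext_cubie_dir (hcub t)
      ((only _ (hcub t) h1).trans (only t rfl htv).symm)

/-- A center cubie has only one sticker. -/
theorem dir_eq_of_mem_orbit (hn : 2 ≤ n) {i j : ℕ} (hi : 1 < i) (hi' : i ≤ n / 2) (hj : 1 < j)
    (hj' : j ≤ (n + 1) / 2) {t t' : Sticker n} (h : t.cubie = t'.cubie)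
    (ht : t.cubie ∈ orbit n i j) : t.dir = t'.dir := by
  obtain ⟨p, hp⟩ := (mem_orbit_iff hi.le hi' _).1 ht
  have key : ∀ d, layer t.cubie.1 d = 1 → d = p.1.1 := by
    intro d hd
    rcases hp.layer_cases d with g | g | g | g | g | g
    · exact g.1
    all_goals omega
  rw [key t.dir t.2, key t'.dir (h ▸ t'.2)]

/-- A cubie that no move displaces has only one sticker. -/
theorem dir_eq_of_fixed (hn : 2 ≤ n) {t t' : Sticker n} (h : t.cubie = t'.cubie)
    (ht : ∀ m, moveCubies n m t.cubie = t.cubie) : t.dir = t'.dir := by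
  by_contra hne
  have h1 : layer t.cubie.1 t.dir = 1 := t.2
  have h2 : layer t.cubie.1 t'.dir = 1 := h ▸ t'.2
  have h3 := axis_ne_of_layer_eq_one hn h1 h2 fun e => hne e.symm
  have h4 := ht (FreeGroup.of (t.dir, ⟨1, le_rfl, by omega⟩))
  rw [moveCubies_of, turnCubie_apply, if_pos h1] at h4
  have := two_mul_layer_of_cwPos_eq (d := t'.dir) (congrArg Subtype.val h4) h3.symm
  omega

/-! ### The solution -/

/-- The conditions on signs and orientations suffice for a configuration to be valid. -/
theorem Configuration.SignCondition.isValid (hn : 2 ≤ n) {s : Configuration n}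
    (hs : s.SignCondition) (hx : ∑ t, s.x t = 0) (hz : Odd n → ∑ t, s.z t = 0)
    (hy : ∀ i, 1 < i → i ≤ n / 2 → s.y i = 0) : s.IsValid := by
  obtain ⟨m₀, hm₀⟩ := hs.exists_place_eq_one hn
  refine isValid_of_mul m₀ ?_
  have hy' : ∀ i, 1 < i → i ≤ n / 2 → ∀ t : Sticker n, t.cubie ∈ orbit n 1 i → CoupledMark t →
      CoupledMark ((ofMove m₀ * s).perm t) := by
    intro i hi hi' t ht hmark
    rw [coupledMark_ofMove_mul hn]
    have h1 : s.y i ⟨t, ht, hmark⟩ = 0 := by rw [hy i hi hi']; rfl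
    by_contra h2
    unfold y at h1
    rw [if_neg h2] at h1
    exact absurd h1 (by decide)
  have hx' := ((cornerMeasure hn).sum_ofMove_mul (sum_cornerTwist_ofRotation hn) m₀ s).2 hx
  have hz' : Odd n → ∑ t : SingleEdgeSticker n, singleValue ((ofMove m₀ * s).perm t.1) = 0 := by
    intro hodd
    have hm : 2 * ((n + 1) / 2) = n + 1 := by obtain ⟨a, rfl⟩ := hodd; omega
    exact ((edgeMeasure hn hm).sum_ofMove_mul (sum_singleValue_ofRotation hn hm) m₀ s).2 (hz hodd)
  generalize ofMove m₀ * s = s at hm₀ hy' hx' hz'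
  have hcub : ∀ t, (s.perm t).cubie = t.cubie := fun t => by rw [s.cubie_perm, hm₀]; rfl
  -- first the corners are turned, then the single edges
  obtain ⟨m₁, a1, a2, a3⟩ := (cornerMeasure hn).exists_oriented (sum_cornerTwist_ofRotation hn)
    (exchange_corner hn) s hm₀ hx'
  refine isValid_of_mul m₁ ?_
  obtain ⟨m₂, b1, b2, b3⟩ : ∃ m₂, moveCubies n m₂ = 1 ∧
      (∀ t : Sticker n, ¬ (Odd n ∧ t.cubie ∈ orbit n 1 ((n + 1) / 2)) → moveStickers n m₂ t = t) ∧
      ∀ t : Sticker n, Odd n → t.cubie ∈ orbit n 1 ((n + 1) / 2) →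
        (ofMove m₂ * (ofMove m₁ * s)).perm t = t := by
    by_cases hodd : Odd n
    · have hm : 2 * ((n + 1) / 2) = n + 1 := by obtain ⟨a, rfl⟩ := hodd; omega
      obtain ⟨m₂, b1, b2, b3⟩ := (edgeMeasure hn hm).exists_oriented
        (sum_singleValue_ofRotation hn hm) (exchange_edge hn hm) (ofMove m₁ * s)
        (by rw [place_mul, place_ofMove, a1, hm₀, one_mul])
        (((edgeMeasure hn hm).sum_ofMove_mul (sum_singleValue_ofRotation hn hm) m₁ s).2 (hz' hodd))
      exact ⟨m₂, b1, fun t ht => b2 t fun h => ht ⟨hodd, h⟩, fun t _ ht => b3 t ht⟩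
    · exact ⟨1, by simp, by simp, fun t h => absurd h hodd⟩
  refine isValid_of_mul m₂ ?_
  have hother : ∀ t : Sticker n, t.cubie ∉ orbit n 1 1 →
      ¬ (Odd n ∧ t.cubie ∈ orbit n 1 ((n + 1) / 2)) →
      (ofMove m₂ * (ofMove m₁ * s)).perm t = s.perm t := by
    intro t h1 h2
    rw [perm_mul, perm_mul, Equiv.Perm.mul_apply, Equiv.Perm.mul_apply, perm_ofMove, perm_ofMove,
      a2 _ (by rwa [hcub]), b2 _ (by rwa [hcub])]
  have hall : (ofMove m₂ * (ofMove m₁ * s)).perm = 1 := by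
    ext1 t
    show _ = t
    by_cases hcor : t.cubie ∈ orbit n 1 1
    · by_cases hedge : Odd n ∧ t.cubie ∈ orbit n 1 ((n + 1) / 2)
      · exact b3 t hedge.1 hedge.2
      · have h1 := a3 t hcor
        rw [perm_mul, Equiv.Perm.mul_apply, h1, perm_ofMove, b2 t hedge]
    · by_cases hedge : Odd n ∧ t.cubie ∈ orbit n 1 ((n + 1) / 2)
      · exact b3 t hedge.1 hedge.2
      · rw [hother t hcor hedge]
        rcases exists_orbit hn t.cubie with ⟨i, j, hi, hi', hj, hj', hij, ht⟩ | hfix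
        · have hj1 : 1 < j := by
            rcases hj.lt_or_eq with h | h
            · exact h
            · obtain rfl := h
              obtain rfl := hij rfl
              exact absurd ht hcor
          rcases hi.lt_or_eq with hi1 | hi1
          · exact Sticker.ext_cubie_dir (hcub t)
              (dir_eq_of_mem_orbit hn hi1 hi' hj1 hj' (hcub t) (by rwa [hcub]))
          · obtain rfl := hi1
            by_cases hjn : j ≤ n / 2
            · exact perm_eq_self_of_coupledMark hn hm₀ hj1 hjn (hy' j hj1 hjn) t ht
            · obtain rfl : j = (n + 1) / 2 := by omega
              exact absurd ⟨by rw [Nat.odd_iff]; omega, ht⟩ hedge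
        · exact Sticker.ext_cubie_dir (hcub t)
            (dir_eq_of_fixed hn (hcub t) fun m => by rw [hcub]; exact hfix m)
  exact ⟨1, by rw [map_one, hall]⟩

end

end RubikCube

theorem mainTheorem1 (n : ℕ) (hn : 2 ≤ n) (s : RubikCube.Configuration n) :
    (Odd n →
      RubikCube.sgn s.sigma = RubikCube.sgn s.tauS →
      (∀ i, 1 < i → i ≤ n / 2 → RubikCube.sgn s.sigma = RubikCube.sgn (s.rhoC i)) →
      (∀ i j, 1 < i → i ≤ n / 2 → 1 < j → j ≤ (n + 1) / 2 → j ≠ i →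
        RubikCube.sgn (s.rhoE i j) = RubikCube.sgn s.sigma * s.sgnTau i * s.sgnTau j) →
      ∑ t, s.x t = 0 →
      ∑ t, s.z t = 0 →
      (∀ i, 1 < i → i ≤ n / 2 → s.y i = 0) →
      s.IsValid) ∧
    (Even n →
      (∀ i, 1 < i → i ≤ n / 2 → RubikCube.sgn s.sigma = RubikCube.sgn (s.rhoC i)) →
      (∀ i j, 1 < i → i ≤ n / 2 → 1 < j → j ≤ (n + 1) / 2 → j ≠ i →
        RubikCube.sgn (s.rhoE i j) = RubikCube.sgn s.sigma * s.sgnTau i * s.sgnTau j) →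
      ∑ t, s.x t = 0 →
      (∀ i, 1 < i → i ≤ n / 2 → s.y i = 0) →
      s.IsValid) := by
  refine ⟨fun _ h1 h2 h3 hx hz hy => ?_, fun heven h2 h3 hx hy => ?_⟩
  · exact RubikCube.Configuration.SignCondition.isValid hn ⟨fun _ => h1, h2, h3⟩ hx (fun _ => hz) hy
  · have hodd : ¬ Odd n := Nat.not_odd_iff_even.2 heven
    exact RubikCube.Configuration.SignCondition.isValid hn ⟨fun h => absurd h hodd, h2, h3⟩ hx
      (fun h => absurd h hodd) hy
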